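/- Let $\mathbf F$ be an algebraically closed field of characteristic $p>0$ and let $G$ be a connected reductive algebraic group over $\mathbf F$ with Lie algebra $\mathfrak g$ and $p$-operation $x\mapsto x^{[p]}$, such that (H1) the derived group $DG$ is simply connected; (H2) $p$ is good for $\mathfrak g$; (H3) there is a $G$-invariant non-degenerate bilinear form on $\mathfrak g$. Let $T$ be a maximal torus of $G$, $\mathfrak h=\mathrm{Lie}(T)$, $\Phi$ the root system, $\Pi$ a base of $\Phi$, $\Phi^+$ the corresponding positive roots, and $\mathfrak g_\alpha$ ($\alpha\in\Phi$) the root spaces; put $\mathfrak n^+=\sum_{\alpha\in\Phi^+}\mathfrak g_\alpha$. Let $\chi\in\mathfrak g^*$ with $\chi(\mathfrak n^+)=0$. For a restricted subalgebra $\mathfrak l\subseteq\mathfrak g$ let $u_\chi(\mathfrak l)=U(\mathfrak l)/(x^p-x^{[p]}-\chi(x)^p : x\in\mathfrak l)$ be the $\chi$-reduced enveloping algebra. Let $I\subsetneq\Pi$, $\Phi_I=\mathbb ZI\cap\Phi$, $\Phi_I^+=\Phi_I\cap\Phi^+$, and let $\mathfrak p_I=\mathfrak h+\sum_{\alpha\in\Phi_I}\mathfrak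 g_\alpha+\sum_{\alpha\in\Phi^+\setminus\Phi_I^+}\mathfrak g_\alpha$. Let $L^\chi_I(\lambda)$ be a simple $u_\chi(\mathfrak p_I)$-module generated by a maximal vector $v_\lambda$ of weight $\lambda\in\mathfrak h^*$, i.e. $v_\lambda\neq0$, $\mathfrak n^+v_\lambda=0$, and $hv_\lambda=\lambda(h)v_\lambda$ for all $h\in\mathfrak h$. Put $Z^\chi_I(\lambda)=u_\chi(\mathfrak g)\otimes_{u_\chi(\mathfrak p_I)}L^\chi_I(\lambda)$. For $\alpha\in\Phi^+$ let $e_\alpha$, $f_\alpha$ be vectors with $\mathfrak g_\alpha=\mathbf Fe_\alpha$ and $\mathfrak g_{-\alpha}=\mathbf Ff_\alpha$ (for instance members of a Chevalley basis, up to sign), and let $\beta_1,\dots,\beta_k$ be the distinct elements of $\Phi^+\setminus\Phi_I^+$ in an order of ascending heights. Then there is a unique scalar $R^I_{\mathfrak g}(\lambda)\in\mathbf F$ with $$e_{\beta_1}^{p-1}\cdots e_{\beta_k}^{p-1}f_{\beta_1}^{p-1}\cdots f_{\beta_k}^{p-1}\otimes v_\lambda=R^I_{\mathfrak g}(\lambda)\,(1\otimes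 v_\lambda)\quad\text{in } Z^\chi_I(\lambda),$$ and if $R^I_{\mathfrak g}(\lambda)\neq0$, then the $u_\chi(\mathfrak g)$-module $Z^\chi_I(\lambda)$ is simple. -/

import Mathlib

attribute [local instance 100] LieRing.ofAssociativeRing

namespace ReductiveLie

open MvPolynomial

noncomputable section

/-! ### Linear algebraic groups -/

section Groups

variable {F : Type*} [Field F] {n : ℕ}

/-- The coordinates `(g_ij)` of an invertible matrix, as a point of affine `n²`-space. -/
def entries (g : GL (Fin n) F) : Fin n × Fin n → F := fun ij => (g : Matrix (Fin n) (Fin n) F) ij.1 ij.2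

/-- Zariski closed subsets of `GL_n(F)`. -/
def IsZariskiClosed (S : Set (GL (Fin n) F)) : Prop :=
  ∃ J : Set (MvPolynomial (Fin n × Fin n) F), S = {g | ∀ f ∈ J, eval (entries g) f = 0}

/-- Connectedness in the Zariski topology. -/
def IsZariskiConnected (S : Set (GL (Fin n) F)) : Prop :=
  S.Nonempty ∧ ∀ A B : Set (GL (Fin n) F), IsZariskiClosed A → IsZariskiClosed B →
    A ∪ B = S → Disjoint A B → A = ∅ ∨ B = ∅

/-- All elements of the group are unipotent matrices. -/
def IsUnipotentGroup (U : Subgroup (GL (Fin n) F)) : Prop :=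
  ∀ u ∈ U, IsNilpotent ((u : Matrix (Fin n) (Fin n) F) - 1)

/-- Connected reductive linear algebraic groups (over an algebraically closed field): Zariski
closed connected subgroups of some `GL_n` with trivial unipotent radical. -/
structure IsReductive (G : Subgroup (GL (Fin n) F)) : Prop where
  closed : IsZariskiClosed (G : Set (GL (Fin n) F))
  connected : IsZariskiConnected (G : Set (GL (Fin n) F))
  unipotentRadical_trivial : ∀ U : Subgroup (GL (Fin n) F), U ≤ G →
    IsZariskiClosed (U : Set (GL (Fin n) F)) → IsZariskiConnected (U : Set (GL (Fin n) F)) →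
    IsUnipotentGroup U → (∀ g ∈ G, ∀ u ∈ U, g * u * g⁻¹ ∈ U) → U = ⊥

/-- Tori: closed connected diagonalizable groups. -/
structure IsTorus (T : Subgroup (GL (Fin n) F)) : Prop where
  closed : IsZariskiClosed (T : Set (GL (Fin n) F))
  connected : IsZariskiConnected (T : Set (GL (Fin n) F))
  diagonalizable : ∃ P : GL (Fin n) F, ∀ t ∈ T,
    ((P * t * P⁻¹ : GL (Fin n) F) : Matrix (Fin n) (Fin n) F).IsDiag

/-- Maximal tori of `G`. -/
structure MaximalTorus (G : Subgroup (GL (Fin n) F)) where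
  /-- the underlying group -/
  grp : Subgroup (GL (Fin n) F)
  isTorus : IsTorus grp
  le : grp ≤ G
  maximal : ∀ T' : Subgroup (GL (Fin n) F), IsTorus T' → T' ≤ G → grp ≤ T' → T' = grp

variable {G : Subgroup (GL (Fin n) F)}

theorem IsTorus.mul_comm {T : Subgroup (GL (Fin n) F)} (hT : IsTorus T) {s t : GL (Fin n) F}
    (hs : s ∈ T) (ht : t ∈ T) : s * t = t * s := by
  obtain ⟨P, hP⟩ := hT.diagonalizable
  have h : (P * s * P⁻¹) * (P * t * P⁻¹) = (P * t * P⁻¹) * (P * s * P⁻¹) := by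
    apply Units.ext
    rw [Units.val_mul (P * s * P⁻¹), Units.val_mul (P * t * P⁻¹), ← (hP s hs).diagonal_diag,
      ← (hP t ht).diagonal_diag, Matrix.diagonal_mul_diagonal, Matrix.diagonal_mul_diagonal]
    simp only [_root_.mul_comm]
  have h2 : P * (s * t) * P⁻¹ = P * (t * s) * P⁻¹ := by
    simpa only [mul_assoc, inv_mul_cancel_left] using h
  exact mul_left_cancel (mul_right_cancel h2)

instance (T : MaximalTorus G) : CommGroup T.grp :=
  { (inferInstance : Group T.grp) with
    mul_comm := fun s t => Subtype.ext (T.isTorus.mul_comm s.2 t.2) }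

/-- The coordinate ring `F[H]`: the algebra of functions on `H` generated by the matrix entries of
`h` and those of `h⁻¹`. -/
def regularFunctions (H : Subgroup (GL (Fin n) F)) : Subalgebra F (H → F) :=
  Algebra.adjoin F
    (Set.range (fun ij (h : H) => entries (h : GL (Fin n) F) ij) ∪
      Set.range (fun ij (h : H) => entries ((h : GL (Fin n) F)⁻¹) ij))

/-- The coordinate ring of the multiplicative group: Laurent polynomial functions on `Fˣ`. -/
def laurentFunctions (F : Type*) [Field F] : Subalgebra F (Fˣ → F) :=
  Algebra.adjoin F ({fun z : Fˣ => (z : F)} ∪ {fun z : Fˣ => ((z⁻¹ : Fˣ) : F)})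

theorem regularFunctions_comp_inv (H : Subgroup (GL (Fin n) F)) {f : H → F}
    (hf : f ∈ regularFunctions H) : (fun h => f h⁻¹) ∈ regularFunctions H := by
  unfold regularFunctions at hf
  induction hf using Algebra.adjoin_induction with
  | mem x hx =>
    apply Algebra.subset_adjoin
    rcases hx with ⟨ij, rfl⟩ | ⟨ij, rfl⟩
    · right; exact ⟨ij, by funext h; simp⟩
    · left; exact ⟨ij, by funext h; simp⟩
  | algebraMap r => exact Subalgebra.algebraMap_mem _ r
  | add x y _ _ hx hy => exact Subalgebra.add_mem _ hx hy
  | mul x y _ _ hx hy => exact Subalgebra.mul_mem _ hx hy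

theorem laurentFunctions_comp_inv {f : Fˣ → F}
    (hf : f ∈ laurentFunctions F) : (fun z => f z⁻¹) ∈ laurentFunctions F := by
  unfold laurentFunctions at hf
  induction hf using Algebra.adjoin_induction with
  | mem x hx =>
    apply Algebra.subset_adjoin
    rcases hx with rfl | rfl
    · right; rfl
    · left; funext z; simp
  | algebraMap r => exact Subalgebra.algebraMap_mem _ r
  | add x y _ _ hx hy => exact Subalgebra.add_mem _ hx hy
  | mul x y _ _ hx hy => exact Subalgebra.mul_mem _ hx hy

/-- The algebraic characters of `T`. -/
def charGroup (T : MaximalTorus G) : Subgroup (T.grp →* Fˣ) where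
  carrier := {a | (fun t => (a t : F)) ∈ regularFunctions T.grp}
  one_mem' := by
    have : (fun t : T.grp => (((1 : T.grp →* Fˣ) t : Fˣ) : F)) = 1 := by funext t; simp
    simpa only [Set.mem_ofPred_eq, this] using Subalgebra.one_mem _
  mul_mem' := fun {a b} ha hb => by
    have : (fun t : T.grp => (((a * b) t : Fˣ) : F)) = (fun t => (a t : F)) * fun t => (b t : F) := by
      funext t; simp
    simpa only [Set.mem_ofPred_eq, this] using Subalgebra.mul_mem _ ha hb
  inv_mem' := fun {a} ha => by
    have : (fun t : T.grp => (((a⁻¹) t : Fˣ) : F)) = fun t => (a t⁻¹ : F) := by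
      funext t; simp
    simpa only [Set.mem_ofPred_eq, this] using regularFunctions_comp_inv _ ha

/-- The algebraic cocharacters of `T`. -/
def cocharGroup (T : MaximalTorus G) : Subgroup (Fˣ →* T.grp) where
  carrier := {c | ∀ ij, (fun z => entries (c z : GL (Fin n) F) ij) ∈ laurentFunctions F}
  one_mem' := fun ij => by
    have : (fun z : Fˣ => entries (((1 : Fˣ →* T.grp) z : T.grp) : GL (Fin n) F) ij) =
        algebraMap F (Fˣ → F) ((1 : Matrix (Fin n) (Fin n) F) ij.1 ij.2) := by
      funext z; simp [entries]
    rw [this]; exact Subalgebra.algebraMap_mem _ _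
  mul_mem' := fun {a b} ha hb ij => by
    have : (fun z : Fˣ => entries (((a * b) z : T.grp) : GL (Fin n) F) ij) =
        ∑ k, (fun z => entries (a z : GL (Fin n) F) (ij.1, k)) *
          (fun z => entries (b z : GL (Fin n) F) (k, ij.2)) := by
      funext z
      simp [entries, Matrix.mul_apply, Finset.sum_apply]
    rw [this]
    exact Subalgebra.sum_mem _ fun k _ => Subalgebra.mul_mem _ (ha _) (hb _)
  inv_mem' := fun {a} ha ij => by
    have : (fun z : Fˣ => entries (((a⁻¹) z : T.grp) : GL (Fin n) F) ij) =
        fun z => entries (a z⁻¹ : GL (Fin n) F) ij := by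
      funext z; simp
    rw [this]; exact laurentFunctions_comp_inv (ha ij)

/-- The character lattice `X(T)`, written additively. -/
abbrev CharLattice (T : MaximalTorus G) : Type _ := Additive (charGroup T)

/-- The cocharacter lattice `Y(T)`, written additively. -/
abbrev CocharLattice (T : MaximalTorus G) : Type _ := Additive (cocharGroup T)

/-- The value of a character. -/
def CharLattice.val {T : MaximalTorus G} (a : CharLattice T) (t : T.grp) : Fˣ := (a.toMul : T.grp →* Fˣ) t

/-- The value of a cocharacter. -/
def CocharLattice.val {T : MaximalTorus G} (c : CocharLattice T) (z : Fˣ) : T.grp := (c.toMul : Fˣ →* T.grp) z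

theorem CharLattice.val_add {T : MaximalTorus G} (a b : CharLattice T) (t : T.grp) :
    (a + b).val t = a.val t * b.val t := rfl

/-! ### The Lie algebra of a linear algebraic group -/

/-- The left-invariant derivation of `F[x_ij]` attached to a matrix `X`:
`(D_X f)(g) = d/dε f(g (1 + ε X))`. -/
def leftInvDer (X : Matrix (Fin n) (Fin n) F) :
    Derivation F (MvPolynomial (Fin n × Fin n) F) (MvPolynomial (Fin n × Fin n) F) :=
  mkDerivation F fun ij => ∑ k, MvPolynomial.X (ij.1, k) * C (X k ij.2)

theorem leftInvDer_X (A : Matrix (Fin n) (Fin n) F) (i j : Fin n) :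
    leftInvDer A (MvPolynomial.X (i, j)) = ∑ k, MvPolynomial.X (i, k) * C (A k j) := by
  simp [leftInvDer, mkDerivation_X]

theorem leftInvDer_add (A B : Matrix (Fin n) (Fin n) F) :
    leftInvDer (A + B) = leftInvDer A + leftInvDer B := by
  apply MvPolynomial.derivation_ext
  rintro ⟨i, j⟩
  simp [leftInvDer_X, mul_add, Finset.sum_add_distrib]

theorem leftInvDer_smul (c : F) (A : Matrix (Fin n) (Fin n) F) :
    leftInvDer (c • A) = c • leftInvDer A := by
  apply MvPolynomial.derivation_ext
  rintro ⟨i, j⟩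
  simp only [leftInvDer_X, Derivation.smul_apply, Finset.smul_sum, Matrix.smul_apply, smul_eq_mul,
    C_mul, smul_eq_C_mul]
  exact Finset.sum_congr rfl fun k _ => by ring

theorem leftInvDer_comp_X (A B : Matrix (Fin n) (Fin n) F) (i j : Fin n) :
    leftInvDer A (leftInvDer B (MvPolynomial.X (i, j))) = leftInvDer (A * B) (MvPolynomial.X (i, j)) := by
  have h : ∀ k l : Fin n, leftInvDer A (C (B k l)) = 0 := fun k l => derivation_C _ _
  simp only [leftInvDer_X, map_sum, Derivation.leibniz, h, smul_eq_mul, mul_zero, zero_add,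
    Matrix.mul_apply, C_mul, Finset.mul_sum]
  rw [Finset.sum_comm]
  exact Finset.sum_congr rfl fun k _ => Finset.sum_congr rfl fun l _ => by ring

theorem leftInvDer_lie (A B : Matrix (Fin n) (Fin n) F) :
    leftInvDer ⁅A, B⁆ = ⁅leftInvDer A, leftInvDer B⁆ := by
  apply MvPolynomial.derivation_ext
  rintro ⟨i, j⟩
  rw [Derivation.commutator_apply, leftInvDer_comp_X, leftInvDer_comp_X]
  simp [leftInvDer_X, Ring.lie_def, mul_sub, Finset.sum_sub_distrib]

/-- The ideal of polynomials vanishing on `H`. -/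
def idealOf (H : Subgroup (GL (Fin n) F)) : Ideal (MvPolynomial (Fin n × Fin n) F) :=
  vanishingIdeal F (entries '' (H : Set (GL (Fin n) F)))

/-- `Lie(H)` for a closed subgroup `H` of `GL_n`: the Lie subalgebra of `𝔤𝔩_n` of those `X` whose
left-invariant derivation preserves the ideal of `H`, i.e. the left-invariant derivations
of `F[H]`. Its `p`-operation is the `p`-th power of matrices. -/
def lieAlg (H : Subgroup (GL (Fin n) F)) : LieSubalgebra F (Matrix (Fin n) (Fin n) F) where
  carrier := {X | ∀ f ∈ idealOf H, leftInvDer X f ∈ idealOf H}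
  add_mem' := fun {A B} hA hB f hf => by
    rw [leftInvDer_add]; exact Ideal.add_mem _ (hA f hf) (hB f hf)
  zero_mem' := fun f hf => by
    have : leftInvDer (0 : Matrix (Fin n) (Fin n) F) = 0 := by
      simpa using leftInvDer_smul (0 : F) (0 : Matrix (Fin n) (Fin n) F)
    rw [this]; exact Ideal.zero_mem _
  smul_mem' := fun c A hA f hf => by
    rw [leftInvDer_smul, Derivation.smul_apply, smul_eq_C_mul]
    exact Ideal.mul_mem_left _ _ (hA f hf)
  lie_mem' := fun {A B} hA hB f hf => by
    rw [leftInvDer_lie, Derivation.commutator_apply]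
    exact Ideal.sub_mem _ (hA _ (hB f hf)) (hB _ (hA f hf))

open scoped TensorProduct in
/-- In characteristic `p`, the `p`-th iterate of a derivation satisfies the Leibniz rule. -/
theorem iterate_char_leibniz (p : ℕ) [Fact p.Prime] [CharP F p] {A : Type*} [CommRing A]
    [Algebra F A] (D : Derivation F A A) (a b : A) :
    (D : A →ₗ[F] A)^[p] (a * b) = a * (D : A →ₗ[F] A)^[p] b + b * (D : A →ₗ[F] A)^[p] a := by
  set d : Module.End F A := (D : A →ₗ[F] A) with hd
  let S₁ : Module.End F (A ⊗[F] A) := TensorProduct.map d LinearMap.id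
  let S₂ : Module.End F (A ⊗[F] A) := TensorProduct.map LinearMap.id d
  have hc : Commute S₁ S₂ := by
    apply TensorProduct.ext'
    intro x y
    simp [S₁, S₂, Module.End.mul_apply]
  have h1 : ∀ z, d (LinearMap.mul' F A z) = LinearMap.mul' F A ((S₁ + S₂) z) := by
    intro z
    induction z using TensorProduct.induction_on with
    | zero => simp
    | tmul x y => simp [S₁, S₂, hd, mul_comm, add_comm]
    | add x y hx hy => simp only [map_add, hx, hy]
  have h2 : ∀ (k : ℕ) z, d^[k] (LinearMap.mul' F A z) = LinearMap.mul' F A (((S₁ + S₂) ^ k) z) := by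
    intro k
    induction k with
    | zero => intro z; simp
    | succ k ih => intro z; rw [Function.iterate_succ_apply, h1, ih, pow_succ, Module.End.mul_apply]
  have hp1 : ∀ (k : ℕ) x y, (S₁ ^ k) (x ⊗ₜ[F] y) = (d^[k] x) ⊗ₜ[F] y := by
    intro k
    induction k with
    | zero => intro x y; simp
    | succ k ih => intro x y; rw [pow_succ, Module.End.mul_apply, Function.iterate_succ_apply, ← ih]; simp [S₁]
  have hp2 : ∀ (k : ℕ) x y, (S₂ ^ k) (x ⊗ₜ[F] y) = x ⊗ₜ[F] (d^[k] y) := by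
    intro k
    induction k with
    | zero => intro x y; simp
    | succ k ih => intro x y; rw [pow_succ, Module.End.mul_apply, Function.iterate_succ_apply, ← ih]; simp [S₂]
  have hp : (p : Module.End F (A ⊗[F] A)) = 0 := by
    rw [← map_natCast (algebraMap F (Module.End F (A ⊗[F] A))), CharP.cast_eq_zero, map_zero]
  have h3 : (S₁ + S₂) ^ p = S₁ ^ p + S₂ ^ p := by
    obtain ⟨r, hr⟩ := hc.exists_add_pow_prime_eq (Fact.out : p.Prime)
    rw [hr, hp]; simp
  have := h2 p (a ⊗ₜ[F] b)
  rw [h3, LinearMap.add_apply, hp1, hp2] at this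
  simpa [mul_comm, add_comm] using this

theorem derivation_eq_iterate (p : ℕ) [Fact p.Prime] [CharP F p] {σ : Type*}
    (D E : Derivation F (MvPolynomial σ F) (MvPolynomial σ F))
    (h : ∀ i, E (MvPolynomial.X i) =
      (D : MvPolynomial σ F →ₗ[F] MvPolynomial σ F)^[p] (MvPolynomial.X i))
    (f : MvPolynomial σ F) : E f = (D : MvPolynomial σ F →ₗ[F] MvPolynomial σ F)^[p] f := by
  have hp : p - 1 + 1 = p := Nat.sub_add_cancel (Fact.out : p.Prime).one_le
  induction f using MvPolynomial.induction_on with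
  | C a =>
    rw [← hp, Function.iterate_succ_apply]
    have h0 : (D : MvPolynomial σ F →ₗ[F] MvPolynomial σ F) (C a) = 0 := derivation_C D a
    rw [h0, ← Module.End.coe_pow, map_zero]
    exact derivation_C E a
  | add f g hf hg => rw [map_add, hf, hg, ← Module.End.coe_pow, map_add]
  | mul_X f i hf => rw [Derivation.leibniz, iterate_char_leibniz, hf, h, smul_eq_mul, smul_eq_mul]

theorem leftInvDer_iterate (p : ℕ) [Fact p.Prime] [CharP F p] (A : Matrix (Fin n) (Fin n) F)
    (f : MvPolynomial (Fin n × Fin n) F) :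
    leftInvDer (A ^ p) f = (leftInvDer A : MvPolynomial (Fin n × Fin n) F →ₗ[F]
      MvPolynomial (Fin n × Fin n) F)^[p] f := by
  have hX : ∀ (k : ℕ) (i j : Fin n),
      (leftInvDer A : MvPolynomial (Fin n × Fin n) F →ₗ[F]
        MvPolynomial (Fin n × Fin n) F)^[k + 1] (MvPolynomial.X (i, j)) =
        leftInvDer (A ^ (k + 1)) (MvPolynomial.X (i, j)) := by
    intro k i j
    induction k with
    | zero => simp
    | succ k ih =>
      rw [Function.iterate_succ_apply', ih, pow_succ' A (k + 1), ← leftInvDer_comp_X]; rfl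
  apply derivation_eq_iterate
  rintro ⟨i, j⟩
  have := hX (p - 1) i j
  rw [Nat.sub_add_cancel (Fact.out : p.Prime).one_le] at this
  exact this.symm

/-- `Lie(H)` is a restricted Lie algebra: it is closed under `X ↦ X^p`. -/
theorem pow_mem_lieAlg (p : ℕ) [Fact p.Prime] [CharP F p] (H : Subgroup (GL (Fin n) F))
    {A : Matrix (Fin n) (Fin n) F} (hA : A ∈ lieAlg H) : A ^ p ∈ lieAlg H := by
  intro f hf
  rw [leftInvDer_iterate]
  have : ∀ k : ℕ, (leftInvDer A : MvPolynomial (Fin n × Fin n) F →ₗ[F]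
      MvPolynomial (Fin n × Fin n) F)^[k] f ∈ idealOf H := by
    intro k
    induction k with
    | zero => exact hf
    | succ k ih => rw [Function.iterate_succ_apply']; exact hA _ ih
  exact this p

/-! ### Weight spaces, root datum, parabolic subalgebras -/

/-- The weight space `𝔤_μ = {X ∈ 𝔤 | Ad(t) X = μ(t) X for all t ∈ T}` for `μ ∈ X(T)`. -/
def weightSpace (T : MaximalTorus G) (μ : CharLattice T) : Submodule F (Matrix (Fin n) (Fin n) F) where
  carrier := {X | X ∈ lieAlg G ∧ ∀ t : T.grp,
    ((t : GL (Fin n) F) : Matrix (Fin n) (Fin n) F) * X *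
      (((t : GL (Fin n) F)⁻¹ : GL (Fin n) F) : Matrix (Fin n) (Fin n) F) = (μ.val t : F) • X}
  add_mem' := fun {A B} hA hB => ⟨add_mem hA.1 hB.1, fun t => by
    rw [mul_add, add_mul, hA.2, hB.2, smul_add]⟩
  zero_mem' := ⟨zero_mem _, fun t => by simp⟩
  smul_mem' := fun c A hA => ⟨SMulMemClass.smul_mem c hA.1, fun t => by
    rw [mul_smul_comm, smul_mul_assoc, hA.2, smul_comm]⟩

theorem lie_mem_weightSpace (T : MaximalTorus G) {μ ν : CharLattice T} {A B : Matrix (Fin n) (Fin n) F}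
    (hA : A ∈ weightSpace T μ) (hB : B ∈ weightSpace T ν) : ⁅A, B⁆ ∈ weightSpace T (μ + ν) := by
  refine ⟨LieSubalgebra.lie_mem _ hA.1 hB.1, fun t => ?_⟩
  have key : ∀ X Y : Matrix (Fin n) (Fin n) F,
      ((t : GL (Fin n) F) : Matrix (Fin n) (Fin n) F) * (X * Y) *
        (((t : GL (Fin n) F)⁻¹ : GL (Fin n) F) : Matrix (Fin n) (Fin n) F) =
      (((t : GL (Fin n) F) : Matrix (Fin n) (Fin n) F) * X *
        (((t : GL (Fin n) F)⁻¹ : GL (Fin n) F) : Matrix (Fin n) (Fin n) F)) *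
      (((t : GL (Fin n) F) : Matrix (Fin n) (Fin n) F) * Y *
        (((t : GL (Fin n) F)⁻¹ : GL (Fin n) F) : Matrix (Fin n) (Fin n) F)) := by
    intro X Y
    have h1 : (((t : GL (Fin n) F)⁻¹ : GL (Fin n) F) : Matrix (Fin n) (Fin n) F) *
        ((t : GL (Fin n) F) : Matrix (Fin n) (Fin n) F) = 1 := Units.inv_mul _
    calc _ = ((t : GL (Fin n) F) : Matrix (Fin n) (Fin n) F) * X * 1 * Y *
        (((t : GL (Fin n) F)⁻¹ : GL (Fin n) F) : Matrix (Fin n) (Fin n) F) := by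
          simp only [mul_assoc, one_mul]
      _ = _ := by rw [← h1]; simp only [mul_assoc]
  rw [Ring.lie_def, mul_sub, sub_mul, key, key, hA.2, hB.2, CharLattice.val_add]
  simp only [smul_mul_smul_comm, Units.val_mul, smul_sub]
  rw [mul_comm (ν.val t : F)]

/-- The Cartan subalgebra `𝔥 = 𝔤^T`, the weight space of weight zero. As `T` is a maximal torus of a
connected reductive group, `𝔥 = Lie(T)`. -/
def cartan (T : MaximalTorus G) : Submodule F (Matrix (Fin n) (Fin n) F) := weightSpace T 0

variable {ι : Type*}

/-- `R` is the root datum `(X(T), Φ, Y(T), Φ^∨)` of `G` with respect to `T`: the lattices are in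
their natural duality, `Φ` is the set of nonzero weights of `T` in `𝔤`, and the coroots are
cocharacters of the derived group. (These conditions determine the coroots.) -/
structure IsRootDatumOf (T : MaximalTorus G) (R : RootPairing ι ℤ (CharLattice T) (CocharLattice T)) :
    Prop where
  pairing : ∀ (a : CharLattice T) (c : CocharLattice T) (z : Fˣ), a.val (c.val z) = z ^ (R.toLinearMap a c)
  roots : Set.range R.root = {μ : CharLattice T | μ ≠ 0 ∧ weightSpace T μ ≠ ⊥}
  coroots : ∀ (i : ι) (z : Fˣ), ((R.coroot i).val z : GL (Fin n) F) ∈ ⁅G, G⁆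

/-- The derived group of `G` is simply connected: the cocharacters of the maximal torus `T ∩ DG` of
`DG` are integral combinations of coroots. -/
def DerivedSimplyConnected {T : MaximalTorus G} (R : RootPairing ι ℤ (CharLattice T) (CocharLattice T)) : Prop :=
  ∀ c : CocharLattice T, (∀ z, (c.val z : GL (Fin n) F) ∈ ⁅G, G⁆) →
    c ∈ AddSubgroup.closure (Set.range R.coroot)

/-- The prime `p` is good: it divides no nonzero coefficient of a root written as an integral
combination of simple roots. -/
def IsGoodPrime {T : MaximalTorus G} {R : RootPairing ι ℤ (CharLattice T) (CocharLattice T)} (p : ℕ)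
    (b : R.Base) : Prop :=
  ∀ (i : ι) (c : ι → ℤ), R.root i = ∑ j ∈ b.support, c j • R.root j →
    ∀ j ∈ b.support, (p : ℤ) ∣ c j → c j = 0

/-- There is a nondegenerate bilinear form on `𝔤 = Lie(G)` invariant under the adjoint action
`Ad(g) X = g X g⁻¹` of `G`. -/
def HasInvariantForm (G : Subgroup (GL (Fin n) F)) : Prop :=
  ∃ B : LinearMap.BilinForm F (lieAlg G), B.Nondegenerate ∧
    ∀ g ∈ G, ∀ X Y X' Y' : lieAlg G,
      (X' : Matrix (Fin n) (Fin n) F) =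
        (g : Matrix (Fin n) (Fin n) F) * X * ((g⁻¹ : GL (Fin n) F) : Matrix (Fin n) (Fin n) F) →
      (Y' : Matrix (Fin n) (Fin n) F) =
        (g : Matrix (Fin n) (Fin n) F) * Y * ((g⁻¹ : GL (Fin n) F) : Matrix (Fin n) (Fin n) F) →
      B X' Y' = B X Y

variable {T : MaximalTorus G} {R : RootPairing ι ℤ (CharLattice T) (CocharLattice T)}

/-- `α_i ∈ Φ_I = ℤI ∩ Φ`. -/
def InLevi (R : RootPairing ι ℤ (CharLattice T) (CocharLattice T)) (I : Finset ι) (i : ι) : Prop :=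
  R.root i ∈ AddSubgroup.closure (R.root '' I)

/-- `α_i` is positive: a sum of simple roots. -/
def IsPositive (b : R.Base) (i : ι) : Prop :=
  R.root i ∈ AddSubmonoid.closure (R.root '' b.support)

/-- The Levi factor `𝔤̃_I = 𝔥 + ∑_{α ∈ Φ_I} 𝔤_α`. -/
def levi (R : RootPairing ι ℤ (CharLattice T) (CocharLattice T)) (I : Finset ι) :
    Submodule F (Matrix (Fin n) (Fin n) F) :=
  cartan T ⊔ ⨆ (i : ι) (_ : InLevi R I i), weightSpace T (R.root i)

/-- `𝔲 = ∑_{α ∈ Φ⁺ ∖ Φ_I⁺} 𝔤_α`. -/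
def nilradical (b : R.Base) (I : Finset ι) : Submodule F (Matrix (Fin n) (Fin n) F) :=
  ⨆ (i : ι) (_ : IsPositive b i ∧ ¬ InLevi R I i), weightSpace T (R.root i)

/-- The weights of `𝔭_I`. -/
def parabolicWeights (b : R.Base) (I : Finset ι) : Set (CharLattice T) :=
  {μ | μ = 0 ∨ ∃ i, R.root i = μ ∧ (InLevi R I i ∨ IsPositive b i)}

theorem levi_sup_nilradical (b : R.Base) (I : Finset ι) :
    levi R I ⊔ nilradical b I = ⨆ μ ∈ parabolicWeights b I, weightSpace T μ := by
  apply le_antisymm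
  · refine sup_le (sup_le ?_ ?_) ?_
    · exact le_iSup₂_of_le 0 (Or.inl rfl) le_rfl
    · exact iSup₂_le fun i hi => le_iSup₂_of_le (R.root i) (Or.inr ⟨i, rfl, Or.inl hi⟩) le_rfl
    · exact iSup₂_le fun i hi => le_iSup₂_of_le (R.root i) (Or.inr ⟨i, rfl, Or.inr hi.1⟩) le_rfl
  · refine iSup₂_le fun μ hμ => ?_
    rcases hμ with rfl | ⟨i, rfl, hi⟩
    · exact le_sup_of_le_left le_sup_left
    · by_cases h : InLevi R I i
      · exact le_sup_of_le_left (le_sup_of_le_right (le_iSup₂_of_le i h le_rfl))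
      · exact le_sup_of_le_right (le_iSup₂_of_le i ⟨hi.resolve_left h, h⟩ le_rfl)


theorem exists_nat_sum {M : Type*} [AddCommGroup M] {v : ι → M} {s : Finset ι} {x : M}
    (hx : x ∈ AddSubmonoid.closure (v '' s)) : ∃ f : ι → ℕ, x = ∑ j ∈ s, f j • v j := by
  classical
  induction hx using AddSubmonoid.closure_induction with
  | mem y hy =>
    obtain ⟨i, hi, rfl⟩ := hy
    exact ⟨Pi.single i 1, by simp [Pi.single_apply, ite_smul, Finset.mem_coe.mp hi]⟩
  | zero => exact ⟨0, by simp⟩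
  | add y z _ _ hy hz =>
    obtain ⟨f, rfl⟩ := hy
    obtain ⟨g, rfl⟩ := hz
    exact ⟨f + g, by simp [add_smul, Finset.sum_add_distrib]⟩

theorem exists_int_sum {M : Type*} [AddCommGroup M] {v : ι → M} {s : Finset ι} {x : M}
    (hx : x ∈ AddSubgroup.closure (v '' s)) : ∃ f : ι → ℤ, x = ∑ j ∈ s, f j • v j := by
  classical
  induction hx using AddSubgroup.closure_induction with
  | mem y hy =>
    obtain ⟨i, hi, rfl⟩ := hy
    exact ⟨Pi.single i 1, by simp [Pi.single_apply, ite_smul, Finset.mem_coe.mp hi]⟩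
  | zero => exact ⟨0, by simp⟩
  | add y z _ _ hy hz =>
    obtain ⟨f, rfl⟩ := hy
    obtain ⟨g, rfl⟩ := hz
    exact ⟨f + g, by simp [add_smul, Finset.sum_add_distrib]⟩
  | neg y _ hy =>
    obtain ⟨f, rfl⟩ := hy
    exact ⟨-f, by simp⟩

theorem mem_closure_of_add_mem {M : Type*} [AddCommGroup M] {v : ι → M} {s I : Finset ι}
    (hv : LinearIndepOn ℤ v s) (hI : I ⊆ s) {x y : M} (hx : x ∈ AddSubmonoid.closure (v '' s))
    (hy : y ∈ AddSubmonoid.closure (v '' s)) (hxy : x + y ∈ AddSubgroup.closure (v '' I)) :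
    x ∈ AddSubgroup.closure (v '' I) := by
  classical
  obtain ⟨f, rfl⟩ := exists_nat_sum hx
  obtain ⟨g, rfl⟩ := exists_nat_sum hy
  obtain ⟨c, hc⟩ := exists_int_sum hxy
  have h0 : ∑ j ∈ s, ((f j : ℤ) + g j - if j ∈ I then c j else 0) • v j = 0 := by
    simp only [sub_smul, add_smul, Finset.sum_sub_distrib, Finset.sum_add_distrib, natCast_zsmul,
      hc, ite_smul, zero_smul]
    rw [← Finset.sum_filter, Finset.filter_mem_eq_inter, Finset.inter_eq_right.mpr hI, sub_self]
  have h1 := linearIndepOn_finset_iff.mp hv _ h0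
  refine AddSubgroup.sum_mem _ fun j hj => ?_
  by_cases hjI : j ∈ I
  · exact AddSubgroup.nsmul_mem _ (AddSubgroup.subset_closure (Set.mem_image_of_mem v (Finset.mem_coe.mpr hjI))) _
  · have := h1 j hj
    rw [if_neg hjI] at this
    have hf : f j = 0 := by omega
    rw [hf, zero_smul]
    exact AddSubgroup.zero_mem _

theorem add_mem_parabolicWeights (hR : IsRootDatumOf T R) (b : R.Base) {I : Finset ι}
    (hI : I ⊆ b.support) {μ ν : CharLattice T} (hμ : μ ∈ parabolicWeights b I)
    (hν : ν ∈ parabolicWeights b I) (h : weightSpace T (μ + ν) ≠ ⊥) :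
    μ + ν ∈ parabolicWeights b I := by
  by_cases h0 : μ + ν = 0
  · exact Or.inl h0
  have hk : μ + ν ∈ Set.range R.root := by rw [hR.roots]; exact ⟨h0, h⟩
  obtain ⟨k, hk⟩ := hk
  rcases hμ with rfl | ⟨i, rfl, hi⟩
  · simpa using hν
  rcases hν with rfl | ⟨j, rfl, hj⟩
  · rw [add_zero]; exact Or.inr ⟨i, rfl, hi⟩
  refine Or.inr ⟨k, hk, ?_⟩
  have aux : ∀ i j : ι, R.root k = R.root i + R.root j → InLevi R I i → IsPositive b j →
      InLevi R I k ∨ IsPositive b k := by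
    intro i j hk hi hj
    rcases b.root_mem_or_neg_mem k with hp | hp
    · exact Or.inr hp
    · left
      have : R.root j ∈ AddSubgroup.closure (R.root '' I) := by
        refine mem_closure_of_add_mem b.linearIndepOn_root hI hj hp ?_
        have e : R.root j + -R.root k = -R.root i := by rw [hk]; abel
        rw [e]; exact AddSubgroup.neg_mem _ hi
      unfold InLevi
      rw [hk]; exact AddSubgroup.add_mem _ hi this
  rcases hi with hi | hi <;> rcases hj with hj | hj
  · left; unfold InLevi; rw [hk]; exact AddSubgroup.add_mem _ hi hj
  · exact aux i j hk hi hj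
  · exact aux j i (by rw [hk, add_comm]) hj hi
  · right; unfold IsPositive; rw [hk]; exact AddSubmonoid.add_mem _ hi hj

/-- The parabolic subalgebra `𝔭_I = 𝔤̃_I + 𝔲`. -/
def parabolic (hR : IsRootDatumOf T R) (b : R.Base) (I : Finset ι) (hI : I ⊆ b.support) :
    LieSubalgebra F (Matrix (Fin n) (Fin n) F) :=
  { levi R I ⊔ nilradical b I with
    lie_mem' := by
      intro x y hx hy
      simp only [AddSubsemigroup.mem_carrier, AddSubmonoid.mem_toSubsemigroup,
        Submodule.mem_toAddSubmonoid] at hx hy ⊢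
      rw [levi_sup_nilradical, iSup_subtype'] at hx hy ⊢
      induction hx using Submodule.iSup_induction' with
      | zero => rw [zero_lie]; exact zero_mem _
      | add x₁ x₂ _ _ h₁ h₂ => rw [add_lie]; exact add_mem h₁ h₂
      | mem μ x hx =>
        induction hy using Submodule.iSup_induction' with
        | zero => rw [lie_zero]; exact zero_mem _
        | add y₁ y₂ _ _ h₁ h₂ => rw [lie_add]; exact add_mem h₁ h₂
        | mem ν y hy =>
          have hxy := lie_mem_weightSpace T hx hy
          by_cases h : weightSpace T ((μ : CharLattice T) + ν) = ⊥
          · rw [h, Submodule.mem_bot] at hxy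
            rw [hxy]; exact zero_mem _
          · exact Submodule.mem_iSup_of_mem
              (p := fun μ : parabolicWeights b I => weightSpace T μ)
              ⟨_, add_mem_parabolicWeights hR b hI μ.2 ν.2 h⟩ hxy }

theorem mem_parabolic (hR : IsRootDatumOf T R) (b : R.Base) (I : Finset ι) (hI : I ⊆ b.support)
    (x : Matrix (Fin n) (Fin n) F) :
    x ∈ parabolic hR b I hI ↔ x ∈ levi R I ⊔ nilradical b I := Iff.rfl

theorem weightSpace_le (μ : CharLattice T) : weightSpace T μ ≤ (lieAlg G).toSubmodule :=
  fun _ h => h.1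

theorem parabolic_le (hR : IsRootDatumOf T R) (b : R.Base) (I : Finset ι) (hI : I ⊆ b.support) :
    parabolic hR b I hI ≤ lieAlg G := by
  intro x hx
  rw [mem_parabolic, levi_sup_nilradical] at hx
  exact (iSup₂_le fun μ _ => weightSpace_le μ :
    (⨆ μ ∈ parabolicWeights b I, weightSpace T μ) ≤ (lieAlg G).toSubmodule) hx

end Groups

/-! ### Reduced enveloping algebras and induced modules -/

section Enveloping

variable {F : Type*} [Field F] {n : ℕ}

/-- The relations `x^p = x^{[p]} + χ(x)^p` for `x ∈ 𝔩`, where `x^{[p]} = y` is the `p`-th power of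
the matrix `x`. -/
inductive ReducedRel (p : ℕ) (𝔩 : LieSubalgebra F (Matrix (Fin n) (Fin n) F))
    (χ : Module.Dual F 𝔩) :
    UniversalEnvelopingAlgebra F 𝔩 → UniversalEnvelopingAlgebra F 𝔩 → Prop
  | pth (x y : 𝔩) (h : (y : Matrix (Fin n) (Fin n) F) = (x : Matrix (Fin n) (Fin n) F) ^ p) :
      ReducedRel p 𝔩 χ (UniversalEnvelopingAlgebra.ι F x ^ p)
        (UniversalEnvelopingAlgebra.ι F y + algebraMap F _ (χ x ^ p))

/-- The `χ`-reduced enveloping algebra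
`u_χ(𝔩) = U(𝔩) / (x^p - x^{[p]} - χ(x)^p : x ∈ 𝔩)` of a restricted Lie subalgebra `𝔩` of `𝔤𝔩_n`. -/
abbrev ReducedEnv (p : ℕ) (𝔩 : LieSubalgebra F (Matrix (Fin n) (Fin n) F))
    (χ : Module.Dual F 𝔩) : Type _ :=
  RingQuot (ReducedRel p 𝔩 χ)

/-- The canonical map `𝔩 → u_χ(𝔩)`. -/
def toEnv (p : ℕ) (𝔩 : LieSubalgebra F (Matrix (Fin n) (Fin n) F)) (χ : Module.Dual F 𝔩) :
    𝔩 →ₗ⁅F⁆ ReducedEnv p 𝔩 χ :=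
  (RingQuot.mkAlgHom F (ReducedRel p 𝔩 χ)).toLieHom.comp (UniversalEnvelopingAlgebra.ι F)

/-- Restriction of a linear form to a subalgebra. -/
def restrictForm {𝔭 𝔤 : LieSubalgebra F (Matrix (Fin n) (Fin n) F)} (h : 𝔭 ≤ 𝔤)
    (χ : Module.Dual F 𝔤) : Module.Dual F 𝔭 :=
  χ ∘ₗ (LieSubalgebra.inclusion h : 𝔭 →ₗ[F] 𝔤)

theorem toEnv_pow (p : ℕ) (𝔩 : LieSubalgebra F (Matrix (Fin n) (Fin n) F)) (χ : Module.Dual F 𝔩)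
    (x y : 𝔩) (h : (y : Matrix (Fin n) (Fin n) F) = (x : Matrix (Fin n) (Fin n) F) ^ p) :
    toEnv p 𝔩 χ x ^ p = toEnv p 𝔩 χ y + algebraMap F _ (χ x ^ p) := by
  have := RingQuot.mkAlgHom_rel F (ReducedRel.pth (χ := χ) x y h)
  rw [map_pow, map_add, AlgHom.commutes] at this
  exact this

/-- The algebra homomorphism `u_χ(𝔭) → u_χ(𝔤)` for a subalgebra `𝔭` of `𝔤`. -/
def envMap (p : ℕ) {𝔭 𝔤 : LieSubalgebra F (Matrix (Fin n) (Fin n) F)} (h : 𝔭 ≤ 𝔤)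
    (χ : Module.Dual F 𝔤) : ReducedEnv p 𝔭 (restrictForm h χ) →ₐ[F] ReducedEnv p 𝔤 χ :=
  RingQuot.liftAlgHom F
    ⟨UniversalEnvelopingAlgebra.lift F ((toEnv p 𝔤 χ).comp (LieSubalgebra.inclusion h)), by
      rintro _ _ ⟨x, y, hxy⟩
      rw [map_pow, map_add, AlgHom.commutes, UniversalEnvelopingAlgebra.lift_ι_apply,
        UniversalEnvelopingAlgebra.lift_ι_apply]
      exact toEnv_pow p 𝔤 χ (LieSubalgebra.inclusion h x) (LieSubalgebra.inclusion h y) hxy⟩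

end Enveloping

section Induced

variable {F A B L : Type*} [Field F] [Ring A] [Algebra F A] [Ring B] [Algebra F B]
  [AddCommGroup L] [Module F L] [Module B L]

open scoped TensorProduct

/-- The relations `a φ(b) ⊗ v = a ⊗ b v`. -/
def inducedRel (φ : B →ₐ[F] A) (L : Type*) [AddCommGroup L] [Module F L] [Module B L] :
    Submodule A (A ⊗[F] L) :=
  Submodule.span A {x | ∃ (a : A) (b : B) (v : L), x = (a * φ b) ⊗ₜ[F] v - a ⊗ₜ[F] (b • v)}

/-- The induced `A`-module `A ⊗_B L` for an algebra homomorphism `φ : B → A`. -/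
abbrev Induced (φ : B →ₐ[F] A) (L : Type*) [AddCommGroup L] [Module F L] [Module B L] : Type _ :=
  (A ⊗[F] L) ⧸ inducedRel φ L

/-- The element `a ⊗ v` of `A ⊗_B L`. -/
def Induced.tmul (φ : B →ₐ[F] A) (a : A) (v : L) : Induced φ L :=
  (inducedRel φ L).mkQ (a ⊗ₜ[F] v)

end Induced

end

end ReductiveLie

open ReductiveLie

/-!
# Simplicity of modules induced from a parabolic subalgebra

Write `A = u_χ(𝔤)`, `Z = A ⊗ L` for the induced module, `j(l) = 1 ⊗ l`, and `E`, `E'` for the top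
monomials in the `e_β` and in the `f_β`, `β ∈ Φ⁺ ∖ Φ_I⁺`. Grade `𝔤` by the sum of the coefficients of a
root at the simple roots outside `I` (`degreeSpace`), so that `𝔭` is the part of degree at least zero
and the `f_β` span the part of negative degree. The `e_β` span an ideal of `𝔭` whose invariants
in `L` form a submodule, which is `L` as it contains the maximal vector (`toEnv_smul_eq_zero`).
Hence `Z` is the sum of the spans of the vectors `f_{β_1} ⋯ f_{β_r} j(l)` of given degree, which `𝔤`
shifts according to its grading (`smul_mem_levelSpan`). So `E` kills `f^m j(l)` for every ordered
monomial `f^m` with exponents below `p` other than `E'`, and maps `E' j(l)` into `j(L)`.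

By the collecting process (`wordSpan_le_span_orderedMonomial`), rearranging a word in the `f_β` changes
it by shorter words, and `f_β ^ p` is a scalar. So `E w j(l)`, for a word `w` no longer than `E'`, is
`E E' j(l)` if `w` is a rearrangement of `E'`, and zero otherwise (`topMul_word_eq_top`,
`topMul_word_eq_zero`). The theorem follows by two applications.

* For `x ∈ 𝔭` of degree zero, the commutators of `x` with `E` and `E'` are multiples of these, up to
  words which contribute nothing, and the multiples are opposite: for `x` in the Cartan subalgebra,
  because a nondegenerate invariant form pairs opposite root spaces (`add_eq_zero_of_lie_eq_smul`); for
  `x` in a root space of the Levi factor, because both are zero. So `l ↦ E E' j(l)` is an endomorphism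
  of `L`, a scalar by Schur's lemma (`exists_top_mul_top_smul_eq`).
* A nonzero vector of `Z` is a sum of terms `f^m j(l_m)`. Take a longest `f^m` with `l_m ≠ 0` and
  multiply by the complementary monomial, then by `E`: only this term survives and gives
  `E E' j(l_m)` (`exists_smul_eq_map`). If the scalar is nonzero, every nonzero submodule of `Z`
  therefore meets `j(L)`, so it contains `j(L)` and is `Z`.

The scalar is unique because `1 ⊗ v ≠ 0`. This needs the freeness of `A` over `u_χ(𝔭)`
(`exists_retraction_envMap`), hence the linear independence of the ordered monomials in `A`
(`linearIndependent_orderedMonomial`). It is obtained from a representation (`envRep`): a matrix `X`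
acts on the polynomial functions on matrices by `D_X + D_X(s)`, where `D_X` is the left-invariant
derivation and `s` is a linear function extending `χ`. By Hochschild's formula the `p`-th power
of this operator is the operator of `X ^ p` plus the multiplication by `D_X(s) ^ p`, which is `χ(X) ^ p`
on the functions modulo the `x_ij ^ p - δ_ij`; and to leading order at the identity matrix the
operators are partial derivatives.
-/

/-! ### Collecting words in an algebra with a finite set of generators -/

section Collecting

variable {F A ι Γ : Type*} [Field F] [Ring A] [Algebra F A] [AddCommMonoid Γ]

variable (F) in
/-- The span of the words of length at most `r` and total weight `γ` in the elements `x i`, `i ∈ β`.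
The weights `wt i` lie in an arbitrary commutative monoid; the trivial one gives the plain length
filtration. -/
def wordSpan (x : ι → A) (β : List ι) (wt : ι → Γ) (r : ℕ) (γ : Γ) : Submodule F A :=
  Submodule.span F {a | ∃ w : List ι, w ⊆ β ∧ w.length ≤ r ∧ (w.map wt).sum = γ ∧
    (w.map x).prod = a}

/-- The ordered monomial `∏ i ∈ β, x i ^ m i`. -/
def orderedMonomial (x : ι → A) (β : List ι) (m : ι → ℕ) : A := (β.map fun i => x i ^ m i).prod

/-- The word spelling an ordered monomial. -/
def orderedWord (β : List ι) (m : ι → ℕ) : List ι := β.flatMap fun i => List.replicate (m i) i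

theorem prod_map_orderedWord (x : ι → A) (β : List ι) (m : ι → ℕ) :
    ((orderedWord β m).map x).prod = orderedMonomial x β m := by
  induction β with
  | nil => simp [orderedWord, orderedMonomial]
  | cons i β ih =>
    simp only [orderedWord, orderedMonomial, List.flatMap_cons, List.map_append, List.prod_append,
      List.map_cons, List.prod_cons, List.map_replicate, List.prod_replicate] at ih ⊢
    rw [ih]

theorem sum_map_orderedWord (wt : ι → Γ) (β : List ι) (m : ι → ℕ) :
    ((orderedWord β m).map wt).sum = (β.map fun i => m i • wt i).sum := by
  induction β with
  | nil => simp [orderedWord]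
  | cons i β ih =>
    simp only [orderedWord, List.flatMap_cons, List.map_append, List.sum_append,
      List.map_cons, List.sum_cons, List.map_replicate, List.sum_replicate] at ih ⊢
    rw [ih]

theorem length_orderedWord (β : List ι) (m : ι → ℕ) :
    (orderedWord β m).length = (β.map m).sum := by
  simp [orderedWord, List.length_flatMap]

theorem orderedWord_subset (β : List ι) (m : ι → ℕ) : orderedWord β m ⊆ β := by
  intro i hi
  simp only [orderedWord, List.mem_flatMap, List.mem_replicate] at hi
  obtain ⟨j, hj, -, rfl⟩ := hi
  exact hj

theorem count_orderedWord [DecidableEq ι] {β : List ι} (hβ : β.Nodup) (m : ι → ℕ) {i : ι}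
    (hi : i ∈ β) : (orderedWord β m).count i = m i := by
  induction β with
  | nil => simp at hi
  | cons j β ih =>
    rw [List.nodup_cons] at hβ
    have e : orderedWord (j :: β) m = List.replicate (m j) j ++ orderedWord β m := by
      simp [orderedWord]
    rw [e, List.count_append, List.count_replicate]
    by_cases h : i = j
    · subst h
      have : (orderedWord β m).count i = 0 :=
        List.count_eq_zero.mpr fun h => hβ.1 (orderedWord_subset β m h)
      simp [this]
    · have h' : ¬ j = i := fun e => h e.symm
      rw [ih hβ.2 ((List.mem_cons.mp hi).resolve_left h)]
      simp [h']

theorem perm_orderedWord [DecidableEq ι] {β : List ι} (hβ : β.Nodup) {w : List ι} (hw : w ⊆ β)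
    {m : ι → ℕ} (hm : ∀ i ∈ β, w.count i = m i) : w.Perm (orderedWord β m) := by
  rw [List.perm_iff_count]
  intro i
  by_cases hi : i ∈ β
  · rw [count_orderedWord hβ m hi, hm i hi]
  · rw [List.count_eq_zero.mpr fun h => hi (hw h),
      List.count_eq_zero.mpr fun h => hi (orderedWord_subset β m h)]

variable {x : ι → A} {β : List ι} {wt : ι → Γ}

theorem word_mem_wordSpan {w : List ι} (hw : w ⊆ β) {r : ℕ} (hr : w.length ≤ r) {γ : Γ}
    (hγ : (w.map wt).sum = γ) : (w.map x).prod ∈ wordSpan F x β wt r γ :=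
  Submodule.subset_span ⟨w, hw, hr, hγ, rfl⟩

theorem wordSpan_mono {r s : ℕ} (h : r ≤ s) (γ : Γ) :
    wordSpan F x β wt r γ ≤ wordSpan F x β wt s γ :=
  Submodule.span_mono fun _ ⟨w, h1, h2, h3, h4⟩ => ⟨w, h1, h2.trans h, h3, h4⟩

theorem mul_mem_wordSpan {r s : ℕ} {γ δ : Γ} {a b : A} (ha : a ∈ wordSpan F x β wt r γ)
    (hb : b ∈ wordSpan F x β wt s δ) : a * b ∈ wordSpan F x β wt (r + s) (γ + δ) := by
  have := Submodule.mul_mem_mul ha hb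
  rw [wordSpan, wordSpan, Submodule.span_mul_span] at this
  refine Submodule.span_mono ?_ this
  rintro _ ⟨_, ⟨w, h1, h2, rfl, rfl⟩, _, ⟨w', h1', h2', rfl, rfl⟩, rfl⟩
  refine ⟨w ++ w', List.append_subset.mpr ⟨h1, h1'⟩, ?_, by simp, by simp⟩
  rw [List.length_append]; omega

theorem generator_mem_wordSpan {i : ι} (hi : i ∈ β) : x i ∈ wordSpan F x β wt 1 (wt i) := by
  have := word_mem_wordSpan (F := F) (x := x) (wt := wt) (β := β) (w := [i]) (by simpa using hi)
    (r := 1) (by simp) rfl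
  simpa using this

variable (F) in
/-- The commutators of the generators are combinations of generators of the right weight. -/
def CommutatorsInSpan (x : ι → A) (β : List ι) (wt : ι → Γ) : Prop :=
  ∀ i ∈ β, ∀ j ∈ β, x i * x j - x j * x i ∈
    Submodule.span F (x '' {k | k ∈ β ∧ wt k = wt i + wt j})

theorem span_generators_le_wordSpan (γ : Γ) :
    Submodule.span F (x '' {k | k ∈ β ∧ wt k = γ}) ≤ wordSpan F x β wt 1 γ := by
  rw [Submodule.span_le]
  rintro _ ⟨k, ⟨hk, rfl⟩, rfl⟩
  exact generator_mem_wordSpan hk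

/-- Rearranging a word changes it by shorter words of the same weight. -/
theorem prod_sub_prod_mem_of_perm (hc : CommutatorsInSpan F x β wt) {w w' : List ι}
    (h : w.Perm w') (hw : w ⊆ β) :
    (w.map x).prod - (w'.map x).prod ∈ wordSpan F x β wt (w.length - 1) (w.map wt).sum := by
  induction h with
  | nil => simp
  | @cons i l l' h ih =>
    rw [List.cons_subset] at hw
    rcases l.eq_nil_or_concat with hl | ⟨_, _, hl⟩
    · subst hl
      rw [h.nil_eq]; simp
    · have hl : 1 ≤ l.length := by rw [hl]; simp
      have := mul_mem_wordSpan (generator_mem_wordSpan (F := F) (x := x) (wt := wt) hw.1) (ih hw.2)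
      simp only [List.map_cons, List.prod_cons, List.sum_cons, List.length_cons, ← mul_sub]
      exact wordSpan_mono (by omega) _ this
  | swap i j l =>
    simp only [List.cons_subset] at hw
    have := mul_mem_wordSpan (span_generators_le_wordSpan _ (hc j hw.1 i hw.2.1))
      (word_mem_wordSpan (F := F) (x := x) (wt := wt) hw.2.2 le_rfl rfl)
    simp only [List.map_cons, List.prod_cons, List.sum_cons, List.length_cons, ← mul_assoc,
      ← sub_mul]
    rw [← add_assoc]
    exact wordSpan_mono (by omega) _ this
  | @trans l l' l'' h h' ih ih' =>
    have h1 := ih hw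
    have h2 := ih' ((h.subset_congr_left).mp hw)
    rw [← h.length_eq, ← (h.map wt).sum_eq] at h2
    have := add_mem h1 h2
    rwa [sub_add_sub_cancel] at this

/-- A word in which a letter occurs `p` times is a combination of shorter words. -/
theorem prod_mem_of_le_count [DecidableEq ι] (hc : CommutatorsInSpan F x β wt) {p : ℕ}
    (hp : 0 < p) (hpow : ∀ i ∈ β, x i ^ p ∈ wordSpan F x β wt (p - 1) (p • wt i))
    {w : List ι} (hw : w ⊆ β) {i : ι} (hi : p ≤ w.count i) :
    (w.map x).prod ∈ wordSpan F x β wt (w.length - 1) (w.map wt).sum := by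
  have hiβ : i ∈ β := hw (List.count_pos_iff.mp (hp.trans_le hi))
  have hsub : (List.replicate p i).Subperm w := by
    rw [List.subperm_ext_iff]
    intro j hj
    rw [List.eq_of_mem_replicate hj, List.count_replicate_self]
    exact hi
  obtain ⟨l, hl, hs⟩ := hsub
  obtain ⟨w', hw'⟩ := hs.exists_perm_append
  have hperm : w.Perm (List.replicate p i ++ w') := hw'.trans (hl.append_right w')
  have h1 := prod_sub_prod_mem_of_perm hc hperm hw
  have hsub' : w' ⊆ β := fun j hj => hw (hperm.symm.subset (List.mem_append_right _ hj))
  have h2 := mul_mem_wordSpan (hpow i hiβ)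
    (word_mem_wordSpan (F := F) (x := x) (wt := wt) hsub' le_rfl rfl)
  have e1 : ((List.replicate p i ++ w').map x).prod = x i ^ p * (w'.map x).prod := by simp
  have e2 : (w.map wt).sum = p • wt i + (w'.map wt).sum := by
    rw [(hperm.map wt).sum_eq]; simp
  have e3 : w.length = p + w'.length := by rw [hperm.length_eq]; simp
  rw [e1] at h1
  rw [← e2] at h2
  have h3 := wordSpan_mono (show p - 1 + w'.length ≤ w.length - 1 by omega) _ h2
  have := add_mem h1 h3
  rwa [sub_add_cancel] at this

/-- Every word is a combination of ordered monomials with exponents below `p`, of the same weight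
and at most the same length. -/
theorem wordSpan_le_span_orderedMonomial (hβ : β.Nodup)
    (hc : CommutatorsInSpan F x β wt) {p : ℕ}
    (hp : 0 < p) (hpow : ∀ i ∈ β, x i ^ p ∈ wordSpan F x β wt (p - 1) (p • wt i)) (r : ℕ) (γ : Γ) :
    wordSpan F x β wt r γ ≤ Submodule.span F {a | ∃ m : ι → ℕ, (∀ i ∈ β, m i < p) ∧
      (β.map m).sum ≤ r ∧ (β.map fun i => m i • wt i).sum = γ ∧ orderedMonomial x β m = a} := by
  classical
  induction r with
  | zero =>
    rw [wordSpan, Submodule.span_le]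
    rintro _ ⟨w, hw, hr, rfl, rfl⟩
    obtain rfl : w = [] := by simpa using hr
    exact Submodule.subset_span ⟨fun _ => 0, fun _ _ => hp, by simp, by simp, by simp [orderedMonomial]⟩
  | succ r ih =>
    have mono : Submodule.span F {a | ∃ m : ι → ℕ, (∀ i ∈ β, m i < p) ∧
      (β.map m).sum ≤ r ∧ (β.map fun i => m i • wt i).sum = γ ∧ orderedMonomial x β m = a} ≤
      Submodule.span F {a | ∃ m : ι → ℕ, (∀ i ∈ β, m i < p) ∧
      (β.map m).sum ≤ r + 1 ∧ (β.map fun i => m i • wt i).sum = γ ∧ orderedMonomial x β m = a} :=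
      Submodule.span_mono fun _ ⟨m, h1, h2, h3, h4⟩ => ⟨m, h1, by omega, h3, h4⟩
    rw [wordSpan, Submodule.span_le]
    rintro _ ⟨w, hw, hr, rfl, rfl⟩
    by_cases hcount : ∃ i, p ≤ w.count i
    · obtain ⟨i, hi⟩ := hcount
      exact mono (ih (wordSpan_mono (by omega) _ (prod_mem_of_le_count hc hp hpow hw hi)))
    · push Not at hcount
      have hperm := perm_orderedWord hβ hw (m := fun i => w.count i) fun _ _ => rfl
      have h1 := mono (ih (wordSpan_mono (by omega) _ (prod_sub_prod_mem_of_perm hc hperm hw)))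
      rw [SetLike.mem_coe, ← sub_add_cancel (w.map x).prod ((orderedWord β _).map x).prod]
      refine add_mem h1 (Submodule.subset_span
        ⟨_, fun i _ => hcount i, ?_, ?_, (prod_map_orderedWord x β _).symm⟩)
      · rw [← length_orderedWord, ← hperm.length_eq]; exact hr
      · rw [← sum_map_orderedWord, (hperm.map wt).sum_eq]

/-- If all exponents of an ordered monomial are below `p`, and the weights are positive, then its
weight is less than that of the top monomial, unless it is the top monomial. -/
theorem sum_mul_lt_of_ne_top {β : List ι} {d : ι → ℕ} (hd : ∀ i ∈ β, 0 < d i) {p : ℕ}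
    {m : ι → ℕ} (hm : ∀ i ∈ β, m i < p) (hne : ∃ i ∈ β, m i ≠ p - 1) :
    (β.map fun i => m i * d i).sum < (β.map fun i => (p - 1) * d i).sum := by
  apply List.sum_lt_sum
  · intro i hi
    have := hm i hi
    exact Nat.mul_le_mul_right _ (by omega)
  · obtain ⟨i, hi, hne⟩ := hne
    have := hm i hi
    exact ⟨i, hi, Nat.mul_lt_mul_of_pos_right (by omega) (hd i hi)⟩

section Top

variable {M : Type*} [AddCommGroup M] [Module F M]

/-- A linear map which vanishes on the ordered monomials of weight `γ` with exponents below `p`,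
except possibly on the top one, vanishes on all words of weight `γ` shorter than the top one. -/
theorem eq_zero_of_mem_wordSpan (hβ : β.Nodup) (hc : CommutatorsInSpan F x β wt) {p : ℕ}
    (hp : 0 < p) (hpow : ∀ i ∈ β, x i ^ p ∈ wordSpan F x β wt (p - 1) (p • wt i)) {γ : Γ}
    (Θ : A →ₗ[F] M)
    (hΘ : ∀ m : ι → ℕ, (∀ i ∈ β, m i < p) → (β.map fun i => m i • wt i).sum = γ →
      (∃ i ∈ β, m i ≠ p - 1) → Θ (orderedMonomial x β m) = 0)
    {r : ℕ} (hr : r < (β.map fun _ => p - 1).sum) {a : A} (ha : a ∈ wordSpan F x β wt r γ) :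
    Θ a = 0 := by
  have := wordSpan_le_span_orderedMonomial hβ hc hp hpow r γ ha
  refine (Submodule.span_le (p := LinearMap.ker Θ)).mpr ?_ this
  rintro _ ⟨m, h1, h2, h3, rfl⟩
  refine hΘ m h1 h3 ?_
  by_contra! hcon
  rw [List.map_congr_left hcon] at h2
  omega

/-- A linear map as in `eq_zero_of_mem_wordSpan` takes the same value on all rearrangements of the
top monomial. -/
theorem map_word_eq_map_top (hβ : β.Nodup) (hc : CommutatorsInSpan F x β wt) {p : ℕ}
    (hp : 1 < p) (hpow : ∀ i ∈ β, x i ^ p ∈ wordSpan F x β wt (p - 1) (p • wt i)) {γ : Γ}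
    (Θ : A →ₗ[F] M)
    (hΘ : ∀ m : ι → ℕ, (∀ i ∈ β, m i < p) → (β.map fun i => m i • wt i).sum = γ →
      (∃ i ∈ β, m i ≠ p - 1) → Θ (orderedMonomial x β m) = 0)
    {w : List ι} (hw : w.Perm (orderedWord β fun _ => p - 1)) (hγ : (w.map wt).sum = γ) :
    Θ (w.map x).prod = Θ (orderedMonomial x β fun _ => p - 1) := by
  subst hγ
  have hsub : w ⊆ β := fun i hi => orderedWord_subset _ _ (hw.subset hi)
  have h := prod_sub_prod_mem_of_perm hc hw hsub
  rw [prod_map_orderedWord] at h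
  rcases β.eq_nil_or_concat with hl | ⟨_, _, hl⟩
  · have : w = [] := by
      subst hl
      exact List.eq_nil_of_subset_nil hsub
    subst hl this
    simp [orderedMonomial]
  · have hpos : 0 < (β.map fun _ => p - 1).sum := by
      rw [hl]; simp; omega
    rw [← sub_eq_zero, ← map_sub]
    refine eq_zero_of_mem_wordSpan hβ hc (by omega) hpow Θ hΘ ?_ h
    rw [hw.length_eq, length_orderedWord]
    omega

/-- A linear map as in `eq_zero_of_mem_wordSpan` vanishes on all words which are not longer than the
top monomial and are not rearrangements of it. -/
theorem map_word_eq_zero [DecidableEq ι] (hβ : β.Nodup) (hc : CommutatorsInSpan F x β wt) {p : ℕ}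
    (hp : 1 < p) (hpow : ∀ i ∈ β, x i ^ p ∈ wordSpan F x β wt (p - 1) (p • wt i)) {γ : Γ}
    (Θ : A →ₗ[F] M)
    (hΘ : ∀ m : ι → ℕ, (∀ i ∈ β, m i < p) → (β.map fun i => m i • wt i).sum = γ →
      (∃ i ∈ β, m i ≠ p - 1) → Θ (orderedMonomial x β m) = 0)
    {w : List ι} (hsub : w ⊆ β) (hlen : w.length ≤ (β.map fun _ => p - 1).sum)
    (hne : ∃ i ∈ β, w.count i ≠ p - 1) (hγ : (w.map wt).sum = γ) :
    Θ (w.map x).prod = 0 := by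
  subst hγ
  by_cases hcount : ∃ i ∈ β, p ≤ w.count i
  · obtain ⟨i, -, hi⟩ := hcount
    have hpos : 0 < w.length := (by omega : 0 < p).trans_le (hi.trans List.count_le_length)
    exact eq_zero_of_mem_wordSpan hβ hc (by omega) hpow Θ hΘ (by omega)
      (prod_mem_of_le_count hc (by omega) hpow hsub hi)
  · push Not at hcount
    have hperm := perm_orderedWord hβ hsub (m := fun i => w.count i) fun _ _ => rfl
    have hlt : w.length < (β.map fun _ => p - 1).sum := by
      have := sum_mul_lt_of_ne_top (d := fun _ => 1) (fun _ _ => one_pos) hcount hne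
      rw [hperm.length_eq, length_orderedWord]
      simpa using this
    exact eq_zero_of_mem_wordSpan hβ hc (by omega) hpow Θ hΘ hlt
      (word_mem_wordSpan hsub le_rfl rfl)

end Top

end Collecting

/-! ### The `p`-th power of a derivation plus a function -/

section Hochschild

variable {F A : Type*} [Field F] [Ring A] [Algebra F A]

open Polynomial in
/-- The derivative of `(a + X b) ^ k`, expanded in iterated commutators of `a` with `b`. -/
theorem derivative_pow_add_X_mul (a b : A)
    (h : ∀ k, Commute ((fun c => a * c - c * a)^[k] b) b) (k : ℕ) :
    derivative ((C a + X * C b) ^ k) = ∑ j ∈ Finset.range k, k.choose (j + 1) •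
      (C ((fun c => a * c - c * a)^[j] b) * (C a + X * C b) ^ (k - 1 - j)) := by
  set u : A[X] := C a + X * C b with hu
  set B : ℕ → A := fun j => (fun c => a * c - c * a)^[j] b with hB
  have hcomm : ∀ j, u * C (B j) = C (B j) * u + C (B (j + 1)) := by
    intro j
    have e : B (j + 1) = a * B j - B j * a := by
      simp only [hB, Function.iterate_succ_apply']
    have e2 : C b * C (B j) = C (B j) * C b := by
      rw [← C_mul, ← C_mul, (h j).eq]
    rw [e, hu, add_mul, mul_add, C_sub, C_mul, C_mul, mul_assoc, e2, ← mul_assoc, X_mul_C,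
      ← mul_assoc]
    abel
  have hder : derivative u = C (B 0) := by
    rw [hu]; simp [hB]
  induction k with
  | zero => simp
  | succ k ih =>
    rw [pow_succ', derivative_mul, ih, hder, Finset.mul_sum]
    have e1 : ∀ j ∈ Finset.range k, u * (k.choose (j + 1) • (C (B j) * u ^ (k - 1 - j))) =
        k.choose (j + 1) • (C (B j) * u ^ (k - j)) +
          k.choose (j + 1) • (C (B (j + 1)) * u ^ (k - 1 - j)) := by
      intro j hj
      rw [Finset.mem_range] at hj
      rw [mul_smul_comm, ← mul_assoc, hcomm, add_mul, smul_add, mul_assoc, ← pow_succ',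
        show k - 1 - j + 1 = k - j by omega]
    rw [Finset.sum_congr rfl e1, Finset.sum_add_distrib]
    have e2 : ∑ j ∈ Finset.range (k + 1), (k + 1).choose (j + 1) •
        (C (B j) * u ^ (k + 1 - 1 - j)) =
        ∑ j ∈ Finset.range (k + 1), k.choose j • (C (B j) * u ^ (k - j)) +
        ∑ j ∈ Finset.range (k + 1), k.choose (j + 1) • (C (B j) * u ^ (k - j)) := by
      rw [← Finset.sum_add_distrib]
      refine Finset.sum_congr rfl fun j _ => ?_
      rw [Nat.choose_succ_succ, add_smul, Nat.add_sub_cancel]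
    change _ = ∑ j ∈ Finset.range (k + 1), (k + 1).choose (j + 1) •
        (C (B j) * u ^ (k + 1 - 1 - j))
    rw [e2, Finset.sum_range_succ', Finset.sum_range_succ (fun j => k.choose (j + 1) • _)]
    have e3 : ∀ j ∈ Finset.range k, k.choose (j + 1) • (C (B (j + 1)) * u ^ (k - (j + 1))) =
        k.choose (j + 1) • (C (B (j + 1)) * u ^ (k - 1 - j)) := by
      intro j _
      rw [show k - (j + 1) = k - 1 - j by omega]
    rw [Finset.sum_congr rfl e3]
    simp only [Nat.choose_succ_self, Nat.choose_zero_right, zero_smul, one_smul, Nat.sub_zero]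
    abel

open Polynomial in
/-- Hochschild's formula `(a + b) ^ p = a ^ p + b ^ p + ad(a) ^ (p - 1) b` in characteristic `p`, for
`b` commuting with its iterated commutators with `a`. -/
theorem add_pow_char_of_commute_iterate (p : ℕ) [hp : Fact p.Prime] [CharP F p] (a b : A)
    (h : ∀ k, Commute ((fun c => a * c - c * a)^[k] b) b) :
    (a + b) ^ p = a ^ p + b ^ p + (fun c => a * c - c * a)^[p - 1] b := by
  have hp2 := hp.out.two_le
  set u : A[X] := C a + X * C b with hu
  have hcast : ∀ k : ℕ, (k : A) = algebraMap F A k := fun k => (map_natCast _ k).symm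
  have hder : derivative (u ^ p) = C ((fun c => a * c - c * a)^[p - 1] b) := by
    rw [hu, derivative_pow_add_X_mul a b h, Finset.sum_eq_single (p - 1)]
    · simp [Nat.sub_add_cancel hp.out.one_le]
    · intro j hj hne
      rw [Finset.mem_range] at hj
      have hdvd : p ∣ p.choose (j + 1) := hp.out.dvd_choose_self (by omega) (by omega)
      obtain ⟨q, hq⟩ := hdvd
      rw [hq, mul_smul, nsmul_eq_mul, ← C_eq_natCast, hcast, CharP.cast_eq_zero]
      simp
    · intro hn; simp at hn; omega
  have hc : ∀ k, k + 2 ≤ p → (u ^ p).coeff (k + 1) =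
      if k = 0 then (fun c => a * c - c * a)^[p - 1] b else 0 := by
    intro k hk
    have h1 := congrArg (fun f => coeff f k) hder
    simp only [coeff_derivative, coeff_C] at h1
    rw [← Nat.cast_succ, hcast] at h1
    have h2 : ((k + 1 : ℕ) : F) ≠ 0 := by
      rw [Ne, CharP.cast_eq_zero_iff F p]
      exact fun hd => absurd (Nat.le_of_dvd (Nat.succ_pos k) hd) (by omega)
    by_cases hk0 : k = 0
    · subst hk0
      simpa using h1
    · rw [if_neg hk0] at h1 ⊢
      have h3 := congrArg (· * algebraMap F A ((k + 1 : ℕ) : F)⁻¹) h1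
      simp only [mul_assoc, ← map_mul, mul_inv_cancel₀ h2, map_one, mul_one, zero_mul] at h3
      exact h3
  have hdeg : u.natDegree ≤ 1 := by
    rw [hu]
    refine (natDegree_add_le _ _).trans (max_le (by simp) ?_)
    exact (natDegree_mul_le).trans (by simpa using natDegree_X_le)
  have hdegp : (u ^ p).natDegree < p + 1 :=
    Nat.lt_succ_of_le ((natDegree_pow_le).trans (by nlinarith))
  let φ : A[X] →+* A := eval₂RingHom' (RingHom.id A) 1 (fun _ => Commute.one_right _)
  have hφ : ∀ f : A[X], φ f = eval 1 f := fun f => rfl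
  have h0 : (u ^ p).coeff 0 = a ^ p := by
    have : ∀ f : A[X], f.coeff 0 = constantCoeff f := fun f => rfl
    rw [this, map_pow]; simp [hu]
  have hpp : (u ^ p).coeff p = b ^ p := by
    have := coeff_pow_of_natDegree_le hdeg (m := p)
    rw [mul_one] at this
    rw [this]; simp [hu]
  have hsum : (a + b) ^ p = ∑ i ∈ Finset.range (p + 1), (u ^ p).coeff i := by
    have : φ (u ^ p) = (a + b) ^ p := by
      rw [map_pow, hφ]; simp [hu]
    rw [← this, hφ, eval_eq_sum_range' hdegp]
    simp
  obtain ⟨q, rfl⟩ : ∃ q, p = q + 2 := ⟨p - 2, by omega⟩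
  rw [hsum, Finset.sum_range_succ, Finset.sum_range_succ', h0, hpp, Finset.sum_eq_single 0]
  · rw [hc 0 (by omega), if_pos rfl]; abel
  · intro k hk hne
    rw [Finset.mem_range] at hk
    rw [hc k (by omega), if_neg hne]
  · intro hn; simp at hn

end Hochschild

/-! ### Twisted differential operators on a Frobenius neighbourhood of the identity -/

section Twisted

variable {F : Type*} [Field F] {n : ℕ}

/-- Evaluation of a polynomial function on matrices at the identity matrix. -/
noncomputable def evalOne : MvPolynomial (Fin n × Fin n) F →ₐ[F] F :=
  MvPolynomial.aeval fun ij => (1 : Matrix (Fin n) (Fin n) F) ij.1 ij.2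

/-- A linear form on matrices, as a linear polynomial in the matrix entries. -/
noncomputable def linearPoly (ξ : Module.Dual F (Matrix (Fin n) (Fin n) F)) :
    MvPolynomial (Fin n × Fin n) F :=
  ∑ ij : Fin n × Fin n, MvPolynomial.C (ξ (Matrix.single ij.1 ij.2 1)) * MvPolynomial.X ij

theorem evalOne_leftInvDer_linearPoly (ξ : Module.Dual F (Matrix (Fin n) (Fin n) F))
    (A : Matrix (Fin n) (Fin n) F) : evalOne (leftInvDer A (linearPoly ξ)) = ξ A := by
  have h1 : ∀ ij : Fin n × Fin n, evalOne (leftInvDer A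
      (MvPolynomial.C (ξ (Matrix.single ij.1 ij.2 1)) * MvPolynomial.X ij)) =
      A ij.1 ij.2 * ξ (Matrix.single ij.1 ij.2 1) := by
    rintro ⟨i, j⟩
    rw [Derivation.leibniz, MvPolynomial.derivation_C, smul_zero, add_zero, leftInvDer_X]
    simp [evalOne, Matrix.one_apply, mul_comm]
  conv_rhs => rw [Matrix.matrix_eq_sum_single A]
  rw [linearPoly, map_sum, map_sum, Finset.sum_congr rfl fun ij _ => h1 ij,
    Fintype.sum_prod_type, map_sum]
  refine Finset.sum_congr rfl fun i _ => ?_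
  rw [map_sum]
  refine Finset.sum_congr rfl fun j _ => ?_
  rw [← smul_eq_mul, ← map_smul, Matrix.smul_single, smul_eq_mul, mul_one]

/-- The operator `D_A + D_A(s)` on polynomial functions, i.e. `e^{-s} D_A e^s`, where `D_A` is the
left-invariant derivation of a matrix `A` and `s` is the linear function attached to `ξ`. -/
noncomputable def twistedOp (ξ : Module.Dual F (Matrix (Fin n) (Fin n) F))
    (A : Matrix (Fin n) (Fin n) F) : Module.End F (MvPolynomial (Fin n × Fin n) F) :=
  (leftInvDer A : MvPolynomial (Fin n × Fin n) F →ₗ[F] MvPolynomial (Fin n × Fin n) F) +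
    LinearMap.mulLeft F (leftInvDer A (linearPoly ξ))

variable (ξ : Module.Dual F (Matrix (Fin n) (Fin n) F))

theorem twistedOp_apply (A : Matrix (Fin n) (Fin n) F) (f : MvPolynomial (Fin n × Fin n) F) :
    twistedOp ξ A f = leftInvDer A f + leftInvDer A (linearPoly ξ) * f := rfl

theorem twistedOp_add (A B : Matrix (Fin n) (Fin n) F) :
    twistedOp ξ (A + B) = twistedOp ξ A + twistedOp ξ B := by
  refine LinearMap.ext fun f => ?_
  simp only [LinearMap.add_apply, twistedOp_apply, leftInvDer_add, Derivation.add_apply]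
  ring

theorem twistedOp_smul (c : F) (A : Matrix (Fin n) (Fin n) F) :
    twistedOp ξ (c • A) = c • twistedOp ξ A := by
  refine LinearMap.ext fun f => ?_
  simp only [LinearMap.smul_apply, twistedOp_apply, leftInvDer_smul, Derivation.smul_apply,
    smul_add, smul_mul_assoc]

theorem twistedOp_lie (A B : Matrix (Fin n) (Fin n) F) :
    twistedOp ξ ⁅A, B⁆ = ⁅twistedOp ξ A, twistedOp ξ B⁆ := by
  refine LinearMap.ext fun f => ?_
  rw [Ring.lie_def (twistedOp ξ A)]
  simp only [LinearMap.sub_apply, Module.End.mul_apply, twistedOp_apply, leftInvDer_lie,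
    Derivation.commutator_apply, map_add, Derivation.leibniz, smul_eq_mul]
  ring

/-- The twisted operators have `p`-th powers given by those of matrices, up to multiplication by the
`p`-th power of a function. -/
theorem twistedOp_pow (p : ℕ) [Fact p.Prime] [CharP F p] (A : Matrix (Fin n) (Fin n) F) :
    twistedOp ξ A ^ p = twistedOp ξ (A ^ p) +
      LinearMap.mulLeft F (leftInvDer A (linearPoly ξ) ^ p) := by
  set D : Module.End F (MvPolynomial (Fin n × Fin n) F) :=
    (leftInvDer A : MvPolynomial (Fin n × Fin n) F →ₗ[F] MvPolynomial (Fin n × Fin n) F) with hD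
  have hDf : ∀ f, D f = leftInvDer A f := fun _ => rfl
  have hcomm : ∀ g : MvPolynomial (Fin n × Fin n) F,
      D * LinearMap.mulLeft F g - LinearMap.mulLeft F g * D = LinearMap.mulLeft F (D g) := by
    intro g
    refine LinearMap.ext fun f => ?_
    simp only [LinearMap.sub_apply, Module.End.mul_apply, LinearMap.mulLeft_apply, hDf,
      Derivation.leibniz, smul_eq_mul]
    ring
  have hiter : ∀ (k : ℕ) (g : MvPolynomial (Fin n × Fin n) F),
      (fun c => D * c - c * D)^[k] (LinearMap.mulLeft F g) = LinearMap.mulLeft F (D^[k] g) := by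
    intro k g
    induction k with
    | zero => rfl
    | succ k ih => rw [Function.iterate_succ_apply', ih, hcomm, Function.iterate_succ_apply']
  have key := add_pow_char_of_commute_iterate (F := F) p D
    (LinearMap.mulLeft F (leftInvDer A (linearPoly ξ))) (by
      intro k
      rw [hiter]
      refine LinearMap.ext fun f => ?_
      simp only [Module.End.mul_apply, LinearMap.mulLeft_apply]
      ring)
  have hp : p - 1 + 1 = p := Nat.sub_add_cancel (Fact.out : p.Prime).one_le
  have hlast : D^[p - 1] (leftInvDer A (linearPoly ξ)) = leftInvDer (A ^ p) (linearPoly ξ) := by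
    rw [← hDf, ← Function.iterate_succ_apply, Nat.succ_eq_add_one, hp, leftInvDer_iterate]
  rw [hiter, hlast] at key
  rw [twistedOp, ← hD, key]
  refine LinearMap.ext fun f => ?_
  simp only [LinearMap.add_apply, LinearMap.mulLeft_apply, twistedOp_apply, leftInvDer_iterate,
    LinearMap.pow_mulLeft, Module.End.pow_apply, ← hD]
  ring

/-- The ideal generated by the functions `x_ij ^ p - δ_ij`. -/
noncomputable def frobeniusIdeal (F : Type*) [Field F] (n p : ℕ) :
    Ideal (MvPolynomial (Fin n × Fin n) F) :=
  Ideal.span (Set.range fun ij : Fin n × Fin n => MvPolynomial.X ij ^ p -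
    MvPolynomial.C ((1 : Matrix (Fin n) (Fin n) F) ij.1 ij.2))

variable (p : ℕ)

theorem twistedOp_mem_frobeniusIdeal [CharP F p] (A : Matrix (Fin n) (Fin n) F)
    {f : MvPolynomial (Fin n × Fin n) F} (hf : f ∈ frobeniusIdeal F n p) :
    twistedOp ξ A f ∈ frobeniusIdeal F n p := by
  rw [twistedOp_apply]
  refine add_mem ?_ (Ideal.mul_mem_left _ _ hf)
  unfold frobeniusIdeal at hf
  induction hf using Submodule.span_induction with
  | zero => simp
  | add f g _ _ hf hg => rw [map_add]; exact add_mem hf hg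
  | smul a f hf ih =>
    rw [smul_eq_mul, Derivation.leibniz]
    exact add_mem (Ideal.mul_mem_left _ _ ih) (Ideal.mul_mem_right _ _ hf)
  | mem f hf =>
    obtain ⟨ij, rfl⟩ := hf
    have hp0 : (p : MvPolynomial (Fin n × Fin n) F) = 0 := CharP.cast_eq_zero _ p
    have : leftInvDer A (MvPolynomial.X ij ^ p - MvPolynomial.C
        ((1 : Matrix (Fin n) (Fin n) F) ij.1 ij.2)) = 0 := by
      rw [map_sub, MvPolynomial.derivation_C, Derivation.leibniz_pow, nsmul_eq_mul, hp0]
      simp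
    rw [this]; exact zero_mem _

/-- Modulo the ideal `(x_ij ^ p - δ_ij)`, a `p`-th power is its value at the identity matrix. -/
theorem pow_sub_evalOne_mem [Fact p.Prime] [CharP F p] (f : MvPolynomial (Fin n × Fin n) F) :
    f ^ p - MvPolynomial.C (evalOne f ^ p) ∈ frobeniusIdeal F n p := by
  induction f using MvPolynomial.induction_on with
  | C a => simp [evalOne]
  | add f g hf hg =>
    rw [map_add, add_pow_char, add_pow_char, map_add, add_sub_add_comm]
    exact add_mem hf hg
  | mul_X f ij hf =>
    have hX : (MvPolynomial.X ij : MvPolynomial (Fin n × Fin n) F) ^ p -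
        MvPolynomial.C (evalOne (MvPolynomial.X ij : MvPolynomial (Fin n × Fin n) F) ^ p) ∈
        frobeniusIdeal F n p := by
      have : evalOne (MvPolynomial.X ij : MvPolynomial (Fin n × Fin n) F) ^ p =
          (1 : Matrix (Fin n) (Fin n) F) ij.1 ij.2 := by
        simp only [evalOne, MvPolynomial.aeval_X, Matrix.one_apply]
        split_ifs <;> simp [(Fact.out : p.Prime).ne_zero]
      rw [this]
      exact Ideal.subset_span ⟨ij, rfl⟩
    rw [map_mul, mul_pow, mul_pow, map_mul]
    have e : ∀ a b c d : MvPolynomial (Fin n × Fin n) F,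
        a * b - c * d = (a - c) * b + c * (b - d) := by intros; ring
    rw [e]
    exact add_mem (Ideal.mul_mem_right _ _ hf) (Ideal.mul_mem_left _ _ hX)

theorem evalOne_eq_zero_of_mem [Fact p.Prime] {f : MvPolynomial (Fin n × Fin n) F}
    (hf : f ∈ frobeniusIdeal F n p) : evalOne f = 0 := by
  have : frobeniusIdeal F n p ≤ RingHom.ker (evalOne (F := F) (n := n)) := by
    rw [frobeniusIdeal, Ideal.span_le]
    rintro _ ⟨ij, rfl⟩
    simp only [SetLike.mem_coe, RingHom.mem_ker, evalOne, map_sub, map_pow, MvPolynomial.aeval_X,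
      MvPolynomial.aeval_C, Matrix.one_apply]
    split_ifs <;> simp [(Fact.out : p.Prime).ne_zero]
  exact this hf

/-- The functions on the first Frobenius neighbourhood of the identity matrix. -/
abbrev FrobeniusNbhd (F : Type*) [Field F] (n p : ℕ) : Type _ :=
  MvPolynomial (Fin n × Fin n) F ⧸ (frobeniusIdeal F n p).restrictScalars F

/-- Evaluation at the identity matrix, on the functions on its first Frobenius neighbourhood. -/
noncomputable def evalOneQuot [Fact p.Prime] : FrobeniusNbhd F n p →ₗ[F] F :=
  Submodule.liftQ _ (evalOne (F := F) (n := n)).toLinearMap fun _ hf =>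
    evalOne_eq_zero_of_mem p hf

theorem evalOneQuot_mkQ [Fact p.Prime] (f : MvPolynomial (Fin n × Fin n) F) :
    evalOneQuot p (Submodule.mkQ _ f) = evalOne f := rfl

variable [CharP F p]

/-- The twisted operators on the functions on the first Frobenius neighbourhood. -/
noncomputable def twistedQuotOp (A : Matrix (Fin n) (Fin n) F) :
    Module.End F (FrobeniusNbhd F n p) :=
  Submodule.mapQ _ _ (twistedOp ξ A) fun _ hf => twistedOp_mem_frobeniusIdeal ξ p A hf

theorem twistedQuotOp_mkQ (A : Matrix (Fin n) (Fin n) F) (f : MvPolynomial (Fin n × Fin n) F) :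
    twistedQuotOp ξ p A (Submodule.mkQ _ f) = Submodule.mkQ _ (twistedOp ξ A f) := rfl

theorem twistedQuotOp_pow_mkQ (A : Matrix (Fin n) (Fin n) F) (k : ℕ)
    (f : MvPolynomial (Fin n × Fin n) F) :
    (twistedQuotOp ξ p A ^ k) (Submodule.mkQ _ f) = Submodule.mkQ _ ((twistedOp ξ A ^ k) f) := by
  induction k generalizing f with
  | zero => rfl
  | succ k ih =>
    rw [pow_succ, Module.End.mul_apply, twistedQuotOp_mkQ, ih, pow_succ, Module.End.mul_apply]

/-- The twisted operators as a representation of a Lie algebra of matrices. -/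
noncomputable def twistedRep (𝔩 : LieSubalgebra F (Matrix (Fin n) (Fin n) F)) :
    𝔩 →ₗ⁅F⁆ Module.End F (FrobeniusNbhd F n p) where
  toFun A := twistedQuotOp ξ p A
  map_add' A B := by
    apply Submodule.linearMap_qext
    refine LinearMap.ext fun f => ?_
    simp only [LinearMap.comp_apply, LinearMap.add_apply, twistedQuotOp_mkQ, AddMemClass.coe_add,
      twistedOp_add, map_add]
  map_smul' c A := by
    apply Submodule.linearMap_qext
    refine LinearMap.ext fun f => ?_
    simp only [LinearMap.comp_apply, LinearMap.smul_apply, twistedQuotOp_mkQ,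
      SetLike.val_smul, twistedOp_smul, map_smul, RingHom.id_apply]
  map_lie' {A B} := by
    apply Submodule.linearMap_qext
    refine LinearMap.ext fun f => ?_
    rw [Ring.lie_def (twistedQuotOp ξ p A)]
    simp only [LinearMap.comp_apply, LinearMap.sub_apply, Module.End.mul_apply, twistedQuotOp_mkQ,
      LieSubalgebra.coe_bracket, twistedOp_lie, Ring.lie_def (twistedOp ξ A), map_sub]

variable [Fact p.Prime]

/-- The representation of `u_χ(𝔩)` on the functions on the first Frobenius neighbourhood of the
identity matrix, for a linear form `χ` on `𝔩` which is the restriction of `ξ`. -/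
noncomputable def envRep (𝔩 : LieSubalgebra F (Matrix (Fin n) (Fin n) F)) (χ : Module.Dual F 𝔩)
    (hξ : ∀ A : 𝔩, ξ A = χ A) : ReducedEnv p 𝔩 χ →ₐ[F] Module.End F (FrobeniusNbhd F n p) :=
  RingQuot.liftAlgHom F ⟨UniversalEnvelopingAlgebra.lift F (twistedRep ξ p 𝔩), by
    rintro _ _ ⟨A, B, hAB⟩
    rw [map_pow, map_add, AlgHom.commutes, UniversalEnvelopingAlgebra.lift_ι_apply,
      UniversalEnvelopingAlgebra.lift_ι_apply]
    apply Submodule.linearMap_qext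
    refine LinearMap.ext fun f => ?_
    change (twistedQuotOp ξ p A ^ p) (Submodule.mkQ _ f) = twistedQuotOp ξ p B (Submodule.mkQ _ f) +
      χ A ^ p • (Submodule.mkQ _ f)
    rw [twistedQuotOp_pow_mkQ, twistedQuotOp_mkQ, twistedOp_pow, hAB, LinearMap.add_apply, map_add,
      ← map_smul]
    congr 1
    rw [← sub_eq_zero, ← map_sub, Submodule.mkQ_apply, Submodule.Quotient.mk_eq_zero,
      Submodule.restrictScalars_mem, LinearMap.mulLeft_apply, MvPolynomial.smul_eq_C_mul, ← sub_mul,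
      ← hξ, ← evalOne_leftInvDer_linearPoly]
    exact Ideal.mul_mem_right _ _ (pow_sub_evalOne_mem p _)⟩

theorem envRep_toEnv (𝔩 : LieSubalgebra F (Matrix (Fin n) (Fin n) F)) (χ : Module.Dual F 𝔩)
    (hξ : ∀ A : 𝔩, ξ A = χ A) (A : 𝔩) (f : MvPolynomial (Fin n × Fin n) F) :
    envRep ξ p 𝔩 χ hξ (toEnv p 𝔩 χ A) (Submodule.mkQ _ f) =
      Submodule.mkQ _ (twistedOp ξ A f) := by
  have : envRep ξ p 𝔩 χ hξ (toEnv p 𝔩 χ A) = twistedRep ξ p 𝔩 A := by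
    change RingQuot.liftAlgHom F _ (RingQuot.mkAlgHom F _ (UniversalEnvelopingAlgebra.ι F A)) = _
    rw [RingQuot.liftAlgHom_mkAlgHom_apply, UniversalEnvelopingAlgebra.lift_ι_apply]
  rw [this]; rfl

theorem envRep_word (𝔩 : LieSubalgebra F (Matrix (Fin n) (Fin n) F)) (χ : Module.Dual F 𝔩)
    (hξ : ∀ A : 𝔩, ξ A = χ A) (w : List 𝔩) (f : MvPolynomial (Fin n × Fin n) F) :
    envRep ξ p 𝔩 χ hξ (w.map (toEnv p 𝔩 χ)).prod (Submodule.mkQ _ f) =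
      Submodule.mkQ _ ((w.map fun A : 𝔩 => twistedOp ξ (A : Matrix (Fin n) (Fin n) F)).prod f) := by
  induction w with
  | nil => simp
  | cons A w ih =>
    rw [List.map_cons, List.prod_cons, map_mul, Module.End.mul_apply, ih, envRep_toEnv,
      List.map_cons, List.prod_cons, Module.End.mul_apply]

end Twisted

/-! ### Linear independence of ordered monomials in a reduced enveloping algebra -/

section Independence

variable {F : Type*} [Field F] {n : ℕ}

/-- The ideal of polynomial functions vanishing at the identity matrix. -/
noncomputable def idealOne (F : Type*) [Field F] (n : ℕ) : Ideal (MvPolynomial (Fin n × Fin n) F) :=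
  RingHom.ker (evalOne (F := F) (n := n))

theorem leftInvDer_mem_idealOne_pow (A : Matrix (Fin n) (Fin n) F) (k : ℕ)
    {f : MvPolynomial (Fin n × Fin n) F} (hf : f ∈ idealOne F n ^ (k + 1)) :
    leftInvDer A f ∈ idealOne F n ^ k := by
  induction k generalizing f with
  | zero => simp
  | succ k ih =>
    rw [pow_succ (idealOne F n) (k + 1)] at hf
    induction hf using Submodule.mul_induction_on' with
    | mem_mul_mem a ha b hb =>
      rw [Derivation.leibniz, smul_eq_mul, smul_eq_mul]
      refine add_mem (Ideal.mul_mem_right _ _ ha) ?_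
      rw [pow_succ', ]
      exact Ideal.mul_mem_mul hb (ih ha)
    | add a _ b _ ha hb => rw [map_add]; exact add_mem ha hb

theorem twistedOp_mem_idealOne_pow (ξ : Module.Dual F (Matrix (Fin n) (Fin n) F))
    (A : Matrix (Fin n) (Fin n) F) (k : ℕ)
    {f : MvPolynomial (Fin n × Fin n) F} (hf : f ∈ idealOne F n ^ (k + 1)) :
    twistedOp ξ A f ∈ idealOne F n ^ k :=
  add_mem (leftInvDer_mem_idealOne_pow A k hf)
    (Ideal.mul_mem_left _ _ (Ideal.pow_le_pow_right (Nat.le_succ k) hf))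

theorem twistedOp_word_mem_idealOne_pow (ξ : Module.Dual F (Matrix (Fin n) (Fin n) F))
    (w : List (Matrix (Fin n) (Fin n) F)) (k : ℕ)
    {f : MvPolynomial (Fin n × Fin n) F} (hf : f ∈ idealOne F n ^ (k + w.length)) :
    (w.map (twistedOp ξ)).prod f ∈ idealOne F n ^ k := by
  induction w generalizing k with
  | nil => simpa using hf
  | cons A w ih =>
    rw [List.map_cons, List.prod_cons, Module.End.mul_apply]
    apply twistedOp_mem_idealOne_pow
    apply ih
    rw [List.length_cons] at hf
    rwa [add_assoc, add_comm 1]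

theorem evalOne_word_eq_zero (ξ : Module.Dual F (Matrix (Fin n) (Fin n) F))
    (w : List (Matrix (Fin n) (Fin n) F)) {k : ℕ} (hk : w.length < k)
    {f : MvPolynomial (Fin n × Fin n) F} (hf : f ∈ idealOne F n ^ k) :
    evalOne ((w.map (twistedOp ξ)).prod f) = 0 := by
  have h := twistedOp_word_mem_idealOne_pow ξ w 1 (Ideal.pow_le_pow_right (by omega) hf)
  rw [pow_one] at h
  exact h

variable {κ : Type*}

/-- The polynomial in the local coordinates `η k - (η k)(1)` at the identity matrix. -/
noncomputable def localCoord (η : κ → Module.Dual F (Matrix (Fin n) (Fin n) F)) :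
    MvPolynomial κ F →ₐ[F] MvPolynomial (Fin n × Fin n) F :=
  MvPolynomial.aeval fun k =>
    linearPoly (η k) - MvPolynomial.C (evalOne (linearPoly (η k)))

variable (η : κ → Module.Dual F (Matrix (Fin n) (Fin n) F))

theorem localCoord_X_mem (k : κ) : localCoord η (MvPolynomial.X k) ∈ idealOne F n := by
  rw [idealOne, RingHom.mem_ker, localCoord, MvPolynomial.aeval_X, map_sub, sub_eq_zero]
  simp [evalOne]

theorem localCoord_monomial_mem (m : κ →₀ ℕ) (c : F) :
    localCoord η (MvPolynomial.monomial m c) ∈ idealOne F n ^ m.degree := by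
  rw [MvPolynomial.monomial_eq, map_mul, Finsupp.prod, map_prod]
  simp only [map_pow]
  exact Ideal.mul_mem_left _ _ (by
    rw [Finsupp.degree_apply, ← Finset.prod_pow_eq_pow_sum]
    exact Ideal.prod_mem_prod fun k _ => Ideal.pow_mem_pow (localCoord_X_mem η k) _)

variable [Fintype κ] [DecidableEq κ]

theorem leftInvDer_localCoord (A : Matrix (Fin n) (Fin n) F) (g : MvPolynomial κ F) :
    leftInvDer A (localCoord η g) = ∑ k, localCoord η (MvPolynomial.pderiv k g) *
      leftInvDer A (linearPoly (η k)) := by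
  induction g using MvPolynomial.induction_on with
  | C a =>
    have : localCoord η (MvPolynomial.C a) = MvPolynomial.C a := by
      simp [localCoord, MvPolynomial.algebraMap_eq]
    simp [this]
  | add f g hf hg =>
    simp only [map_add, hf, hg, add_mul, Finset.sum_add_distrib]
  | mul_X f i hf =>
    have hX : leftInvDer A (localCoord η (MvPolynomial.X i)) =
        leftInvDer A (linearPoly (η i)) := by
      rw [localCoord, MvPolynomial.aeval_X, map_sub, MvPolynomial.derivation_C, sub_zero]
    have h1 : ∀ k, localCoord η (MvPolynomial.pderiv k (f * MvPolynomial.X i)) *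
        leftInvDer A (linearPoly (η k)) =
        localCoord η f * (localCoord η (MvPolynomial.pderiv k (MvPolynomial.X i)) *
          leftInvDer A (linearPoly (η k))) +
        localCoord η (MvPolynomial.X i) * (localCoord η (MvPolynomial.pderiv k f) *
          leftInvDer A (linearPoly (η k))) := by
      intro k
      rw [Derivation.leibniz, smul_eq_mul, smul_eq_mul, map_add, map_mul, map_mul]
      ring
    rw [Finset.sum_congr rfl fun k _ => h1 k, Finset.sum_add_distrib, ← Finset.mul_sum,
      ← Finset.mul_sum, map_mul, Derivation.leibniz, hf, hX, smul_eq_mul, smul_eq_mul]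
    congr 2
    rw [Finset.sum_eq_single i]
    · simp
    · intro k _ hk
      rw [MvPolynomial.pderiv_X_of_ne hk.symm, map_zero, zero_mul]
    · simp

/-- To leading order at the identity matrix, the twisted operator of a matrix `A` with
`η k A = δ_{ik}` is the partial derivative in the `i`-th local coordinate. -/
theorem twistedOp_localCoord_monomial (ξ : Module.Dual F (Matrix (Fin n) (Fin n) F))
    {A : Matrix (Fin n) (Fin n) F} {i : κ} (hA : ∀ k, η k A = if k = i then 1 else 0)
    (m : κ →₀ ℕ) :
    twistedOp ξ A (localCoord η (MvPolynomial.monomial m 1)) -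
      localCoord η (MvPolynomial.pderiv i (MvPolynomial.monomial m 1)) ∈
      idealOne F n ^ m.degree := by
  rw [twistedOp_apply, add_sub_right_comm]
  refine add_mem ?_ (Ideal.mul_mem_left _ _ (localCoord_monomial_mem η m 1))
  have e : localCoord η (MvPolynomial.pderiv i (MvPolynomial.monomial m 1)) =
      ∑ k, localCoord η (MvPolynomial.pderiv k (MvPolynomial.monomial m 1)) *
        MvPolynomial.C (η k A) := by
    rw [Finset.sum_eq_single i]
    · simp [hA]
    · intro k _ hk; simp [hA, hk]
    · simp
  rw [leftInvDer_localCoord, e, ← Finset.sum_sub_distrib]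
  refine Ideal.sum_mem _ fun k _ => ?_
  rw [← mul_sub]
  have h1 : leftInvDer A (linearPoly (η k)) - MvPolynomial.C (η k A) ∈ idealOne F n := by
    rw [idealOne, RingHom.mem_ker, map_sub, evalOne_leftInvDer_linearPoly]
    simp [evalOne]
  rw [MvPolynomial.pderiv_monomial]
  by_cases hk : m k = 0
  · simp [hk]
  · have hdeg : m.degree = (m - Finsupp.single k 1).degree + 1 := by
      have hle : Finsupp.single k 1 ≤ m := by
        rw [Finsupp.single_le_iff]; omega
      conv_lhs => rw [← tsub_add_cancel_of_le hle]
      rw [map_add, Finsupp.degree_single]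
    rw [hdeg, pow_succ]
    exact Ideal.mul_mem_mul (localCoord_monomial_mem η _ _) h1

/-- The value at the identity matrix of a word of twisted operators applied to a monomial of the
same degree in the local coordinates. -/
theorem evalOne_word_localCoord (ξ : Module.Dual F (Matrix (Fin n) (Fin n) F))
    {y : κ → Matrix (Fin n) (Fin n) F} (hy : ∀ k i, η k (y i) = if k = i then 1 else 0)
    (w : List κ) (m : κ →₀ ℕ) (hm : m.degree = w.length) :
    evalOne ((w.map fun i => twistedOp ξ (y i)).prod
      (localCoord η (MvPolynomial.monomial m 1))) =
      if ∀ k, w.count k = m k then ∏ k, ((m k).factorial : F) else 0 := by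
  induction w using List.reverseRecOn generalizing m with
  | nil =>
    have : m = 0 := by simpa [Finsupp.degree_eq_zero_iff] using hm
    subst this
    simp
  | append_singleton w i ih =>
    rw [List.length_append, List.length_singleton] at hm
    have h0 := evalOne_word_eq_zero ξ (w.map y) (by simp [hm])
      (twistedOp_localCoord_monomial η ξ (fun k => hy k i) m)
    simp only [List.map_map, Function.comp_def, map_sub, sub_eq_zero] at h0
    rw [List.map_append, List.prod_append, List.map_singleton, List.prod_singleton,
      Module.End.mul_apply, h0, MvPolynomial.pderiv_monomial, one_mul]
    have hcount : ∀ k, (w ++ [i]).count k = w.count k + if k = i then 1 else 0 := by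
      intro k
      rw [List.count_append, List.count_singleton]
      simp only [beq_iff_eq]
      rw [if_congr (eq_comm (a := k)) rfl rfl]
    by_cases hi : m i = 0
    · rw [if_neg, hi]
      · simp
      · intro h
        have := h i
        rw [hcount, hi, if_pos rfl] at this
        omega
    · have hle : Finsupp.single i 1 ≤ m := by
        rw [Finsupp.single_le_iff]; omega
      set m' := m - Finsupp.single i 1 with hm'
      have hmm : m = m' + Finsupp.single i 1 := (tsub_add_cancel_of_le hle).symm
      have hdeg : m'.degree = w.length := by
        rw [hmm, map_add, Finsupp.degree_single] at hm
        omega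
      have e1 : (MvPolynomial.monomial m' (m i : F)) =
          (m i : F) • MvPolynomial.monomial m' (1 : F) := by
        rw [MvPolynomial.smul_monomial, smul_eq_mul, mul_one]
      rw [e1, map_smul, map_smul, map_smul, ih m' hdeg]
      have e2 : (∀ k, (w ++ [i]).count k = m k) ↔ ∀ k, w.count k = m' k := by
        refine forall_congr' fun k => ?_
        rw [hcount, hmm, Finsupp.add_apply, Finsupp.single_apply, if_congr (eq_comm (a := k)) rfl rfl]
        exact Nat.add_right_cancel_iff
      simp only [e2]
      split_ifs with h
      · rw [smul_eq_mul, ← Finset.mul_prod_erase _ _ (Finset.mem_univ i),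
          ← Finset.mul_prod_erase Finset.univ (fun k => ((m k).factorial : F)) (Finset.mem_univ i),
          ← mul_assoc]
        congr 1
        · have : m i = m' i + 1 := by rw [hmm]; simp
          rw [this, Nat.factorial_succ]; push_cast; ring
        · refine Finset.prod_congr rfl fun k hk => ?_
          have : m k = m' k := by
            rw [hmm]; simp [(Finset.ne_of_mem_erase hk).symm]
          rw [this]
      · simp

/-- The ordered monomials with exponents below `p` in linearly independent elements of `𝔩` are
linearly independent in `u_χ(𝔩)`: the independence half of the Poincaré-Birkhoff-Witt theorem. -/
theorem linearIndependent_orderedMonomial (p : ℕ) [Fact p.Prime] [CharP F p]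
    (𝔩 : LieSubalgebra F (Matrix (Fin n) (Fin n) F)) (χ : Module.Dual F 𝔩) {y : κ → 𝔩}
    (hy : LinearIndependent F y) {β : List κ} (hβ : β.Nodup) (hmem : ∀ k, k ∈ β) :
    LinearIndependent F fun m : κ → Fin p =>
      orderedMonomial (fun k => toEnv p 𝔩 χ (y k)) β fun k => (m k : ℕ) := by
  obtain ⟨ξ, hξ⟩ := LinearMap.exists_extend (p := 𝔩.toSubmodule) χ
  have hξ' : ∀ A : 𝔩, ξ A = χ A := fun A => congrArg (fun f => f A) hξ
  have hy' : LinearIndependent F fun k => (y k : Matrix (Fin n) (Fin n) F) :=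
    hy.map' 𝔩.toSubmodule.subtype (Submodule.ker_subtype _)
  obtain ⟨g, hg⟩ := LinearMap.exists_leftInverse_of_injective
    (Fintype.linearCombination F fun k => (y k : Matrix (Fin n) (Fin n) F))
    (LinearMap.ker_eq_bot.mpr
      hy'.fintypeLinearCombination_injective)
  let η : κ → Module.Dual F (Matrix (Fin n) (Fin n) F) := fun k => LinearMap.proj k ∘ₗ g
  have hη : ∀ k i, η k (y i) = if k = i then 1 else 0 := by
    intro k i
    have := congrArg (fun f => f (Pi.single i 1) k) hg
    simpa [Fintype.linearCombination_apply_single, Pi.single_apply, η] using this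
  classical
  rw [Fintype.linearIndependent_iff]
  intro a ha
  by_contra! hne
  obtain ⟨m₀, hm₀, hmax⟩ := Finset.exists_max_image
    (Finset.univ.filter fun m : κ → Fin p => a m ≠ 0) (fun m => ∑ k, (m k : ℕ))
    (by obtain ⟨i, hi⟩ := hne; exact ⟨i, by simpa using hi⟩)
  simp only [Finset.mem_filter, Finset.mem_univ, true_and] at hm₀ hmax
  let M : κ →₀ ℕ := Finsupp.equivFunOnFinite.symm fun k => (m₀ k : ℕ)
  have hM : ∀ k, M k = m₀ k := fun _ => rfl
  have hMdeg : M.degree = ∑ k, (m₀ k : ℕ) := by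
    rw [Finsupp.degree_eq_sum]; rfl
  have hlen : ∀ m : κ → Fin p,
      (orderedWord β fun k => (m k : ℕ)).length = ∑ k, (m k : ℕ) := by
    intro m
    rw [length_orderedWord, ← List.sum_toFinset _ hβ]
    congr 1
    ext k; simp [hmem k]
  have hval : ∀ m : κ → Fin p, evalOneQuot p (envRep ξ p 𝔩 χ hξ'
      (orderedMonomial (fun k => toEnv p 𝔩 χ (y k)) β fun k => (m k : ℕ))
        (Submodule.mkQ _ (localCoord η (MvPolynomial.monomial M 1)))) =
      evalOne (((orderedWord β fun k => (m k : ℕ)).map fun i => twistedOp ξ (y i)).prod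
        (localCoord η (MvPolynomial.monomial M 1))) := by
    intro m
    rw [← prod_map_orderedWord]
    have := envRep_word ξ p 𝔩 χ hξ' ((orderedWord β fun k => (m k : ℕ)).map y)
      (localCoord η (MvPolynomial.monomial M 1))
    simp only [List.map_map, Function.comp_def] at this
    rw [this, evalOneQuot_mkQ]
  have hsum := congrArg (fun u => evalOneQuot p (envRep ξ p 𝔩 χ hξ' u
    (Submodule.mkQ _ (localCoord η (MvPolynomial.monomial M 1))))) ha
  simp only [map_sum, map_smul, LinearMap.sum_apply, LinearMap.smul_apply, map_zero,
    LinearMap.zero_apply, hval] at hsum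
  rw [Finset.sum_eq_single m₀] at hsum
  · rw [evalOne_word_localCoord η ξ hη _ M (by rw [hMdeg, hlen]), if_pos, smul_eq_mul] at hsum
    · refine mul_ne_zero hm₀ (Finset.prod_ne_zero_iff.mpr fun k _ => ?_) hsum
      rw [Ne, CharP.cast_eq_zero_iff F p, (Fact.out : p.Prime).dvd_factorial, hM]
      have := (m₀ k).2
      omega
    · intro k
      rw [count_orderedWord hβ _ (hmem k), hM]
  · intro m _ hm
    by_cases ham : a m = 0
    · rw [ham, zero_smul]
    · rcases (hmax m ham).lt_or_eq with hlt | heq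
      · have := evalOne_word_eq_zero ξ ((orderedWord β fun k => (m k : ℕ)).map fun i => (y i : Matrix (Fin n) (Fin n) F))
          (by rw [List.length_map, hlen, hMdeg]; exact hlt)
          (localCoord_monomial_mem η M 1)
        simp only [List.map_map, Function.comp_def] at this
        rw [this, smul_zero]
      · rw [evalOne_word_localCoord η ξ hη _ M (by rw [hMdeg, hlen, heq]), if_neg, smul_zero]
        intro h
        apply hm
        funext k
        have := h k
        rw [count_orderedWord hβ _ (hmem k), hM] at this
        exact Fin.ext this
  · intro h; exact absurd (Finset.mem_univ _) h

end Independence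

/-! ### A reduced enveloping algebra as a module over that of a subalgebra -/

open scoped TensorProduct

section Spanning

variable {F : Type*} [Field F]

theorem one_mem_wordSpan {A ι Γ : Type*} [Ring A] [Algebra F A] [AddCommMonoid Γ] (x : ι → A)
    (β : List ι) (wt : ι → Γ) (r : ℕ) : 1 ∈ wordSpan F x β wt r 0 := by
  simpa using word_mem_wordSpan (F := F) (x := x) (wt := wt) (β := β) (w := []) (by simp)
    (r := r) (by simp) rfl

theorem exists_mem_wordSpan {A ι : Type*} [Ring A] [Algebra F A] {x : ι → A} {β : List ι}
    {a : A} (ha : a ∈ Algebra.adjoin F (x '' {i | i ∈ β})) :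
    ∃ r, a ∈ wordSpan F x β (fun _ => ()) r () := by
  induction ha using Algebra.adjoin_induction with
  | mem a ha =>
    obtain ⟨i, hi, rfl⟩ := ha
    exact ⟨1, generator_mem_wordSpan (wt := fun _ => ()) hi⟩
  | algebraMap c =>
    refine ⟨0, ?_⟩
    rw [Algebra.algebraMap_eq_smul_one]
    exact Submodule.smul_mem _ _ (one_mem_wordSpan x β (fun _ => ()) 0)
  | add a b _ _ ha hb =>
    obtain ⟨r, hr⟩ := ha
    obtain ⟨s, hs⟩ := hb
    exact ⟨max r s, add_mem (wordSpan_mono (le_max_left r s) _ hr)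
      (wordSpan_mono (le_max_right r s) _ hs)⟩
  | mul a b _ _ ha hb =>
    obtain ⟨r, hr⟩ := ha
    obtain ⟨s, hs⟩ := hb
    exact ⟨r + s, mul_mem_wordSpan hr hs⟩

variable {n : ℕ} (p : ℕ) (𝔩 : LieSubalgebra F (Matrix (Fin n) (Fin n) F)) (χ : Module.Dual F 𝔩)

theorem adjoin_range_toEnv : Algebra.adjoin F (Set.range (toEnv p 𝔩 χ)) = ⊤ := by
  have hsurj : Function.Surjective ((RingQuot.mkAlgHom F (ReducedRel p 𝔩 χ)).comp
      (UniversalEnvelopingAlgebra.mkAlgHom F 𝔩)) :=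
    (RingQuot.mkAlgHom_surjective F _).comp Quotient.mk_surjective
  rw [← AlgHom.range_eq_top, ← Algebra.map_top, ← TensorAlgebra.adjoin_range_ι, AlgHom.map_adjoin,
    ← Set.range_comp] at hsurj
  exact hsurj

variable {p 𝔩 χ}

theorem toEnv_mul_sub_mul (x y : 𝔩) : toEnv p 𝔩 χ x * toEnv p 𝔩 χ y -
    toEnv p 𝔩 χ y * toEnv p 𝔩 χ x = toEnv p 𝔩 χ ⁅x, y⁆ := by
  rw [LieHom.map_lie, Ring.lie_def]

theorem toEnv_mem_span {ι : Type*} {y : ι → 𝔩} {s : Set ι} {z : 𝔩}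
    (hz : z ∈ Submodule.span F (y '' s)) :
    toEnv p 𝔩 χ z ∈ Submodule.span F ((fun i => toEnv p 𝔩 χ (y i)) '' s) := by
  have := Submodule.mem_map_of_mem (f := (toEnv p 𝔩 χ : 𝔩 →ₗ[F] ReducedEnv p 𝔩 χ)) hz
  rw [Submodule.map_span, ← Set.image_comp] at this
  exact this

/-- Ordered monomials with exponents below `p` in a basis of `𝔩` whose elements have their `p`-th
powers in `𝔩` span `u_χ(𝔩)`. -/
theorem span_orderedMonomial_eq_top [hp : Fact p.Prime] {κ : Type*} (y : Module.Basis κ F 𝔩)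
    (hpow : ∀ i, (y i : Matrix (Fin n) (Fin n) F) ^ p ∈ 𝔩) {β : List κ} (hβ : β.Nodup)
    (hmem : ∀ k, k ∈ β) :
    Submodule.span F (Set.range fun m : κ → Fin p =>
      orderedMonomial (fun k => toEnv p 𝔩 χ (y k)) β fun k => (m k : ℕ)) = ⊤ := by
  have hp2 := hp.out.two_le
  set x : κ → ReducedEnv p 𝔩 χ := fun k => toEnv p 𝔩 χ (y k) with hx
  have huniv : {k | k ∈ β} = Set.univ := by ext k; simp [hmem k]
  have hspan : ∀ z, toEnv p 𝔩 χ z ∈ Submodule.span F (x '' {k | k ∈ β}) := by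
    intro z
    apply toEnv_mem_span
    rw [huniv, Set.image_univ, y.span_eq]
    exact Submodule.mem_top
  have hc : CommutatorsInSpan F x β (fun _ => ()) := by
    intro i _ j _
    simp only [hx, toEnv_mul_sub_mul, and_true]
    exact hspan _
  have hpw : ∀ i ∈ β, x i ^ p ∈ wordSpan F x β (fun _ => ()) (p - 1) (p • ()) := by
    intro i _
    have h1 := hspan ⟨_, hpow i⟩
    rw [show {k | k ∈ β} = {k | k ∈ β ∧ (fun _ : κ => ()) k = ()} by simp] at h1
    have h2 := span_generators_le_wordSpan () h1
    simp only [hx]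
    rw [toEnv_pow p 𝔩 χ (y i) ⟨_, hpow i⟩ rfl, Algebra.algebraMap_eq_smul_one]
    exact add_mem (wordSpan_mono (by omega) _ h2)
      (Submodule.smul_mem _ _ (one_mem_wordSpan x β (fun _ => ()) _))
  rw [eq_top_iff]
  intro a _
  have ha : a ∈ Algebra.adjoin F (x '' {k | k ∈ β}) := by
    have : a ∈ Algebra.adjoin F (Set.range (toEnv p 𝔩 χ)) := by
      rw [adjoin_range_toEnv]; exact Algebra.mem_top
    refine (Algebra.adjoin_le ?_ : _ ≤ Algebra.adjoin F (x '' {k | k ∈ β})) this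
    rintro _ ⟨z, rfl⟩
    exact Algebra.span_le_adjoin _ _ (hspan z)
  obtain ⟨r, hr⟩ := exists_mem_wordSpan ha
  have := wordSpan_le_span_orderedMonomial hβ hc hp.out.pos hpw r () hr
  refine Submodule.span_mono ?_ this
  rintro _ ⟨m, hm, -, -, rfl⟩
  exact ⟨fun k => ⟨m k, hm k (hmem k)⟩, rfl⟩

theorem exists_basis_pow_mem (h : 𝔩.toSubmodule ≤ Submodule.span F
    {x | x ∈ 𝔩 ∧ x ^ p ∈ 𝔩}) :
    ∃ (k : ℕ) (y : Module.Basis (Fin k) F 𝔩),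
      ∀ i, (y i : Matrix (Fin n) (Fin n) F) ^ p ∈ 𝔩 := by
  have hs : (⊤ : Submodule F 𝔩) ≤
      Submodule.span F {x : 𝔩 | (x : Matrix (Fin n) (Fin n) F) ^ p ∈ 𝔩} := by
    rw [← Submodule.map_le_map_iff_of_injective (f := 𝔩.toSubmodule.subtype)
      Subtype.val_injective, Submodule.map_span, Submodule.map_top, Submodule.range_subtype]
    refine h.trans (Submodule.span_mono ?_)
    rintro x ⟨hx, hxp⟩
    exact ⟨⟨x, hx⟩, hxp, rfl⟩
  have := FiniteDimensional.fintypeBasisIndex (Module.Basis.ofSpan hs)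
  refine ⟨_, (Module.Basis.ofSpan hs).reindex (Fintype.equivFin _), fun i => ?_⟩
  rw [Module.Basis.reindex_apply]
  exact Module.Basis.ofSpan_subset hs ⟨_, rfl⟩

theorem finite_reducedEnv [Fact p.Prime]
    (h : 𝔩.toSubmodule ≤ Submodule.span F {x | x ∈ 𝔩 ∧ x ^ p ∈ 𝔩}) :
    Module.Finite F (ReducedEnv p 𝔩 χ) := by
  classical
  obtain ⟨k, y, hy⟩ := exists_basis_pow_mem h
  have := span_orderedMonomial_eq_top (χ := χ) y hy (Finset.nodup_toList Finset.univ) (by simp)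
  exact ⟨Submodule.fg_def.mpr ⟨_, Set.finite_range _, this⟩⟩

theorem orderedMonomial_append {A ι₁ ι₂ : Type*} [Ring A] (x : ι₁ ⊕ ι₂ → A) (β₁ : List ι₁)
    (β₂ : List ι₂) (m : ι₁ ⊕ ι₂ → ℕ) :
    orderedMonomial x (β₁.map Sum.inl ++ β₂.map Sum.inr) m =
      orderedMonomial (fun i => x (Sum.inl i)) β₁ (fun i => m (Sum.inl i)) *
        orderedMonomial (fun i => x (Sum.inr i)) β₂ (fun i => m (Sum.inr i)) := by
  simp [orderedMonomial, Function.comp_def]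

theorem envMap_toEnv {𝔭 𝔤 : LieSubalgebra F (Matrix (Fin n) (Fin n) F)} (h : 𝔭 ≤ 𝔤)
    (χ : Module.Dual F 𝔤) (x : 𝔭) :
    envMap p h χ (toEnv p 𝔭 (restrictForm h χ) x) =
      toEnv p 𝔤 χ (LieSubalgebra.inclusion h x) := by
  change RingQuot.liftAlgHom F _ (RingQuot.mkAlgHom F _ (UniversalEnvelopingAlgebra.ι F x)) = _
  rw [RingQuot.liftAlgHom_mkAlgHom_apply, UniversalEnvelopingAlgebra.lift_ι_apply]
  rfl

/-- `u_χ(𝔤)` is a free right module over `u_χ(𝔭)`, with a basis containing `1`; so `u_χ(𝔭)` is a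
retract of `u_χ(𝔤)` as a right module. -/
theorem exists_retraction_envMap [Fact p.Prime] [CharP F p]
    {𝔭 𝔤 : LieSubalgebra F (Matrix (Fin n) (Fin n) F)} (h : 𝔭 ≤ 𝔤) (χ : Module.Dual F 𝔤)
    (h𝔤 : ∀ x ∈ 𝔤, x ^ p ∈ 𝔤)
    (h𝔭 : 𝔭.toSubmodule ≤ Submodule.span F {x | x ∈ 𝔭 ∧ x ^ p ∈ 𝔭}) :
    ∃ τ : ReducedEnv p 𝔤 χ →ₗ[F] ReducedEnv p 𝔭 (restrictForm h χ),
      τ 1 = 1 ∧ ∀ a b, τ (a * envMap p h χ b) = τ a * b := by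
  classical
  obtain ⟨k, y, hy⟩ := exists_basis_pow_mem h𝔭
  let W : Submodule F 𝔤 := Submodule.comap 𝔤.toSubmodule.subtype 𝔭.toSubmodule
  let e : 𝔭 ≃ₗ[F] W := (Submodule.comapSubtypeEquivOfLe (p := 𝔭.toSubmodule)
    (q := 𝔤.toSubmodule) h).symm
  let bQ := Module.finBasis F (𝔤 ⧸ W)
  let z := ((y.map e).sumQuot bQ).reindex (Equiv.sumComm _ _)
  have hz : ∀ i, z (Sum.inr i) = LieSubalgebra.inclusion h (y i) := by
    intro i
    simp only [z, Module.Basis.reindex_apply, Equiv.sumComm_symm, Equiv.sumComm_apply,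
      Sum.swap_inr, Module.Basis.sumQuot_inl, Module.Basis.map_apply]
    rfl
  set β₁ := (Finset.univ : Finset (Fin (Module.finrank F (𝔤 ⧸ W)))).toList
  set β₂ := (Finset.univ : Finset (Fin k)).toList
  have hβ₁ : β₁.Nodup := Finset.nodup_toList _
  have hβ₂ : β₂.Nodup := Finset.nodup_toList _
  have hmem₂ : ∀ i, i ∈ β₂ := by simp [β₂]
  have hβ : (β₁.map Sum.inl ++ β₂.map Sum.inr).Nodup := by
    rw [List.nodup_append']
    refine ⟨hβ₁.map Sum.inl_injective, hβ₂.map Sum.inr_injective, ?_⟩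
    intro a h1 h2
    obtain ⟨_, -, rfl⟩ := List.mem_map.mp h1
    obtain ⟨_, -, h⟩ := List.mem_map.mp h2
    cases h
  have hmem : ∀ i, i ∈ β₁.map Sum.inl ++ β₂.map Sum.inr := by
    rintro (i | i) <;> simp [β₁, β₂]
  -- ordered monomials, first in a complement of `𝔭` and then in `𝔭`
  let f₁ := fun m : Fin (Module.finrank F (𝔤 ⧸ W)) → Fin p =>
    orderedMonomial (fun i => toEnv p 𝔤 χ (z (Sum.inl i))) β₁ fun i => (m i : ℕ)
  let f₂ := fun m : Fin k → Fin p =>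
    orderedMonomial (fun i => toEnv p 𝔭 (restrictForm h χ) (y i)) β₂ fun i => (m i : ℕ)
  let f := fun m : Fin (Module.finrank F (𝔤 ⧸ W)) ⊕ Fin k → Fin p =>
    orderedMonomial (fun i => toEnv p 𝔤 χ (z i)) (β₁.map Sum.inl ++ β₂.map Sum.inr)
      fun i => (m i : ℕ)
  have hf : ∀ m, f m = f₁ (fun i => m (Sum.inl i)) * envMap p h χ (f₂ fun i => m (Sum.inr i)) := by
    intro m
    simp only [f, f₁, f₂, orderedMonomial_append]
    congr 1
    simp only [orderedMonomial, map_list_prod, List.map_map, Function.comp_def, map_pow,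
      envMap_toEnv, hz]
  let B := Module.Basis.mk (linearIndependent_orderedMonomial p 𝔤 χ z.linearIndependent hβ hmem)
    (span_orderedMonomial_eq_top z (fun i => h𝔤 _ (z i).2) hβ hmem).ge
  have hB : ∀ m, B m = f m := fun m => Module.Basis.mk_apply _ _ m
  have span₂ := span_orderedMonomial_eq_top (χ := restrictForm h χ) y hy hβ₂ hmem₂
  have hp0 : 0 < p := (Fact.out : p.Prime).pos
  let τ : ReducedEnv p 𝔤 χ →ₗ[F] ReducedEnv p 𝔭 (restrictForm h χ) :=
    B.constr F fun m => if ∀ i, (m (Sum.inl i) : ℕ) = 0 then f₂ fun i => m (Sum.inr i) else 0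
  have hτ : ∀ m₁ b, τ (f₁ m₁ * envMap p h χ b) = if ∀ i, (m₁ i : ℕ) = 0 then b else 0 := by
    intro m₁ b
    have hb : b ∈ Submodule.span F (Set.range f₂) := by rw [span₂]; exact Submodule.mem_top
    induction hb using Submodule.span_induction with
    | mem b hb =>
      obtain ⟨m₂, rfl⟩ := hb
      have := hf (Sum.elim m₁ m₂)
      simp only [Sum.elim_inl, Sum.elim_inr] at this
      rw [← this, ← hB, Module.Basis.constr_basis]
      rfl
    | zero => simp
    | add a b _ _ ha hb =>
      rw [map_add, mul_add, map_add, ha, hb]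
      split_ifs <;> simp
    | smul c b _ hb =>
      rw [map_smul, mul_smul_comm, map_smul, hb]
      split_ifs <;> simp
  refine ⟨τ, ?_, fun a b => ?_⟩
  · have h1 : f₁ (fun _ => ⟨0, hp0⟩) = 1 := by simp [f₁, orderedMonomial]
    have := hτ (fun _ => ⟨0, hp0⟩) 1
    rwa [map_one, mul_one, h1, if_pos fun _ => rfl] at this
  · have ha : a ∈ Submodule.span F (Set.range B) := by rw [B.span_eq]; exact Submodule.mem_top
    induction ha using Submodule.span_induction with
    | mem a ha =>
      obtain ⟨m, rfl⟩ := ha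
      rw [hB, hf, mul_assoc, ← map_mul, hτ, hτ]
      split_ifs <;> simp
    | zero => simp
    | add a b _ _ ha hb => rw [add_mul, map_add, ha, hb, map_add, add_mul]
    | smul c b _ hb => rw [smul_mul_assoc, map_smul, hb, map_smul, smul_mul_assoc]

/-- In the induced module `u_χ(𝔤) ⊗ L` over `u_χ(𝔭)`, the map `v ↦ 1 ⊗ v` is injective. -/
theorem induced_tmul_one_injective [Fact p.Prime] [CharP F p]
    {𝔭 𝔤 : LieSubalgebra F (Matrix (Fin n) (Fin n) F)} (h : 𝔭 ≤ 𝔤) (χ : Module.Dual F 𝔤)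
    (h𝔤 : ∀ x ∈ 𝔤, x ^ p ∈ 𝔤)
    (h𝔭 : 𝔭.toSubmodule ≤ Submodule.span F {x | x ∈ 𝔭 ∧ x ^ p ∈ 𝔭})
    {L : Type*} [AddCommGroup L] [Module F L] [Module (ReducedEnv p 𝔭 (restrictForm h χ)) L]
    [IsScalarTower F (ReducedEnv p 𝔭 (restrictForm h χ)) L] {v : L}
    (hv : Induced.tmul (envMap p h χ) 1 v = 0) : v = 0 := by
  obtain ⟨τ, hτ1, hτ⟩ := exists_retraction_envMap h χ h𝔤 h𝔭
  let act : ReducedEnv p 𝔤 χ →ₗ[F] L →ₗ[F] L := LinearMap.mk₂ F (fun a l => τ a • l)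
    (fun a b l => by rw [map_add, add_smul]) (fun c a l => by rw [map_smul, smul_assoc])
    (fun a l l' => smul_add _ _ _) (fun c a l => by rw [smul_algebra_smul_comm])
  let t := TensorProduct.lift act
  have key : ∀ x ∈ inducedRel (envMap p h χ) L, ∀ a : ReducedEnv p 𝔤 χ, t (a • x) = 0 := by
    intro x hx
    unfold inducedRel at hx
    induction hx using Submodule.span_induction with
    | mem x hx =>
      obtain ⟨a, b, l, rfl⟩ := hx
      intro a'
      rw [smul_sub, TensorProduct.smul_tmul', TensorProduct.smul_tmul', map_sub, sub_eq_zero,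
        TensorProduct.lift.tmul, TensorProduct.lift.tmul]
      change τ (a' * (a * _)) • l = τ (a' * a) • b • l
      rw [← mul_assoc, hτ, mul_smul]
    | zero => simp
    | add x y _ _ hx hy => intro a; rw [smul_add, map_add, hx, hy, add_zero]
    | smul a x _ hx => intro a'; rw [smul_smul, hx]
  have h0 : (1 : ReducedEnv p 𝔤 χ) ⊗ₜ[F] v ∈ inducedRel (envMap p h χ) L := by
    rwa [Induced.tmul, Submodule.mkQ_apply, Submodule.Quotient.mk_eq_zero] at hv
  have h1 := key _ h0 1
  rw [one_smul, TensorProduct.lift.tmul] at h1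
  change τ 1 • v = 0 at h1
  rwa [hτ1, one_smul] at h1

end Spanning

/-! ### The adjoint action and the weight space decomposition -/

section Adjoint

variable {F : Type*} [Field F] {n : ℕ}

/-- Right translation of polynomial functions on matrices: `(r_g f)(x) = f (x g)`. -/
noncomputable def rightTranslate (g : Matrix (Fin n) (Fin n) F) :
    MvPolynomial (Fin n × Fin n) F →ₐ[F] MvPolynomial (Fin n × Fin n) F :=
  MvPolynomial.aeval fun ij => ∑ k, MvPolynomial.X (ij.1, k) * MvPolynomial.C (g k ij.2)

theorem rightTranslate_X (g : Matrix (Fin n) (Fin n) F) (i j : Fin n) :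
    rightTranslate g (MvPolynomial.X (i, j)) =
      ∑ k, MvPolynomial.X (i, k) * MvPolynomial.C (g k j) := by
  rw [rightTranslate, MvPolynomial.aeval_X]

theorem rightTranslate_rightTranslate (g h : Matrix (Fin n) (Fin n) F)
    (f : MvPolynomial (Fin n × Fin n) F) :
    rightTranslate g (rightTranslate h f) = rightTranslate (g * h) f := by
  suffices h : (rightTranslate g).comp (rightTranslate h) = rightTranslate (g * h) from
    congrArg (fun φ => φ f) h
  apply MvPolynomial.algHom_ext
  rintro ⟨i, j⟩
  have hC : ∀ c : F, rightTranslate g (MvPolynomial.C c) = MvPolynomial.C c :=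
    fun c => (rightTranslate g).commutes c
  have h1 : ∀ k, rightTranslate g (MvPolynomial.X (i, k) * MvPolynomial.C (h k j)) =
      ∑ l, MvPolynomial.X (i, l) * (MvPolynomial.C (g l k) * MvPolynomial.C (h k j)) := by
    intro k
    rw [map_mul, hC, rightTranslate_X, Finset.sum_mul]
    exact Finset.sum_congr rfl fun l _ => mul_assoc _ _ _
  rw [AlgHom.comp_apply, rightTranslate_X, map_sum, Finset.sum_congr rfl fun k _ => h1 k,
    Finset.sum_comm, rightTranslate_X]
  refine Finset.sum_congr rfl fun l _ => ?_
  rw [← Finset.mul_sum, Matrix.mul_apply, map_sum]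
  simp only [map_mul]

theorem rightTranslate_one (f : MvPolynomial (Fin n × Fin n) F) : rightTranslate 1 f = f := by
  have : rightTranslate (1 : Matrix (Fin n) (Fin n) F) = AlgHom.id F _ := by
    apply MvPolynomial.algHom_ext
    rintro ⟨i, j⟩
    rw [rightTranslate_X, Finset.sum_eq_single j]
    · simp
    · intro k _ hk; simp [Matrix.one_apply_ne hk]
    · simp
  rw [this]; rfl

theorem leftInvDer_rightTranslate {g A B : Matrix (Fin n) (Fin n) F} (h : A * g = g * B)
    (f : MvPolynomial (Fin n × Fin n) F) :
    leftInvDer A (rightTranslate g f) = rightTranslate g (leftInvDer B f) := by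
  have hC : ∀ c : F, rightTranslate g (MvPolynomial.C c) = MvPolynomial.C c :=
    fun c => (rightTranslate g).commutes c
  induction f using MvPolynomial.induction_on with
  | C a => rw [hC, MvPolynomial.derivation_C, MvPolynomial.derivation_C, map_zero]
  | add f g hf hg => simp only [map_add, hf, hg]
  | mul_X f ij hf =>
    obtain ⟨i, j⟩ := ij
    have hX : leftInvDer A (rightTranslate g (MvPolynomial.X (i, j))) =
        rightTranslate g (leftInvDer B (MvPolynomial.X (i, j))) := by
      have h1 : ∀ M : Matrix (Fin n) (Fin n) F, leftInvDer M (MvPolynomial.X (i, j)) =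
          rightTranslate M (MvPolynomial.X (i, j)) := fun M => by
        rw [leftInvDer_X, rightTranslate_X]
      rw [← h1 g, h1 B, rightTranslate_rightTranslate, ← h, ← h1 (A * g), leftInvDer_comp_X]
    rw [map_mul, Derivation.leibniz, Derivation.leibniz, hf, hX]
    simp only [smul_eq_mul, map_add, map_mul]

variable {G : Subgroup (GL (Fin n) F)}

theorem mem_idealOf {f : MvPolynomial (Fin n × Fin n) F} :
    f ∈ idealOf G ↔ ∀ g ∈ G, MvPolynomial.aeval (entries g) f = 0 := by
  simp [idealOf, MvPolynomial.mem_vanishingIdeal_iff]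

theorem rightTranslate_mem_idealOf {g : GL (Fin n) F} (hg : g ∈ G)
    {f : MvPolynomial (Fin n × Fin n) F} (hf : f ∈ idealOf G) :
    rightTranslate (g : Matrix (Fin n) (Fin n) F) f ∈ idealOf G := by
  rw [mem_idealOf] at hf ⊢
  intro h hh
  have : (MvPolynomial.aeval (entries h)).comp (rightTranslate (g : Matrix (Fin n) (Fin n) F)) =
      MvPolynomial.aeval (entries (h * g)) := by
    apply MvPolynomial.algHom_ext
    rintro ⟨i, j⟩
    rw [AlgHom.comp_apply, rightTranslate_X]
    simp [entries, Matrix.mul_apply]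
  rw [← AlgHom.comp_apply, this]
  exact hf _ (mul_mem hh hg)

theorem conj_mem_lieAlg {g : GL (Fin n) F} (hg : g ∈ G) {A : Matrix (Fin n) (Fin n) F}
    (hA : A ∈ lieAlg G) : (g : Matrix (Fin n) (Fin n) F) * A *
      ((g⁻¹ : GL (Fin n) F) : Matrix (Fin n) (Fin n) F) ∈ lieAlg G := by
  intro f hf
  have h1 : rightTranslate (g : Matrix (Fin n) (Fin n) F)
      (rightTranslate ((g⁻¹ : GL (Fin n) F) : Matrix (Fin n) (Fin n) F) f) = f := by
    rw [rightTranslate_rightTranslate, Units.mul_inv, rightTranslate_one]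
  rw [← h1, leftInvDer_rightTranslate (B := A)]
  · exact rightTranslate_mem_idealOf hg (hA _ (rightTranslate_mem_idealOf (inv_mem hg) hf))
  · rw [mul_assoc, Units.inv_mul, mul_one]

/-- The components of a vector of a stable subspace in simultaneous eigenspaces lie in the
subspace. -/
theorem mem_of_sum_mem_of_eigen {V S : Type*} [AddCommGroup V] [Module F V]
    (a : S → Module.End F V) (W : Submodule F V) (hW : ∀ t, ∀ w ∈ W, a t w ∈ W)
    (s : Finset (S → F)) (x : (S → F) → V) (hx : ∀ μ ∈ s, ∀ t, a t (x μ) = μ t • x μ)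
    (hsum : ∑ μ ∈ s, x μ ∈ W) : ∀ μ ∈ s, x μ ∈ W := by
  classical
  induction s using Finset.induction_on generalizing x with
  | empty => simp
  | insert ν s hν ih =>
    rw [Finset.sum_insert hν] at hsum
    have key : ∀ μ ∈ s, x μ ∈ W := by
      intro μ hμ
      obtain ⟨t, ht⟩ := Function.ne_iff.mp (show μ ≠ ν from fun h => hν (h ▸ hμ))
      have h1 : ∑ μ ∈ s, (μ t - ν t) • x μ ∈ W := by
        have := sub_mem (hW t _ hsum) (W.smul_mem (ν t) hsum)
        rw [map_add, hx ν (Finset.mem_insert_self _ _), smul_add, add_sub_add_left_eq_sub, map_sum,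
          Finset.smul_sum, ← Finset.sum_sub_distrib] at this
        convert this using 2 with μ' hμ'
        rw [hx μ' (Finset.mem_insert_of_mem hμ'), sub_smul]
      have h2 := ih (fun μ => (μ t - ν t) • x μ) (fun μ' hμ' t' => by
        rw [map_smul, hx μ' (Finset.mem_insert_of_mem hμ'), smul_comm]) h1 μ hμ
      exact (W.smul_mem_iff (sub_ne_zero.mpr ht)).mp h2
    intro μ hμ
    rcases Finset.mem_insert.mp hμ with rfl | hμ
    · have := sub_mem hsum (W.sum_mem key)
      rwa [add_sub_cancel_right] at this
    · exact key μ hμ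

variable (T : MaximalTorus G)

/-- The adjoint action of an element of the torus. -/
noncomputable def torusAd (t : T.grp) : Module.End F (Matrix (Fin n) (Fin n) F) :=
  LinearMap.mulLeft F ((t : GL (Fin n) F) : Matrix (Fin n) (Fin n) F) ∘ₗ
    LinearMap.mulRight F (((t : GL (Fin n) F)⁻¹ : GL (Fin n) F) : Matrix (Fin n) (Fin n) F)

theorem torusAd_apply (t : T.grp) (A : Matrix (Fin n) (Fin n) F) :
    torusAd T t A = ((t : GL (Fin n) F) : Matrix (Fin n) (Fin n) F) * A *
      (((t : GL (Fin n) F)⁻¹ : GL (Fin n) F) : Matrix (Fin n) (Fin n) F) := by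
  rw [mul_assoc]; rfl

/-- A matrix entry of `T` in a basis in which `T` is diagonal, as a character. -/
noncomputable def diagChar (P : GL (Fin n) F)
    (hP : ∀ t ∈ T.grp, ((P * t * P⁻¹ : GL (Fin n) F) : Matrix (Fin n) (Fin n) F).IsDiag)
    (i : Fin n) : T.grp →* Fˣ :=
  MonoidHom.toHomUnits
    { toFun := fun t => ((P * (t : GL (Fin n) F) * P⁻¹ : GL (Fin n) F) : Matrix (Fin n) (Fin n) F) i i
      map_one' := by simp
      map_mul' := fun s t => by
        have : P * ((s * t : T.grp) : GL (Fin n) F) * P⁻¹ = 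
            (P * (s : GL (Fin n) F) * P⁻¹) * (P * (t : GL (Fin n) F) * P⁻¹) := by
          simp [mul_assoc]
        rw [this, Units.val_mul (P * (s : GL (Fin n) F) * P⁻¹), ← (hP s s.2).diagonal_diag,
          ← (hP t t.2).diagonal_diag, Matrix.diagonal_mul_diagonal]
        simp only [Matrix.diagonal_apply_eq, Matrix.diag_apply] }

theorem diagChar_mem (P : GL (Fin n) F)
    (hP : ∀ t ∈ T.grp, ((P * t * P⁻¹ : GL (Fin n) F) : Matrix (Fin n) (Fin n) F).IsDiag)
    (i : Fin n) : diagChar T P hP i ∈ charGroup T := by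
  have e : (fun t : T.grp => (diagChar T P hP i t : F)) =
      ∑ k, ∑ l, (((P : Matrix (Fin n) (Fin n) F) i l *
        ((P⁻¹ : GL (Fin n) F) : Matrix (Fin n) (Fin n) F) k i) •
          fun t : T.grp => entries (t : GL (Fin n) F) (l, k)) := by
    funext t
    change ((P * (t : GL (Fin n) F) * P⁻¹ : GL (Fin n) F) : Matrix (Fin n) (Fin n) F) i i = _
    rw [Units.val_mul, Units.val_mul]
    simp only [Matrix.mul_apply, Finset.sum_apply, Pi.smul_apply, entries, smul_eq_mul,
      Finset.sum_mul]
    exact Finset.sum_congr rfl fun k _ => Finset.sum_congr rfl fun l _ => by ring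
  change (fun t : T.grp => (diagChar T P hP i t : F)) ∈ regularFunctions T.grp
  rw [e]
  refine Subalgebra.sum_mem _ fun k _ => Subalgebra.sum_mem _ fun l _ =>
    Subalgebra.smul_mem _ ?_ _
  exact Algebra.subset_adjoin (Or.inl ⟨(l, k), rfl⟩)

theorem charLattice_ext {μ ν : CharLattice T} (h : ∀ t, (μ.val t : F) = ν.val t) : μ = ν := by
  apply Additive.toMul.injective
  apply Subtype.ext
  apply MonoidHom.ext
  intro t
  exact Units.ext (h t)

theorem diagonal_mul_single (v : Fin n → F) (i j : Fin n) (c : F) :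
    Matrix.diagonal v * Matrix.single i j c = Matrix.single i j (v i * c) := by
  ext k l
  rw [Matrix.diagonal_mul, Matrix.single_apply, Matrix.single_apply]
  split_ifs with h
  · rw [h.1]
  · rw [mul_zero]

theorem single_mul_diagonal (v : Fin n → F) (i j : Fin n) (c : F) :
    Matrix.single i j c * Matrix.diagonal v = Matrix.single i j (c * v j) := by
  ext k l
  rw [Matrix.mul_diagonal, Matrix.single_apply, Matrix.single_apply]
  split_ifs with h
  · rw [h.2]
  · rw [zero_mul]

/-- `𝔤` is the sum of its weight spaces under a maximal torus. -/
theorem lieAlg_le_iSup_weightSpace :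
    (lieAlg G).toSubmodule ≤ ⨆ μ : CharLattice T, weightSpace T μ := by
  classical
  obtain ⟨P, hP⟩ := T.isTorus.diagonalizable
  let μ : Fin n × Fin n → CharLattice T := fun ij =>
    Additive.ofMul ((⟨diagChar T P hP ij.1, diagChar_mem T P hP ij.1⟩ : charGroup T) /
      ⟨diagChar T P hP ij.2, diagChar_mem T P hP ij.2⟩)
  let val : CharLattice T → T.grp → F := fun μ t => (μ.val t : F)
  have hμ : ∀ ij t, val (μ ij) t * ((P * (t : GL (Fin n) F) * P⁻¹ : GL (Fin n) F) : Matrix (Fin n) (Fin n) F)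
      ij.2 ij.2 = ((P * (t : GL (Fin n) F) * P⁻¹ : GL (Fin n) F) : Matrix (Fin n) (Fin n) F) ij.1 ij.1 := by
    intro ij t
    change ((diagChar T P hP ij.1 t / diagChar T P hP ij.2 t : Fˣ) : F) *
      (diagChar T P hP ij.2 t : F) = (diagChar T P hP ij.1 t : F)
    rw [← Units.val_mul, div_mul_cancel]
  intro A hA
  set P' : Matrix (Fin n) (Fin n) F := ((P⁻¹ : GL (Fin n) F) : Matrix (Fin n) (Fin n) F) with hP'
  have hPP : P' * P = 1 := Units.inv_mul P
  have hPP' : (P : Matrix (Fin n) (Fin n) F) * P' = 1 := Units.mul_inv P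
  let Y : Fin n × Fin n → Matrix (Fin n) (Fin n) F := fun ij =>
    P' * Matrix.single ij.1 ij.2 (((P : Matrix (Fin n) (Fin n) F) * A * P') ij.1 ij.2) * P
  have hAY : A = ∑ ij, Y ij := by
    simp only [Y]
    rw [← Finset.sum_mul, ← Finset.mul_sum, Fintype.sum_prod_type,
      ← Matrix.matrix_eq_sum_single ((P : Matrix (Fin n) (Fin n) F) * A * P')]
    calc A = 1 * A * 1 := by simp
      _ = _ := by rw [← hPP]; simp only [mul_assoc]
  have hY : ∀ ij t, torusAd T t (Y ij) = val (μ ij) t • Y ij := by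
    rintro ⟨i, j⟩ t
    set c := ((P : Matrix (Fin n) (Fin n) F) * A * P') i j
    set d := ((P * (t : GL (Fin n) F) * P⁻¹ : GL (Fin n) F) : Matrix (Fin n) (Fin n) F) with hd
    have hdiag : d = Matrix.diagonal d.diag := ((hP t t.2).diagonal_diag).symm
    have h1 : ((t : GL (Fin n) F) : Matrix (Fin n) (Fin n) F) * P' = P' * d := by
      rw [hd, Units.val_mul, Units.val_mul, ← mul_assoc, ← mul_assoc, hPP, one_mul]
    have h2 : (P : Matrix (Fin n) (Fin n) F) * (t : GL (Fin n) F) = d * P := by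
      rw [hd, Units.val_mul, Units.val_mul, mul_assoc _ _ (P : Matrix (Fin n) (Fin n) F), ← hP',
        hPP, mul_one]
    have h3 : ((t : GL (Fin n) F) : Matrix (Fin n) (Fin n) F) * Y (i, j) =
        val (μ (i, j)) t • (Y (i, j) * (t : GL (Fin n) F)) := by
      have h4 : ((t : GL (Fin n) F) : Matrix (Fin n) (Fin n) F) * Y (i, j) =
          P' * (d * Matrix.single i j c) * P := by
        simp only [Y, ← mul_assoc]
        rw [h1]
      have h5 : Y (i, j) * (t : GL (Fin n) F) = P' * (Matrix.single i j c * d) * P := by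
        have h6 : Y (i, j) = P' * Matrix.single i j c * P := rfl
        rw [h6, mul_assoc _ (P : Matrix (Fin n) (Fin n) F), h2]
        simp only [mul_assoc]
      rw [h4, h5, hdiag, diagonal_mul_single, single_mul_diagonal, ← smul_mul_assoc,
        ← mul_smul_comm, Matrix.smul_single, smul_eq_mul, mul_left_comm, Matrix.diag_apply,
        Matrix.diag_apply, hμ (i, j) t, mul_comm c]
    rw [torusAd_apply, h3, smul_mul_assoc, mul_assoc, Units.mul_inv, mul_one]
  let x : (T.grp → F) → Matrix (Fin n) (Fin n) F := fun f =>
    ∑ ij with val (μ ij) = f, Y ij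
  have hsum : ∑ f ∈ Finset.univ.image (fun ij => val (μ ij)), x f = A := by
    rw [hAY]
    exact Finset.sum_fiberwise_of_maps_to (fun ij _ => Finset.mem_image_of_mem _ (Finset.mem_univ _)) _
  have hx : ∀ f t, torusAd T t (x f) = f t • x f := by
    intro f t
    simp only [x]
    rw [map_sum, Finset.smul_sum]
    refine Finset.sum_congr rfl fun ij hij => ?_
    rw [hY, (Finset.mem_filter.mp hij).2]
  have hmem := mem_of_sum_mem_of_eigen (torusAd T) (lieAlg G).toSubmodule
    (fun t w hw => by rw [torusAd_apply]; exact conj_mem_lieAlg (T.le t.2) hw)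
    (Finset.univ.image fun ij => val (μ ij)) x (fun f _ t => hx f t) (by rw [hsum]; exact hA)
  rw [← hsum]
  refine Submodule.sum_mem _ fun f hf => ?_
  obtain ⟨ij, -, rfl⟩ := Finset.mem_image.mp hf
  refine Submodule.mem_iSup_of_mem (μ ij) ⟨hmem _ hf, fun t => ?_⟩
  rw [← torusAd_apply, hx]

end Adjoint

/-! ### Invariance of the bilinear form under the Lie algebra -/

section InvariantForm

variable {F : Type*} [Field F] {n : ℕ}

theorem bilin_matrix_eq_sum (Φ : LinearMap.BilinForm F (Matrix (Fin n) (Fin n) F))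
    (A C : Matrix (Fin n) (Fin n) F) :
    Φ A C = ∑ ij : Fin n × Fin n, ∑ kl : Fin n × Fin n, A ij.1 ij.2 * C kl.1 kl.2 *
      Φ (Matrix.single ij.1 ij.2 1) (Matrix.single kl.1 kl.2 1) := by
  have h : ∀ A : Matrix (Fin n) (Fin n) F,
      A = ∑ ij : Fin n × Fin n, A ij.1 ij.2 • Matrix.single ij.1 ij.2 (1 : F) := by
    intro A
    conv_lhs => rw [Matrix.matrix_eq_sum_single A]
    rw [Fintype.sum_prod_type]
    simp [Matrix.smul_single]
  conv_lhs => rw [h A, h C]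
  simp only [map_sum, LinearMap.sum_apply, map_smul, LinearMap.smul_apply, smul_eq_mul,
    Finset.mul_sum]
  rw [Finset.sum_comm]
  exact Finset.sum_congr rfl fun _ _ => Finset.sum_congr rfl fun _ _ => by ring

/-- The derivative of a polynomial function at the identity matrix in the direction `H`. -/
noncomputable def derivOne (H : Matrix (Fin n) (Fin n) F) :
    MvPolynomial (Fin n × Fin n) F →ₗ[F] F :=
  (evalOne (F := F) (n := n)).toLinearMap ∘ₗ
    (leftInvDer H : MvPolynomial (Fin n × Fin n) F →ₗ[F] MvPolynomial (Fin n × Fin n) F)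

theorem derivOne_mul (H : Matrix (Fin n) (Fin n) F) (f g : MvPolynomial (Fin n × Fin n) F) :
    derivOne H (f * g) = evalOne f * derivOne H g + derivOne H f * evalOne g := by
  change evalOne (leftInvDer H (f * g)) = evalOne f * evalOne (leftInvDer H g) +
    evalOne (leftInvDer H f) * evalOne g
  rw [Derivation.leibniz]
  simp only [smul_eq_mul, map_add, map_mul]
  ring

theorem derivOne_C (H : Matrix (Fin n) (Fin n) F) (c : F) :
    derivOne H (MvPolynomial.C c) = 0 := by
  change evalOne (leftInvDer H _) = 0
  rw [MvPolynomial.derivation_C, map_zero]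

theorem map_derivOne_mul (H : Matrix (Fin n) (Fin n) F)
    (M N : Matrix (Fin n) (Fin n) (MvPolynomial (Fin n × Fin n) F)) :
    (M * N).map (derivOne H) = M.map evalOne * N.map (derivOne H) +
      M.map (derivOne H) * N.map evalOne := by
  ext i j
  simp only [Matrix.map_apply, Matrix.mul_apply, Matrix.add_apply, map_sum, derivOne_mul,
    Finset.sum_add_distrib]

theorem map_derivOne_C (H A : Matrix (Fin n) (Fin n) F) :
    (A.map MvPolynomial.C).map (derivOne H) = 0 := by
  ext i j
  rw [Matrix.map_apply, Matrix.map_apply, derivOne_C, Matrix.zero_apply]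

theorem map_evalOne_C (A : Matrix (Fin n) (Fin n) F) :
    (A.map MvPolynomial.C).map (evalOne (F := F) (n := n)) = A := by
  ext i j
  simp [evalOne]

theorem map_evalOne_mvPolynomialX :
    (Matrix.mvPolynomialX (Fin n) (Fin n) F).map evalOne = 1 := by
  ext i j
  simp [evalOne]

theorem map_derivOne_mvPolynomialX (H : Matrix (Fin n) (Fin n) F) :
    (Matrix.mvPolynomialX (Fin n) (Fin n) F).map (derivOne H) = H := by
  ext i j
  change evalOne (leftInvDer H (MvPolynomial.X (i, j))) = H i j
  rw [leftInvDer_X]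
  simp [evalOne, Matrix.one_apply]

theorem map_evalOne_adjugate :
    (Matrix.mvPolynomialX (Fin n) (Fin n) F).adjugate.map evalOne = 1 := by
  have := AlgHom.map_adjugate (evalOne (F := F)) (Matrix.mvPolynomialX (Fin n) (Fin n) F)
  rw [AlgHom.mapMatrix_apply, AlgHom.mapMatrix_apply, map_evalOne_mvPolynomialX,
    Matrix.adjugate_one] at this
  exact this

theorem map_derivOne_adjugate (H : Matrix (Fin n) (Fin n) F) :
    (Matrix.mvPolynomialX (Fin n) (Fin n) F).adjugate.map (derivOne H) =
      derivOne H (Matrix.mvPolynomialX (Fin n) (Fin n) F).det • 1 - H := by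
  have h := congrArg (fun M => M.map (derivOne H))
    (Matrix.mul_adjugate (Matrix.mvPolynomialX (Fin n) (Fin n) F))
  simp only [map_derivOne_mul, map_evalOne_mvPolynomialX, map_evalOne_adjugate,
    map_derivOne_mvPolynomialX, one_mul, mul_one] at h
  rw [eq_sub_iff_add_eq, h]
  ext i j
  by_cases hij : i = j
  · subst hij; simp
  · simp [hij]

/-- The matrix of polynomial functions `g ↦ g A adj(g) = det(g) Ad(g) A`. -/
noncomputable def conjPoly (A : Matrix (Fin n) (Fin n) F) :
    Matrix (Fin n) (Fin n) (MvPolynomial (Fin n × Fin n) F) :=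
  Matrix.mvPolynomialX (Fin n) (Fin n) F * A.map MvPolynomial.C *
    (Matrix.mvPolynomialX (Fin n) (Fin n) F).adjugate

theorem map_evalOne_mul (M N : Matrix (Fin n) (Fin n) (MvPolynomial (Fin n × Fin n) F)) :
    (M * N).map (evalOne (F := F)) = M.map evalOne * N.map evalOne :=
  map_mul (AlgHom.mapMatrix (evalOne (F := F))) M N

theorem map_evalOne_conjPoly (A : Matrix (Fin n) (Fin n) F) :
    (conjPoly A).map evalOne = A := by
  rw [conjPoly, map_evalOne_mul, map_evalOne_mul, map_evalOne_mvPolynomialX, map_evalOne_C,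
    map_evalOne_adjugate, one_mul, mul_one]

theorem map_derivOne_conjPoly (H A : Matrix (Fin n) (Fin n) F) :
    (conjPoly A).map (derivOne H) =
      ⁅H, A⁆ + derivOne H (Matrix.mvPolynomialX (Fin n) (Fin n) F).det • A := by
  rw [conjPoly, map_derivOne_mul, map_derivOne_mul, map_evalOne_mul, map_evalOne_mvPolynomialX,
    map_evalOne_C, map_evalOne_adjugate, map_derivOne_C, map_derivOne_mvPolynomialX,
    map_derivOne_adjugate, Ring.lie_def]
  simp only [one_mul, mul_one, mul_zero, zero_add, mul_sub, mul_smul_comm]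
  abel

variable {G : Subgroup (GL (Fin n) F)}

theorem map_aeval_conjPoly (g : GL (Fin n) F) (A : Matrix (Fin n) (Fin n) F) :
    (conjPoly A).map (MvPolynomial.aeval (entries g)) =
      (g : Matrix (Fin n) (Fin n) F).det • ((g : Matrix (Fin n) (Fin n) F) * A *
        ((g⁻¹ : GL (Fin n) F) : Matrix (Fin n) (Fin n) F)) := by
  have hx : (Matrix.mvPolynomialX (Fin n) (Fin n) F).map (MvPolynomial.aeval (entries g)) =
      (g : Matrix (Fin n) (Fin n) F) := by
    ext i j; simp [entries]
  have hadj : (Matrix.mvPolynomialX (Fin n) (Fin n) F).adjugate.map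
      (MvPolynomial.aeval (entries g)) = (g : Matrix (Fin n) (Fin n) F).adjugate := by
    have := AlgHom.map_adjugate (MvPolynomial.aeval (R := F) (entries g))
      (Matrix.mvPolynomialX (Fin n) (Fin n) F)
    rw [AlgHom.mapMatrix_apply, AlgHom.mapMatrix_apply, hx] at this
    exact this
  have hC : (A.map MvPolynomial.C).map (MvPolynomial.aeval (R := F) (entries g)) = A := by
    ext i j; simp
  have hmul : ∀ M N : Matrix (Fin n) (Fin n) (MvPolynomial (Fin n × Fin n) F),
      (M * N).map (MvPolynomial.aeval (R := F) (entries g)) =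
      M.map (MvPolynomial.aeval (R := F) (entries g)) *
        N.map (MvPolynomial.aeval (R := F) (entries g)) :=
    fun M N => map_mul (AlgHom.mapMatrix (MvPolynomial.aeval (R := F) (entries g))) M N
  have hinv : (g : Matrix (Fin n) (Fin n) F).adjugate =
      (g : Matrix (Fin n) (Fin n) F).det • ((g⁻¹ : GL (Fin n) F) : Matrix (Fin n) (Fin n) F) := by
    have h1 := Matrix.adjugate_mul (g : Matrix (Fin n) (Fin n) F)
    have h2 := congrArg (· * ((g⁻¹ : GL (Fin n) F) : Matrix (Fin n) (Fin n) F)) h1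
    simp only [mul_assoc, Units.mul_inv, mul_one, smul_mul_assoc, one_mul] at h2
    exact h2
  rw [conjPoly, hmul, hmul, hx, hC, hadj, hinv, mul_smul_comm]

/-- A `G`-invariant bilinear form on `𝔤` is `𝔤`-invariant: differentiate at the identity the relation
`B(g A adj(g), g C adj(g)) = det(g)² B(A, C)`. -/
theorem bilin_lie_eq_zero_of_invariant (B : LinearMap.BilinForm F (lieAlg G))
    (hB : ∀ g ∈ G, ∀ X Y X' Y' : lieAlg G,
      (X' : Matrix (Fin n) (Fin n) F) =
        (g : Matrix (Fin n) (Fin n) F) * X * ((g⁻¹ : GL (Fin n) F) : Matrix (Fin n) (Fin n) F) →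
      (Y' : Matrix (Fin n) (Fin n) F) =
        (g : Matrix (Fin n) (Fin n) F) * Y * ((g⁻¹ : GL (Fin n) F) : Matrix (Fin n) (Fin n) F) →
      B X' Y' = B X Y) (H X Y : lieAlg G) :
    B ⁅H, X⁆ Y + B X ⁅H, Y⁆ = 0 := by
  obtain ⟨π, hπ⟩ := LinearMap.exists_leftInverse_of_injective (lieAlg G).toSubmodule.subtype
    (Submodule.ker_subtype _)
  have hπ' : ∀ Z : lieAlg G, π Z = Z := fun Z => congrArg (fun f => f Z) hπ
  let Φ : LinearMap.BilinForm F (Matrix (Fin n) (Fin n) F) := B.compl₁₂ π π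
  have hΦ : ∀ Z W : lieAlg G, Φ Z W = B Z W := fun Z W => by
    change B (π Z) (π W) = _
    rw [hπ', hπ']
  let c : Fin n × Fin n → Fin n × Fin n → F := fun ij kl =>
    Φ (Matrix.single ij.1 ij.2 1) (Matrix.single kl.1 kl.2 1)
  let Q : MvPolynomial (Fin n × Fin n) F :=
    ∑ ij : Fin n × Fin n, ∑ kl : Fin n × Fin n,
      conjPoly (X : Matrix (Fin n) (Fin n) F) ij.1 ij.2 *
        conjPoly (Y : Matrix (Fin n) (Fin n) F) kl.1 kl.2 * MvPolynomial.C (c ij kl)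
  let R : MvPolynomial (Fin n × Fin n) F :=
    (Matrix.mvPolynomialX (Fin n) (Fin n) F).det *
      (Matrix.mvPolynomialX (Fin n) (Fin n) F).det * MvPolynomial.C (B X Y)
  have hQR : Q - R ∈ idealOf G := by
    rw [mem_idealOf]
    intro g hg
    have hdet : MvPolynomial.aeval (entries g) (Matrix.mvPolynomialX (Fin n) (Fin n) F).det =
        (g : Matrix (Fin n) (Fin n) F).det := by
      rw [AlgHom.map_det, AlgHom.mapMatrix_apply]
      congr 1
      ext i j; simp [entries]
    have hcX := fun i j => congrFun (congrFun (map_aeval_conjPoly g (X : Matrix (Fin n) (Fin n) F)) i) j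
    have hcY := fun i j => congrFun (congrFun (map_aeval_conjPoly g (Y : Matrix (Fin n) (Fin n) F)) i) j
    simp only [Matrix.map_apply] at hcX hcY
    have hQ : MvPolynomial.aeval (entries g) Q =
        Φ ((g : Matrix (Fin n) (Fin n) F).det • ((g : Matrix (Fin n) (Fin n) F) * X *
          ((g⁻¹ : GL (Fin n) F) : Matrix (Fin n) (Fin n) F)))
          ((g : Matrix (Fin n) (Fin n) F).det • ((g : Matrix (Fin n) (Fin n) F) * Y *
          ((g⁻¹ : GL (Fin n) F) : Matrix (Fin n) (Fin n) F))) := by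
      rw [bilin_matrix_eq_sum Φ]
      simp only [Q, map_sum, map_mul, hcX, hcY, MvPolynomial.aeval_C, Algebra.algebraMap_self,
        RingHom.id_apply, c]
    have hΦg := hΦ ⟨_, conj_mem_lieAlg hg X.2⟩ ⟨_, conj_mem_lieAlg hg Y.2⟩
    rw [hB g hg X Y _ _ rfl rfl] at hΦg
    simp only at hΦg
    rw [map_sub, hQ, map_smul, map_smul, LinearMap.smul_apply, hΦg]
    simp only [R, map_mul, hdet, MvPolynomial.aeval_C, Algebra.algebraMap_self, RingHom.id_apply,
      smul_eq_mul]
    ring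
  have hone : derivOne H (Q - R) = 0 := mem_idealOf.mp (H.2 _ hQR) 1 (one_mem G)
  set δ := derivOne (H : Matrix (Fin n) (Fin n) F) (Matrix.mvPolynomialX (Fin n) (Fin n) F).det
    with hδ
  have hdet1 : evalOne (Matrix.mvPolynomialX (Fin n) (Fin n) F).det = 1 := by
    rw [AlgHom.map_det, AlgHom.mapMatrix_apply, map_evalOne_mvPolynomialX, Matrix.det_one]
  have hevC : ∀ a : F, evalOne (n := n) (MvPolynomial.C a) = a := fun a => by simp [evalOne]
  have hR : derivOne H R = 2 * δ * B X Y := by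
    simp only [R, derivOne_mul, derivOne_C, hdet1, hevC, ← hδ]
    ring
  have hev := fun (A : Matrix (Fin n) (Fin n) F) i j =>
    congrFun (congrFun (map_evalOne_conjPoly A) i) j
  have hder := fun (A : Matrix (Fin n) (Fin n) F) i j =>
    congrFun (congrFun (map_derivOne_conjPoly (H : Matrix (Fin n) (Fin n) F) A) i) j
  simp only [Matrix.map_apply, ← hδ] at hev hder
  have hQ : derivOne H Q = Φ X (⁅(H : Matrix (Fin n) (Fin n) F), (Y : Matrix (Fin n) (Fin n) F)⁆ + δ • (Y : Matrix (Fin n) (Fin n) F)) +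
      Φ (⁅(H : Matrix (Fin n) (Fin n) F), (X : Matrix (Fin n) (Fin n) F)⁆ + δ • (X : Matrix (Fin n) (Fin n) F)) Y := by
    rw [bilin_matrix_eq_sum Φ, bilin_matrix_eq_sum Φ, ← Finset.sum_add_distrib]
    simp only [Q, map_sum]
    refine Finset.sum_congr rfl fun ij _ => ?_
    rw [← Finset.sum_add_distrib]
    refine Finset.sum_congr rfl fun kl _ => ?_
    rw [derivOne_mul, derivOne_mul, derivOne_C, hevC, hev, hev, hder, hder]
    ring
  have h1 := hΦ X ⁅H, Y⁆
  have h2 := hΦ ⁅H, X⁆ Y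
  rw [LieSubalgebra.coe_bracket] at h1 h2
  rw [map_sub, hQ, hR, map_add, map_add, LinearMap.add_apply, map_smul, map_smul,
    LinearMap.smul_apply, hΦ X Y, h1, h2, smul_eq_mul] at hone
  linear_combination hone

variable {T : MaximalTorus G}

/-- For an invariant form, weight spaces of non-opposite weights are orthogonal. -/
theorem bilin_weightSpace_eq_zero {B : LinearMap.BilinForm F (lieAlg G)}
    (hB : ∀ g ∈ G, ∀ X Y X' Y' : lieAlg G,
      (X' : Matrix (Fin n) (Fin n) F) =
        (g : Matrix (Fin n) (Fin n) F) * X * ((g⁻¹ : GL (Fin n) F) : Matrix (Fin n) (Fin n) F) →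
      (Y' : Matrix (Fin n) (Fin n) F) =
        (g : Matrix (Fin n) (Fin n) F) * Y * ((g⁻¹ : GL (Fin n) F) : Matrix (Fin n) (Fin n) F) →
      B X' Y' = B X Y) {μ ν : CharLattice T} (hμν : μ + ν ≠ 0) {X Y : lieAlg G}
    (hX : (X : Matrix (Fin n) (Fin n) F) ∈ weightSpace T μ)
    (hY : (Y : Matrix (Fin n) (Fin n) F) ∈ weightSpace T ν) : B X Y = 0 := by
  by_contra hne
  refine hμν (charLattice_ext T fun t => ?_)
  have h := hB t (T.le t.2) X Y ((μ.val t : F) • X) ((ν.val t : F) • Y) (hX.2 t).symm (hY.2 t).symm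
  rw [map_smul, map_smul, LinearMap.smul_apply, smul_eq_mul, smul_eq_mul, ← mul_assoc] at h
  have h1 := mul_right_cancel₀ hne (h.trans (one_mul _).symm)
  rw [CharLattice.val_add, Units.val_mul, mul_comm, h1]
  rfl

/-- Opposite root vectors have opposite weights under the Cartan subalgebra: this rests on the
existence of a nondegenerate invariant form on `𝔤`, which pairs them nontrivially. -/
theorem add_eq_zero_of_lie_eq_smul (hG : HasInvariantForm G) {μ : CharLattice T} {h e f : lieAlg G}
    (he0 : e ≠ 0)
    (he : (e : Matrix (Fin n) (Fin n) F) ∈ weightSpace T μ)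
    (hf : Submodule.span F {(f : Matrix (Fin n) (Fin n) F)} = weightSpace T (-μ)) {c c' : F}
    (hc : ⁅h, e⁆ = c • e) (hc' : ⁅h, f⁆ = c' • f) : c + c' = 0 := by
  obtain ⟨B, hnd, hB⟩ := hG
  have hBef : B e f ≠ 0 := by
    intro h0
    apply he0
    refine hnd.1 e fun Y => ?_
    have hle : (lieAlg G).toSubmodule ≤
        Submodule.map (lieAlg G).toSubmodule.subtype (LinearMap.ker (B e)) := by
      refine (lieAlg_le_iSup_weightSpace T).trans (iSup_le fun ν y hy => ?_)
      refine ⟨⟨y, hy.1⟩, ?_, rfl⟩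
      rw [SetLike.mem_coe, LinearMap.mem_ker]
      by_cases hν : μ + ν = 0
      · obtain rfl : ν = -μ := (neg_eq_of_add_eq_zero_right hν).symm
        rw [← hf, Submodule.mem_span_singleton] at hy
        obtain ⟨a, rfl⟩ := hy
        have : (⟨a • (f : Matrix (Fin n) (Fin n) F), SMulMemClass.smul_mem a f.2⟩ : lieAlg G) =
          a • f := rfl
        rw [this, map_smul, h0, smul_zero]
      · exact bilin_weightSpace_eq_zero hB hν he hy
    obtain ⟨Z, hZ, hZY⟩ := hle Y.2
    rw [← Subtype.ext hZY]
    exact hZ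
  have key := bilin_lie_eq_zero_of_invariant B hB h e f
  rw [hc, hc', map_smul, map_smul, LinearMap.smul_apply, smul_eq_mul, smul_eq_mul, ← add_mul] at key
  exact (mul_eq_zero.mp key).resolve_right hBef

end InvariantForm

/-! ### The grading of `𝔤` by the height outside `I` -/

section Grading

variable {F : Type*} [Field F] {n : ℕ} {G : Subgroup (GL (Fin n) F)} {T : MaximalTorus G}
  {ι : Type*} {R : RootPairing ι ℤ (CharLattice T) (CocharLattice T)}

open Classical in
/-- The character `μ` is an integral combination of simple roots in which the coefficients of the
simple roots outside `I` have sum `d`. -/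
def HasDegree (b : R.Base) (I : Finset ι) (μ : CharLattice T) (d : ℤ) : Prop :=
  ∃ c : ι → ℤ, μ = ∑ j ∈ b.support, c j • R.root j ∧
    d = ∑ j ∈ b.support, if j ∈ I then 0 else c j

variable {b : R.Base} {I : Finset ι}

theorem HasDegree.zero : HasDegree b I 0 0 := ⟨fun _ => 0, by simp, by simp⟩

theorem HasDegree.add {μ ν : CharLattice T} {d e : ℤ} (h : HasDegree b I μ d)
    (h' : HasDegree b I ν e) : HasDegree b I (μ + ν) (d + e) := by
  obtain ⟨c, rfl, rfl⟩ := h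
  obtain ⟨c', rfl, rfl⟩ := h'
  refine ⟨c + c', by simp [add_smul, Finset.sum_add_distrib], ?_⟩
  rw [← Finset.sum_add_distrib]
  refine Finset.sum_congr rfl fun j _ => ?_
  split_ifs <;> simp

theorem HasDegree.neg {μ : CharLattice T} {d : ℤ} (h : HasDegree b I μ d) :
    HasDegree b I (-μ) (-d) := by
  obtain ⟨c, rfl, rfl⟩ := h
  refine ⟨-c, by simp, ?_⟩
  rw [← Finset.sum_neg_distrib]
  refine Finset.sum_congr rfl fun j _ => ?_
  split_ifs <;> simp

theorem coeff_unique {c c' : ι → ℤ} (h : ∑ j ∈ b.support, c j • R.root j =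
    ∑ j ∈ b.support, c' j • R.root j) : ∀ j ∈ b.support, c j = c' j := by
  intro j hj
  have h0 : ∑ j ∈ b.support, (c j - c' j) • R.root j = 0 := by
    simp only [sub_smul, Finset.sum_sub_distrib, h, sub_self]
  exact sub_eq_zero.mp (linearIndepOn_finset_iff.mp b.linearIndepOn_root _ h0 j hj)

theorem HasDegree.unique {μ : CharLattice T} {d e : ℤ} (h : HasDegree b I μ d)
    (h' : HasDegree b I μ e) : d = e := by
  obtain ⟨c, rfl, rfl⟩ := h
  obtain ⟨c', h', rfl⟩ := h'
  refine Finset.sum_congr rfl fun j hj => ?_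
  rw [coeff_unique h' j hj]

theorem hasDegree_of_inLevi (hI : I ⊆ b.support) {i : ι} (hi : InLevi R I i) :
    HasDegree b I (R.root i) 0 := by
  classical
  obtain ⟨c, hc⟩ := exists_int_sum hi
  refine ⟨fun j => if j ∈ I then c j else 0, ?_, ?_⟩
  · simp only [ite_smul, zero_smul]
    rw [hc, ← Finset.sum_filter, Finset.filter_mem_eq_inter, Finset.inter_eq_right.mpr hI]
  · exact (Finset.sum_eq_zero fun j _ => by by_cases h : j ∈ I <;> simp [h]).symm

theorem exists_hasDegree_of_isPositive {i : ι} (hi : IsPositive b i) :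
    ∃ d : ℕ, HasDegree b I (R.root i) d ∧ (¬ InLevi R I i → 0 < d) := by
  classical
  obtain ⟨c, hc⟩ := exists_nat_sum hi
  refine ⟨∑ j ∈ b.support, if j ∈ I then 0 else c j,
    ⟨fun j => c j, by simpa using hc, by simp⟩, fun hL => ?_⟩
  by_contra! h0
  refine hL ?_
  unfold InLevi
  rw [hc]
  refine AddSubgroup.sum_mem _ fun j hj => ?_
  by_cases hjI : j ∈ I
  · exact AddSubgroup.nsmul_mem _ (AddSubgroup.subset_closure
      (Set.mem_image_of_mem R.root (Finset.mem_coe.mpr hjI))) _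
  · have := Finset.sum_eq_zero_iff.mp (Nat.le_zero.mp h0) j hj
    rw [if_neg hjI] at this
    rw [this, zero_smul]
    exact AddSubgroup.zero_mem _

theorem exists_root_eq_neg (i : ι) : ∃ j, R.root j = -R.root i :=
  ⟨R.reflectionPerm i i, by simp⟩

theorem isPositive_or_of_root_eq_neg (i : ι) :
    IsPositive b i ∨ ∃ j, R.root j = -R.root i ∧ IsPositive b j := by
  rcases b.root_mem_or_neg_mem i with h | h
  · exact Or.inl h
  · obtain ⟨j, hj⟩ := exists_root_eq_neg (R := R) i
    exact Or.inr ⟨j, hj, by unfold IsPositive; rw [hj]; exact h⟩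

theorem inLevi_of_root_eq_neg {i j : ι} (h : R.root j = -R.root i) (hj : InLevi R I j) :
    InLevi R I i := by
  unfold InLevi at hj ⊢
  rw [h] at hj
  exact neg_mem_iff.mp hj

theorem isPositive_of_hasDegree_pos {i : ι} {d : ℤ} (h : HasDegree b I (R.root i) d)
    (hd : 0 < d) : IsPositive b i := by
  rcases isPositive_or_of_root_eq_neg (b := b) i with hp | ⟨j, hj, hp⟩
  · exact hp
  · obtain ⟨e, he, -⟩ := exists_hasDegree_of_isPositive (I := I) hp
    rw [hj] at he
    have := he.unique h.neg
    omega

theorem not_inLevi_of_hasDegree (hI : I ⊆ b.support) {i : ι} {d : ℤ}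
    (h : HasDegree b I (R.root i) d) (hd : d ≠ 0) : ¬ InLevi R I i :=
  fun hL => hd (h.unique (hasDegree_of_inLevi hI hL))

theorem inLevi_of_hasDegree_zero {i : ι} (h : HasDegree b I (R.root i) 0) : InLevi R I i := by
  by_contra hL
  rcases isPositive_or_of_root_eq_neg (b := b) i with hp | ⟨j, hj, hp⟩
  · obtain ⟨e, he, hpos⟩ := exists_hasDegree_of_isPositive (I := I) hp
    have := he.unique h
    have := hpos hL
    omega
  · obtain ⟨e, he, hpos⟩ := exists_hasDegree_of_isPositive (I := I) hp
    rw [hj] at he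
    have := he.unique h.neg
    have := hpos fun hLj => hL (inLevi_of_root_eq_neg hj hLj)
    omega

/-- The sum of the weight spaces of degree `d`. -/
def degreeSpace (b : R.Base) (I : Finset ι) (d : ℤ) : Submodule F (lieAlg G) :=
  ⨆ μ : {μ : CharLattice T // HasDegree b I μ d},
    (weightSpace T (μ : CharLattice T)).comap (lieAlg G).toSubmodule.subtype

theorem mem_degreeSpace {μ : CharLattice T} {d : ℤ} (h : HasDegree b I μ d) {x : lieAlg G}
    (hx : (x : Matrix (Fin n) (Fin n) F) ∈ weightSpace T μ) : x ∈ degreeSpace b I d :=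
  Submodule.mem_iSup_of_mem (p := fun μ : {μ : CharLattice T // HasDegree b I μ d} =>
    (weightSpace T (μ : CharLattice T)).comap (lieAlg G).toSubmodule.subtype) ⟨μ, h⟩ hx

theorem degreeSpace_le {d : ℤ} {W : Submodule F (lieAlg G)}
    (h : ∀ μ, HasDegree b I μ d → ∀ x : lieAlg G,
      (x : Matrix (Fin n) (Fin n) F) ∈ weightSpace T μ → x ∈ W) : degreeSpace b I d ≤ W :=
  iSup_le fun μ x hx => h μ μ.2 x hx

theorem lie_mem_degreeSpace {d e : ℤ} {x y : lieAlg G} (hx : x ∈ degreeSpace b I d)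
    (hy : y ∈ degreeSpace b I e) : ⁅x, y⁆ ∈ degreeSpace b I (d + e) := by
  unfold degreeSpace at hx
  induction hx using Submodule.iSup_induction' with
  | zero => rw [zero_lie]; exact zero_mem _
  | add x₁ x₂ _ _ h₁ h₂ => rw [add_lie]; exact add_mem h₁ h₂
  | mem μ x hx =>
    unfold degreeSpace at hy
    induction hy using Submodule.iSup_induction' with
    | zero => rw [lie_zero]; exact zero_mem _
    | add y₁ y₂ _ _ h₁ h₂ => rw [lie_add]; exact add_mem h₁ h₂
    | mem ν y hy => exact mem_degreeSpace (μ.2.add ν.2) (lie_mem_weightSpace T hx hy)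

theorem eq_zero_or_root (hR : IsRootDatumOf T R) {μ : CharLattice T} {x : Matrix (Fin n) (Fin n) F}
    (hx : x ∈ weightSpace T μ) (hx0 : x ≠ 0) : μ = 0 ∨ ∃ i, R.root i = μ := by
  by_cases h0 : μ = 0
  · exact Or.inl h0
  · have : μ ∈ Set.range R.root := by
      rw [hR.roots]
      exact ⟨h0, fun h => hx0 ((Submodule.mem_bot F).mp (h ▸ hx))⟩
    exact Or.inr this

theorem exists_hasDegree_root (i : ι) : ∃ d, HasDegree b I (R.root i) d := by
  rcases isPositive_or_of_root_eq_neg (b := b) i with hp | ⟨j, hj, hp⟩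
  · obtain ⟨d, hd, -⟩ := exists_hasDegree_of_isPositive (I := I) hp
    exact ⟨d, hd⟩
  · obtain ⟨d, hd, -⟩ := exists_hasDegree_of_isPositive (I := I) hp
    rw [hj] at hd
    exact ⟨-d, by simpa using hd.neg⟩

theorem iSup_degreeSpace (hR : IsRootDatumOf T R) : ⨆ d, degreeSpace b I d = ⊤ := by
  rw [eq_top_iff]
  intro x _
  have hle : (lieAlg G).toSubmodule ≤
      Submodule.map (lieAlg G).toSubmodule.subtype (⨆ d, degreeSpace b I d) := by
    refine (lieAlg_le_iSup_weightSpace T).trans (iSup_le fun μ y hy => ?_)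
    by_cases hy0 : y = 0
    · rw [hy0]; exact zero_mem _
    refine ⟨⟨y, hy.1⟩, ?_, rfl⟩
    have : ∃ d, HasDegree b I μ d := by
      rcases eq_zero_or_root hR hy hy0 with rfl | ⟨i, rfl⟩
      · exact ⟨0, HasDegree.zero⟩
      · exact exists_hasDegree_root i
    obtain ⟨d, hd⟩ := this
    exact Submodule.mem_iSup_of_mem d (mem_degreeSpace hd hy)
  obtain ⟨z, hz, hzx⟩ := hle x.2
  rw [← Subtype.ext hzx]
  exact hz

theorem mem_parabolic_of_mem_degreeSpace (hR : IsRootDatumOf T R) (hI : I ⊆ b.support) {d : ℤ}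
    (hd : 0 ≤ d) {x : lieAlg G} (hx : x ∈ degreeSpace b I d) :
    (x : Matrix (Fin n) (Fin n) F) ∈ parabolic hR b I hI := by
  refine degreeSpace_le (W := (parabolic hR b I hI).toSubmodule.comap
    (lieAlg G).toSubmodule.subtype) (fun μ hμ y hy => ?_) hx
  change (y : Matrix (Fin n) (Fin n) F) ∈ parabolic hR b I hI
  by_cases hy0 : (y : Matrix (Fin n) (Fin n) F) = 0
  · rw [hy0]; exact zero_mem _
  rw [mem_parabolic, levi_sup_nilradical]
  refine Submodule.mem_iSup_of_mem μ (Submodule.mem_iSup_of_mem ?_ hy)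
  rcases eq_zero_or_root hR hy hy0 with rfl | ⟨i, rfl⟩
  · exact Or.inl rfl
  · refine Or.inr ⟨i, rfl, ?_⟩
    rcases hd.eq_or_lt with rfl | hd
    · exact Or.inl (inLevi_of_hasDegree_zero hμ)
    · exact Or.inr (isPositive_of_hasDegree_pos hμ hd)

theorem exists_root_of_hasDegree_ne_zero (hR : IsRootDatumOf T R) {μ : CharLattice T} {d : ℤ}
    (hμ : HasDegree b I μ d) (hd : d ≠ 0) {x : Matrix (Fin n) (Fin n) F}
    (hx : x ∈ weightSpace T μ) (hx0 : x ≠ 0) : ∃ i, R.root i = μ := by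
  refine (eq_zero_or_root hR hx hx0).resolve_left ?_
  rintro rfl
  exact hd (hμ.unique HasDegree.zero)

theorem degreeSpace_le_span_of_pos (hR : IsRootDatumOf T R) (hI : I ⊆ b.support)
    {e : ι → lieAlg G} (he : ∀ i, IsPositive b i →
      Submodule.span F {(e i : Matrix (Fin n) (Fin n) F)} = weightSpace T (R.root i)) {d : ℤ}
    (hd : 0 < d) : degreeSpace b I d ≤ Submodule.span F
      (e '' {i | (IsPositive b i ∧ ¬ InLevi R I i) ∧ HasDegree b I (R.root i) d}) := by
  refine degreeSpace_le fun μ hμ x hx => ?_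
  by_cases hx0 : (x : Matrix (Fin n) (Fin n) F) = 0
  · rw [show x = 0 from Subtype.ext hx0]; exact zero_mem _
  obtain ⟨i, rfl⟩ := exists_root_of_hasDegree_ne_zero hR hμ hd.ne' hx hx0
  have hi := isPositive_of_hasDegree_pos hμ hd
  rw [← he i hi, Submodule.mem_span_singleton] at hx
  obtain ⟨a, ha⟩ := hx
  rw [show x = a • e i from Subtype.ext ha.symm]
  exact Submodule.smul_mem _ _ (Submodule.subset_span
    ⟨i, ⟨⟨hi, not_inLevi_of_hasDegree hI hμ hd.ne'⟩, hμ⟩, rfl⟩)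

theorem degreeSpace_le_span_of_neg (hR : IsRootDatumOf T R) (hI : I ⊆ b.support)
    {f : ι → lieAlg G} (hf : ∀ i, IsPositive b i →
      Submodule.span F {(f i : Matrix (Fin n) (Fin n) F)} = weightSpace T (-R.root i)) {d : ℤ}
    (hd : d < 0) : degreeSpace b I d ≤ Submodule.span F
      (f '' {i | (IsPositive b i ∧ ¬ InLevi R I i) ∧ HasDegree b I (R.root i) (-d)}) := by
  refine degreeSpace_le fun μ hμ x hx => ?_
  by_cases hx0 : (x : Matrix (Fin n) (Fin n) F) = 0
  · rw [show x = 0 from Subtype.ext hx0]; exact zero_mem _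
  obtain ⟨j, rfl⟩ := exists_root_of_hasDegree_ne_zero hR hμ hd.ne hx hx0
  obtain ⟨i, hij⟩ := exists_root_eq_neg (R := R) j
  have hdi : HasDegree b I (R.root i) (-d) := by rw [hij]; exact hμ.neg
  have hi := isPositive_of_hasDegree_pos hdi (by omega)
  rw [show R.root j = -R.root i by rw [hij, neg_neg], ← hf i hi,
    Submodule.mem_span_singleton] at hx
  obtain ⟨a, ha⟩ := hx
  rw [show x = a • f i from Subtype.ext ha.symm]
  exact Submodule.smul_mem _ _ (Submodule.subset_span
    ⟨i, ⟨⟨hi, not_inLevi_of_hasDegree hI hdi (by omega)⟩, hdi⟩, rfl⟩)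

/-! ### Powers of root vectors -/

theorem pow_mem_weightSpace (p : ℕ) [Fact p.Prime] [CharP F p] {μ : CharLattice T}
    {x : Matrix (Fin n) (Fin n) F} (hx : x ∈ weightSpace T μ) : x ^ p ∈ weightSpace T (p • μ) := by
  refine ⟨pow_mem_lieAlg p G hx.1, fun t => ?_⟩
  have hval : ((p • μ).val t : F) = (μ.val t : F) ^ p := by
    have : (p • μ).val t = μ.val t ^ p := rfl
    rw [this, Units.val_pow_eq_pow_val]
  have hconj : ∀ k, ((t : GL (Fin n) F) : Matrix (Fin n) (Fin n) F) * x ^ k *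
      (((t : GL (Fin n) F)⁻¹ : GL (Fin n) F) : Matrix (Fin n) (Fin n) F) =
      (((t : GL (Fin n) F) : Matrix (Fin n) (Fin n) F) * x *
      (((t : GL (Fin n) F)⁻¹ : GL (Fin n) F) : Matrix (Fin n) (Fin n) F)) ^ k := by
    intro k
    exact (Units.conj_pow (t : GL (Fin n) F) x k).symm
  rw [hconj, hx.2 t, smul_pow, hval]

/-- Root vectors have `p`-th power zero, as `p` is good, so that no root is `p` times a root. -/
theorem pow_eq_zero_of_mem_weightSpace_root (hR : IsRootDatumOf T R) {p : ℕ} [Fact p.Prime]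
    [CharP F p] (H2 : IsGoodPrime p b) {i : ι} {x : Matrix (Fin n) (Fin n) F}
    (hx : x ∈ weightSpace T (R.root i)) : x ^ p = 0 := by
  have hp0 : (p : ℤ) ≠ 0 := by exact_mod_cast (Fact.out : p.Prime).ne_zero
  obtain ⟨-, c, hc, -⟩ := exists_hasDegree_root (b := b) (I := ∅) i
  have hne : R.root i ≠ 0 := by
    have : R.root i ∈ Set.range R.root := ⟨i, rfl⟩
    rw [hR.roots] at this
    exact this.1
  have hpc : p • R.root i = ∑ j ∈ b.support, ((p : ℤ) * c j) • R.root j := by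
    rw [hc, Finset.smul_sum]
    exact Finset.sum_congr rfl fun j _ => by rw [mul_smul, natCast_zsmul]
  have hfinish : ¬ ∀ j ∈ b.support, (p : ℤ) * c j = 0 := by
    intro h
    apply hne
    rw [hc]
    exact Finset.sum_eq_zero fun j hj => by
      rw [(mul_eq_zero.mp (h j hj)).resolve_left hp0, zero_smul]
  by_contra hxp
  rcases eq_zero_or_root hR (pow_mem_weightSpace p hx) hxp with h0 | ⟨k, hk⟩
  · exact hfinish fun j hj => coeff_unique (b := b) (c' := fun _ => 0)
      (by rw [← hpc, h0]; simp) j hj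
  · exact hfinish fun j hj => H2 k _ (hk.trans hpc) j hj (dvd_mul_right _ _)

theorem parabolic_le_span_pow_mem (hR : IsRootDatumOf T R) (hI : I ⊆ b.support) {p : ℕ}
    [Fact p.Prime] [CharP F p] (H2 : IsGoodPrime p b) :
    (parabolic hR b I hI).toSubmodule ≤ Submodule.span F
      {x | x ∈ parabolic hR b I hI ∧ x ^ p ∈ parabolic hR b I hI} := by
  intro x hx
  have hx' : x ∈ levi R I ⊔ nilradical b I := hx
  rw [levi_sup_nilradical] at hx'
  refine (iSup₂_le fun μ hμ y hy => Submodule.subset_span ?_ :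
    (⨆ μ ∈ parabolicWeights b I, weightSpace T μ) ≤ _) hx'
  have hmem : ∀ z ∈ weightSpace T μ, z ∈ parabolic hR b I hI := by
    intro z hz
    rw [mem_parabolic, levi_sup_nilradical]
    exact Submodule.mem_iSup_of_mem μ (Submodule.mem_iSup_of_mem hμ hz)
  refine ⟨hmem y hy, ?_⟩
  rcases hμ with rfl | ⟨i, rfl, -⟩
  · have := pow_mem_weightSpace p hy
    rw [smul_zero] at this
    exact hmem _ this
  · rw [pow_eq_zero_of_mem_weightSpace_root hR H2 hy]
    exact zero_mem _

end Grading

/-! ### Modules generated from a parabolic subalgebra -/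

section ParabolicModule

variable {F : Type*} [Field F] {n : ℕ}

theorem list_sum_map_neg {ι R : Type*} [CommRing R] (c : ι → R) (w : List ι) :
    (w.map fun i => -c i).sum = -(w.map c).sum := by
  induction w with
  | nil => simp
  | cons i w ih => rw [List.map_cons, List.sum_cons, ih, List.map_cons, List.sum_cons, neg_add]

/-- The commutator of `x` with a word, modulo words which are not rearrangements of it, for `x` whose
commutator with each letter `y i` is `c i • y i` modulo other letters of the same degree. -/
theorem commutator_word_sub_mem {A ι : Type*} [Ring A] [Algebra F A] {y : ι → A} {β : List ι}
    {δ : ι → ℕ} {x : A} {c : ι → F} (hx : ∀ i ∈ β, x * y i - y i * x - c i • y i ∈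
      Submodule.span F (y '' {k | k ∈ β ∧ δ k = δ i ∧ k ≠ i})) (w : List ι) (hw : w ⊆ β) :
    x * (w.map y).prod - (w.map y).prod * x - (w.map c).sum • (w.map y).prod ∈
      Submodule.span F {a | ∃ w' : List ι, w' ⊆ β ∧ w'.length = w.length ∧
        (w'.map δ).sum = (w.map δ).sum ∧ ¬ w'.Perm w ∧ (w'.map y).prod = a} := by
  classical
  induction w with
  | nil => simp
  | cons i v ih =>
    rw [List.cons_subset] at hw
    simp only [List.map_cons, List.prod_cons, List.sum_cons, List.length_cons]
    set Y := (v.map y).prod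
    have e : x * (y i * Y) - y i * Y * x - (c i + (v.map c).sum) • (y i * Y) =
        (x * y i - y i * x - c i • y i) * Y +
          y i * (x * Y - Y * x - (v.map c).sum • Y) := by
      simp only [sub_mul, mul_sub, add_smul, smul_mul_assoc, mul_smul_comm, mul_assoc]
      abel
    rw [e]
    refine add_mem ?_ ?_
    · have h1 := Submodule.mem_map_of_mem (f := LinearMap.mulRight F Y) (hx i hw.1)
      rw [Submodule.map_span] at h1
      refine Submodule.span_mono ?_ h1
      rintro _ ⟨_, ⟨k, ⟨hk, hδ, hki⟩, rfl⟩, rfl⟩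
      refine ⟨k :: v, List.cons_subset.mpr ⟨hk, hw.2⟩, by simp, by simp [hδ], fun hp => ?_,
        by simp [Y]⟩
      have := hp.count_eq k
      simp [hki.symm] at this
    · have h1 := Submodule.mem_map_of_mem (f := LinearMap.mulLeft F (y i)) (ih hw.2)
      rw [Submodule.map_span] at h1
      refine Submodule.span_mono ?_ h1
      rintro _ ⟨_, ⟨w', hw', hl, hδ, hp, rfl⟩, rfl⟩
      exact ⟨i :: w', List.cons_subset.mpr ⟨hw.1, hw'⟩, by simp [hl], by simp [hδ],
        fun h => hp h.cons_inv, by simp⟩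

/-- The vectors `x` which act on the root vectors `e i` and `f i` with opposite diagonal
coefficients `c i` and `-c i`, modulo the other root vectors of the same degree. -/
def ActsOppositely {𝔤 : LieSubalgebra F (Matrix (Fin n) (Fin n) F)} {ι : Type*} (β : List ι)
    (e f : ι → 𝔤) (δ : ι → ℕ) (x : 𝔤) : Prop :=
  ∃ c : ι → F, ∀ i ∈ β,
    ⁅x, e i⁆ - c i • e i ∈ Submodule.span F (e '' {k | k ∈ β ∧ δ k = δ i ∧ k ≠ i}) ∧
    ⁅x, f i⁆ - (-c i) • f i ∈ Submodule.span F (f '' {k | k ∈ β ∧ δ k = δ i ∧ k ≠ i})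

/-- The properties of the grading `𝔤 = ⨁ 𝔤_d` attached to a parabolic subalgebra
`𝔭 = ⨁_{d ≥ 0} 𝔤_d` which enter the study of the induced modules. The subspaces of positive and of
negative degrees are spanned by the vectors `e i` and `f i`, of degrees `δ i` and `-δ i`, with `i` in
the list `β`. -/
structure ParabolicGrading (p : ℕ) {𝔭 𝔤 : LieSubalgebra F (Matrix (Fin n) (Fin n) F)} (h : 𝔭 ≤ 𝔤)
    (χ : Module.Dual F 𝔤) {ι : Type*} (β : List ι) (e f : ι → 𝔤) (δ : ι → ℕ)
    (g : ℤ → Submodule F 𝔤) : Prop where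
  nodup : β.Nodup
  degree_pos : ∀ i ∈ β, 0 < δ i
  lie_mem : ∀ {d d' : ℤ} {x y : 𝔤}, x ∈ g d → y ∈ g d' → ⁅x, y⁆ ∈ g (d + d')
  iSup_eq_top : ⨆ d, g d = ⊤
  mem_of_nonneg : ∀ {d : ℤ}, 0 ≤ d → ∀ x ∈ g d, (x : Matrix (Fin n) (Fin n) F) ∈ 𝔭
  le_span_of_pos : ∀ {d : ℤ}, 0 < d → g d ≤ Submodule.span F (e '' {i | i ∈ β ∧ (δ i : ℤ) = d})
  le_span_of_neg : ∀ {d : ℤ}, d < 0 → g d ≤ Submodule.span F (f '' {i | i ∈ β ∧ (δ i : ℤ) = -d})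
  e_mem : ∀ i ∈ β, e i ∈ g (δ i)
  f_mem : ∀ i ∈ β, f i ∈ g (-δ i)
  e_pow : ∀ i ∈ β, toEnv p 𝔤 χ (e i) ^ p = 0
  f_pow : ∀ i ∈ β, ∃ c : F, toEnv p 𝔤 χ (f i) ^ p = algebraMap F _ c
  mem_span : ∀ x : 𝔭, x ∈ Submodule.span F {x : 𝔭 |
    (∃ d : ℤ, 0 < d ∧ LieSubalgebra.inclusion h x ∈ g d) ∨
      LieSubalgebra.inclusion h x ∈ g 0 ∧ ActsOppositely β e f δ (LieSubalgebra.inclusion h x)}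

namespace ParabolicGrading

variable {p : ℕ} {𝔭 𝔤 : LieSubalgebra F (Matrix (Fin n) (Fin n) F)} {h : 𝔭 ≤ 𝔤}
  {χ : Module.Dual F 𝔤} {ι : Type*} {β : List ι} {e f : ι → 𝔤} {δ : ι → ℕ}
  {g : ℤ → Submodule F 𝔤}

section Algebra

theorem commutators_e (H : ParabolicGrading p h χ β e f δ g) :
    CommutatorsInSpan F (fun i => toEnv p 𝔤 χ (e i)) β δ := by
  intro i hi j hj
  rw [toEnv_mul_sub_mul]
  apply toEnv_mem_span
  have h1 := H.degree_pos i hi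
  refine Submodule.span_mono (Set.image_mono ?_)
    (H.le_span_of_pos (by omega) (H.lie_mem (H.e_mem i hi) (H.e_mem j hj)))
  rintro k ⟨hk, hδ⟩
  exact ⟨hk, by exact_mod_cast hδ⟩

theorem commutators_f (H : ParabolicGrading p h χ β e f δ g) :
    CommutatorsInSpan F (fun i => toEnv p 𝔤 χ (f i)) β fun _ => () := by
  intro i hi j hj
  rw [toEnv_mul_sub_mul]
  apply toEnv_mem_span
  have h1 := H.degree_pos i hi
  refine Submodule.span_mono (Set.image_mono ?_)
    (H.le_span_of_neg (by omega) (H.lie_mem (H.f_mem i hi) (H.f_mem j hj)))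
  rintro k ⟨hk, -⟩
  exact ⟨hk, rfl⟩

theorem f_pow_mem (H : ParabolicGrading p h χ β e f δ g) (i : ι) (hi : i ∈ β) :
    toEnv p 𝔤 χ (f i) ^ p ∈
      wordSpan F (fun i => toEnv p 𝔤 χ (f i)) β (fun _ => ()) (p - 1) (p • ()) := by
  obtain ⟨c, hc⟩ := H.f_pow i hi
  rw [hc, Algebra.algebraMap_eq_smul_one]
  exact Submodule.smul_mem _ _ (one_mem_wordSpan _ _ _ _)

/-- An element acting oppositely on the `e i` and the `f i` normalizes the line through the top
monomial in the `e i`. -/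
theorem commutator_top_e [hp : Fact p.Prime] (H : ParabolicGrading p h χ β e f δ g) {x : 𝔤}
    {c : ι → F} (hx : ∀ i ∈ β, ⁅x, e i⁆ - c i • e i ∈
      Submodule.span F (e '' {k | k ∈ β ∧ δ k = δ i ∧ k ≠ i})) :
    toEnv p 𝔤 χ x * orderedMonomial (fun i => toEnv p 𝔤 χ (e i)) β (fun _ => p - 1) =
      orderedMonomial (fun i => toEnv p 𝔤 χ (e i)) β (fun _ => p - 1) * toEnv p 𝔤 χ x +
      ((orderedWord β fun _ => p - 1).map c).sum •
        orderedMonomial (fun i => toEnv p 𝔤 χ (e i)) β (fun _ => p - 1) := by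
  classical
  have h1 := commutator_word_sub_mem (y := fun i => toEnv p 𝔤 χ (e i)) (x := toEnv p 𝔤 χ x) (c := c)
    (β := β) (δ := δ) (fun i hi => by
      rw [toEnv_mul_sub_mul, ← map_smul, ← map_sub]
      exact toEnv_mem_span (hx i hi)) (orderedWord β fun _ => p - 1) (orderedWord_subset _ _)
  have hzero : Submodule.span F {a | ∃ w' : List ι, w' ⊆ β ∧
      w'.length = (orderedWord β fun _ => p - 1).length ∧
      (w'.map δ).sum = ((orderedWord β fun _ => p - 1).map δ).sum ∧
      ¬ w'.Perm (orderedWord β fun _ => p - 1) ∧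
      (w'.map fun i => toEnv p 𝔤 χ (e i)).prod = a} ≤ ⊥ := by
    rw [Submodule.span_le]
    rintro _ ⟨w', hw', hl, hδ, hperm, rfl⟩
    refine map_word_eq_zero H.nodup H.commutators_e hp.out.one_lt
      (fun i hi => by rw [H.e_pow i hi]; exact zero_mem _) (LinearMap.id (R := F))
      (fun m hm hsum hne => ?_) hw' (by rw [hl, length_orderedWord]) ?_ hδ
    -- a monomial of the same degree as the top one, with exponents below `p`, is the top one
    · exfalso
      have := sum_mul_lt_of_ne_top H.degree_pos hm hne
      rw [sum_map_orderedWord] at hsum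
      simp only [smul_eq_mul] at hsum
      omega
    · by_contra! hcon
      exact hperm (perm_orderedWord H.nodup hw' hcon)
  have h2 := hzero h1
  rw [Submodule.mem_bot, prod_map_orderedWord, sub_eq_zero, sub_eq_iff_eq_add'] at h2
  exact h2

end Algebra

section Module

variable {L Z : Type*} [AddCommGroup L] [Module F L]
  [Module (ReducedEnv p 𝔭 (restrictForm h χ)) L]
  [AddCommGroup Z] [Module F Z]
  [Module (ReducedEnv p 𝔤 χ) Z]

variable (p χ β f δ) in
/-- The span of the vectors `f_{i₁} ⋯ f_{i_r} j(l)` of degree `d`. -/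
def levelSpan (j : L →ₗ[F] Z) (d : ℤ) : Submodule F Z :=
  Submodule.span F {z | ∃ (w : List ι) (l : L), w ⊆ β ∧ -((w.map δ).sum : ℤ) = d ∧
    (w.map fun i => toEnv p 𝔤 χ (f i)).prod • j l = z}

variable {j : L →ₗ[F] Z}

theorem word_smul_mem_levelSpan {w : List ι} (hw : w ⊆ β) (l : L) {d : ℤ}
    (hd : -((w.map δ).sum : ℤ) = d) :
    (w.map fun i => toEnv p 𝔤 χ (f i)).prod • j l ∈ levelSpan p χ β f δ j d :=
  Submodule.subset_span ⟨w, l, hw, hd, rfl⟩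

theorem map_mem_levelSpan (l : L) : j l ∈ levelSpan p χ β f δ j 0 := by
  have := word_smul_mem_levelSpan (p := p) (χ := χ) (β := β) (f := f) (δ := δ) (j := j) (w := [])
    (by simp) l (d := 0) (by simp)
  simpa using this

theorem levelSpan_eq_bot {d : ℤ} (hd : 0 < d) : levelSpan p χ β f δ j d = ⊥ := by
  rw [eq_bot_iff, levelSpan, Submodule.span_le]
  rintro _ ⟨w, l, -, hw, rfl⟩
  omega

theorem levelSpan_zero_le (hδ : ∀ i ∈ β, 0 < δ i) :
    levelSpan p χ β f δ j 0 ≤ LinearMap.range j := by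
  rw [levelSpan, Submodule.span_le]
  rintro _ ⟨w, l, hw, h0, rfl⟩
  have : w = [] := by
    cases w with
    | nil => rfl
    | cons i w =>
      have := hδ i (List.cons_subset.mp hw).1
      rw [List.map_cons, List.sum_cons, Nat.cast_add] at h0
      omega
  subst this
  simp

variable [IsScalarTower F (ReducedEnv p 𝔤 χ) Z]

theorem smul_mem_levelSpan_of_generators (x : ReducedEnv p 𝔤 χ) {d d' : ℤ}
    (hx : ∀ (w : List ι) (l : L), w ⊆ β → -((w.map δ).sum : ℤ) = d →
      x • (w.map fun i => toEnv p 𝔤 χ (f i)).prod • j l ∈ levelSpan p χ β f δ j d') {z : Z}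
    (hz : z ∈ levelSpan p χ β f δ j d) : x • z ∈ levelSpan p χ β f δ j d' := by
  unfold levelSpan at hz
  induction hz using Submodule.span_induction with
  | mem z hz =>
    obtain ⟨w, l, hw, hd, rfl⟩ := hz
    exact hx w l hw hd
  | zero => rw [smul_zero]; exact zero_mem _
  | add z z' _ _ h h' => rw [smul_add]; exact add_mem h h'
  | smul c z _ h => rw [smul_algebra_smul_comm]; exact Submodule.smul_mem _ _ h

theorem f_smul_mem_levelSpan {i : ι} (hi : i ∈ β) {d : ℤ} {z : Z}
    (hz : z ∈ levelSpan p χ β f δ j d) :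
    toEnv p 𝔤 χ (f i) • z ∈ levelSpan p χ β f δ j (d - δ i) := by
  refine smul_mem_levelSpan_of_generators _ (fun w l hw hd => ?_) hz
  have := word_smul_mem_levelSpan (p := p) (χ := χ) (f := f) (δ := δ) (j := j) (w := i :: w)
    (List.cons_subset.mpr ⟨hi, hw⟩) l (d := d - δ i) (by
      rw [List.map_cons, List.sum_cons, Nat.cast_add]; omega)
  rwa [List.map_cons, List.prod_cons, mul_smul] at this

/-- An element of degree `d` shifts the degree by `d`: move it to the right through the letters of the
word, until it reaches `j(L)`, where `𝔭` acts through `L` and the positive degrees act by zero. -/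
theorem smul_word_mem_levelSpan (H : ParabolicGrading p h χ β e f δ g)
    (hj : ∀ b l, j (b • l) = envMap p h χ b • j l)
    (hu : ∀ (x : 𝔭) (d : ℤ), 0 < d → LieSubalgebra.inclusion h x ∈ g d →
      ∀ l : L, toEnv p 𝔭 (restrictForm h χ) x • l = 0) (w : List ι) (hw : w ⊆ β) (l : L) {d : ℤ}
    {x : 𝔤} (hx : x ∈ g d) :
    toEnv p 𝔤 χ x • (w.map fun i => toEnv p 𝔤 χ (f i)).prod • j l ∈
      levelSpan p χ β f δ j (d - (w.map δ).sum) := by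
  induction w generalizing d x with
  | nil =>
    simp only [List.map_nil, List.prod_nil, one_smul, List.sum_nil, Nat.cast_zero, sub_zero]
    rcases lt_or_ge d 0 with hd | hd
    · have hx' := H.le_span_of_neg hd hx
      clear hx
      induction hx' using Submodule.span_induction with
      | mem x hx =>
        obtain ⟨i, ⟨hi, hid⟩, rfl⟩ := hx
        have := f_smul_mem_levelSpan hi
          (map_mem_levelSpan (p := p) (χ := χ) (β := β) (f := f) (δ := δ) (j := j) l)
        rwa [hid, zero_sub, neg_neg] at this
      | zero => rw [map_zero, zero_smul]; exact zero_mem _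
      | add x y _ _ h h' => rw [map_add, add_smul]; exact add_mem h h'
      | smul c x _ h => rw [map_smul, smul_assoc]; exact Submodule.smul_mem _ _ h
    · have hx𝔭 := H.mem_of_nonneg hd x hx
      have e1 : toEnv p 𝔤 χ x • j l =
          j (toEnv p 𝔭 (restrictForm h χ) ⟨(x : Matrix (Fin n) (Fin n) F), hx𝔭⟩ • l) := by
        rw [hj, envMap_toEnv]; rfl
      rw [e1]
      rcases hd.eq_or_lt with rfl | hd
      · exact map_mem_levelSpan _
      · rw [hu _ d hd hx, map_zero]; exact zero_mem _
  | cons i v ih =>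
    rw [List.cons_subset] at hw
    have e1 : toEnv p 𝔤 χ x * toEnv p 𝔤 χ (f i) =
        toEnv p 𝔤 χ (f i) * toEnv p 𝔤 χ x + toEnv p 𝔤 χ ⁅x, f i⁆ := by
      rw [← toEnv_mul_sub_mul]; abel
    simp only [List.map_cons, List.prod_cons, List.sum_cons, Nat.cast_add]
    rw [← mul_smul, ← mul_assoc, e1, add_mul, add_smul, mul_assoc, mul_smul, mul_smul, mul_smul]
    refine add_mem ?_ ?_
    · have := f_smul_mem_levelSpan hw.1 (ih hw.2 hx)
      convert this using 2
      ring
    · have := ih hw.2 (H.lie_mem hx (H.f_mem i hw.1))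
      convert this using 2
      ring

theorem smul_mem_levelSpan (H : ParabolicGrading p h χ β e f δ g)
    (hj : ∀ b l, j (b • l) = envMap p h χ b • j l)
    (hu : ∀ (x : 𝔭) (d : ℤ), 0 < d → LieSubalgebra.inclusion h x ∈ g d →
      ∀ l : L, toEnv p 𝔭 (restrictForm h χ) x • l = 0) {d d' : ℤ}
    {x : 𝔤} (hx : x ∈ g d) {z : Z} (hz : z ∈ levelSpan p χ β f δ j d') :
    toEnv p 𝔤 χ x • z ∈ levelSpan p χ β f δ j (d + d') := by
  refine smul_mem_levelSpan_of_generators _ (fun w l hw hd => ?_) hz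
  have := H.smul_word_mem_levelSpan hj hu w hw l hx
  rwa [sub_eq_add_neg, hd] at this

theorem e_word_smul_mem_levelSpan (H : ParabolicGrading p h χ β e f δ g)
    (hj : ∀ b l, j (b • l) = envMap p h χ b • j l)
    (hu : ∀ (x : 𝔭) (d : ℤ), 0 < d → LieSubalgebra.inclusion h x ∈ g d →
      ∀ l : L, toEnv p 𝔭 (restrictForm h χ) x • l = 0) (w : List ι) (hw : w ⊆ β) {d : ℤ} {z : Z}
    (hz : z ∈ levelSpan p χ β f δ j d) :
    (w.map fun i => toEnv p 𝔤 χ (e i)).prod • z ∈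
      levelSpan p χ β f δ j ((w.map δ).sum + d) := by
  induction w with
  | nil => simpa using hz
  | cons i v ih =>
    rw [List.cons_subset] at hw
    simp only [List.map_cons, List.prod_cons, List.sum_cons, Nat.cast_add, mul_smul]
    have := H.smul_mem_levelSpan hj hu (H.e_mem i hw.1) (ih hw.2)
    convert this using 2
    ring

/-- The product of the top monomial in the `e i` with an ordered monomial in the `f i`, other than
the top one, kills `j(L)`: its degree is positive. -/
theorem top_mul_orderedMonomial_smul_eq_zero (H : ParabolicGrading p h χ β e f δ g)
    (hj : ∀ b l, j (b • l) = envMap p h χ b • j l)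
    (hu : ∀ (x : 𝔭) (d : ℤ), 0 < d → LieSubalgebra.inclusion h x ∈ g d →
      ∀ l : L, toEnv p 𝔭 (restrictForm h χ) x • l = 0) {m : ι → ℕ} (hm : ∀ i ∈ β, m i < p)
    (hne : ∃ i ∈ β, m i ≠ p - 1) (l : L) :
    orderedMonomial (fun i => toEnv p 𝔤 χ (e i)) β (fun _ => p - 1) •
      orderedMonomial (fun i => toEnv p 𝔤 χ (f i)) β m • j l = 0 := by
  have hlt := sum_mul_lt_of_ne_top H.degree_pos hm hne
  have h1 := H.e_word_smul_mem_levelSpan hj hu _ (orderedWord_subset β fun _ => p - 1)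
    (word_smul_mem_levelSpan (p := p) (χ := χ) (f := f) (δ := δ) (j := j)
      (orderedWord_subset β m) l rfl)
  rw [prod_map_orderedWord, prod_map_orderedWord, sum_map_orderedWord, sum_map_orderedWord] at h1
  simp only [smul_eq_mul] at h1
  rw [levelSpan_eq_bot (by omega)] at h1
  exact h1

theorem top_mul_top_smul_mem_range (H : ParabolicGrading p h χ β e f δ g)
    (hj : ∀ b l, j (b • l) = envMap p h χ b • j l)
    (hu : ∀ (x : 𝔭) (d : ℤ), 0 < d → LieSubalgebra.inclusion h x ∈ g d →
      ∀ l : L, toEnv p 𝔭 (restrictForm h χ) x • l = 0) (l : L) :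
    orderedMonomial (fun i => toEnv p 𝔤 χ (e i)) β (fun _ => p - 1) •
      orderedMonomial (fun i => toEnv p 𝔤 χ (f i)) β (fun _ => p - 1) • j l ∈
      LinearMap.range j := by
  have h1 := H.e_word_smul_mem_levelSpan hj hu _ (orderedWord_subset β fun _ => p - 1)
    (word_smul_mem_levelSpan (p := p) (χ := χ) (f := f) (δ := δ) (j := j)
      (orderedWord_subset β fun _ => p - 1) l rfl)
  rw [prod_map_orderedWord, prod_map_orderedWord, add_neg_cancel] at h1
  exact levelSpan_zero_le H.degree_pos h1

variable (p χ β e) in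
/-- The linear map `a ↦ E a z`, where `E` is the top monomial in the `e i`. -/
noncomputable def topMul (z : Z) : ReducedEnv p 𝔤 χ →ₗ[F] Z where
  toFun a := orderedMonomial (fun i => toEnv p 𝔤 χ (e i)) β (fun _ => p - 1) • a • z
  map_add' a b := by rw [add_smul, smul_add]
  map_smul' c a := by rw [smul_assoc, smul_algebra_smul_comm]; rfl

/-- After multiplication by `E`, the order of the letters of the top monomial in the `f i` does not
matter. -/
theorem topMul_word_eq_top [hp : Fact p.Prime] (H : ParabolicGrading p h χ β e f δ g)
    (hj : ∀ b l, j (b • l) = envMap p h χ b • j l)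
    (hu : ∀ (x : 𝔭) (d : ℤ), 0 < d → LieSubalgebra.inclusion h x ∈ g d →
      ∀ l : L, toEnv p 𝔭 (restrictForm h χ) x • l = 0) {w : List ι}
    (hw : w.Perm (orderedWord β fun _ => p - 1)) (l : L) :
    topMul p χ β e (j l) (w.map fun i => toEnv p 𝔤 χ (f i)).prod =
      topMul p χ β e (j l)
        (orderedMonomial (fun i => toEnv p 𝔤 χ (f i)) β fun _ => p - 1) :=
  map_word_eq_map_top (wt := fun _ => ()) H.nodup H.commutators_f hp.out.one_lt H.f_pow_mem _
    (fun _ hm _ hne => H.top_mul_orderedMonomial_smul_eq_zero hj hu hm hne l) hw rfl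

theorem topMul_word_eq_zero [hp : Fact p.Prime] (H : ParabolicGrading p h χ β e f δ g)
    (hj : ∀ b l, j (b • l) = envMap p h χ b • j l)
    (hu : ∀ (x : 𝔭) (d : ℤ), 0 < d → LieSubalgebra.inclusion h x ∈ g d →
      ∀ l : L, toEnv p 𝔭 (restrictForm h χ) x • l = 0) {w : List ι} (hsub : w ⊆ β)
    (hlen : w.length ≤ (β.map fun _ => p - 1).sum)
    (hw : ¬ w.Perm (orderedWord β fun _ => p - 1)) (l : L) :
    topMul p χ β e (j l) (w.map fun i => toEnv p 𝔤 χ (f i)).prod = 0 := by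
  classical
  refine map_word_eq_zero (wt := fun _ => ()) (γ := ()) H.nodup H.commutators_f hp.out.one_lt
    H.f_pow_mem _ (fun _ hm _ hne => H.top_mul_orderedMonomial_smul_eq_zero hj hu hm hne l) hsub
    hlen ?_ rfl
  by_contra! hcon
  exact hw (perm_orderedWord H.nodup hsub hcon)

/-- The operator `E E'` on `j(L)`, for the top monomials `E` in the `e i` and `E'` in the `f i`,
commutes with the elements which act oppositely on the `e i` and the `f i`: the commutators of such an
element with `E` and with `E'` contribute opposite multiples of `E E'`. -/
theorem top_mul_top_smul_of_actsOppositely [hp : Fact p.Prime]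
    (H : ParabolicGrading p h χ β e f δ g)
    (hj : ∀ b l, j (b • l) = envMap p h χ b • j l)
    (hu : ∀ (x : 𝔭) (d : ℤ), 0 < d → LieSubalgebra.inclusion h x ∈ g d →
      ∀ l : L, toEnv p 𝔭 (restrictForm h χ) x • l = 0) {x : 𝔤} (hx : ActsOppositely β e f δ x)
    (l : L) :
    orderedMonomial (fun i => toEnv p 𝔤 χ (e i)) β (fun _ => p - 1) •
      orderedMonomial (fun i => toEnv p 𝔤 χ (f i)) β (fun _ => p - 1) • toEnv p 𝔤 χ x • j l =
    toEnv p 𝔤 χ x • orderedMonomial (fun i => toEnv p 𝔤 χ (e i)) β (fun _ => p - 1) •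
      orderedMonomial (fun i => toEnv p 𝔤 χ (f i)) β (fun _ => p - 1) • j l := by
  obtain ⟨c, hc⟩ := hx
  have h1 := commutator_word_sub_mem (y := fun i => toEnv p 𝔤 χ (f i)) (x := toEnv p 𝔤 χ x)
    (c := fun i => -c i) (β := β) (δ := δ) (fun i hi => by
      rw [toEnv_mul_sub_mul, ← map_smul, ← map_sub]
      exact toEnv_mem_span (hc i hi).2) (orderedWord β fun _ => p - 1) (orderedWord_subset _ _)
  have h2 : topMul p χ β e (j l) (toEnv p 𝔤 χ x *
      ((orderedWord β fun _ => p - 1).map fun i => toEnv p 𝔤 χ (f i)).prod -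
      ((orderedWord β fun _ => p - 1).map fun i => toEnv p 𝔤 χ (f i)).prod * toEnv p 𝔤 χ x -
      ((orderedWord β fun _ => p - 1).map fun i => -c i).sum •
        ((orderedWord β fun _ => p - 1).map fun i => toEnv p 𝔤 χ (f i)).prod) = 0 := by
    refine (Submodule.span_le (p := LinearMap.ker (topMul p χ β e (j l)))).mpr ?_ h1
    rintro _ ⟨w', hw', hl, -, hperm, rfl⟩
    exact H.topMul_word_eq_zero hj hu hw' (by rw [hl, length_orderedWord]) hperm l
  rw [prod_map_orderedWord] at h2
  set E := orderedMonomial (fun i => toEnv p 𝔤 χ (e i)) β (fun _ => p - 1)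
  set E' := orderedMonomial (fun i => toEnv p 𝔤 χ (f i)) β (fun _ => p - 1)
  set X := toEnv p 𝔤 χ x
  set s := ((orderedWord β fun _ => p - 1).map c).sum
  have hs : ((orderedWord β fun _ => p - 1).map fun i => -c i).sum = -s := by
    exact list_sum_map_neg _ _
  have h3 : E • (X * E' - E' * X - (-s) • E') • j l = 0 := by rw [← hs]; exact h2
  have h4 : X * E = E * X + s • E := H.commutator_top_e fun i hi => (hc i hi).1
  have h5 : X • E • E' • j l = E • X • E' • j l + s • E • E' • j l := by
    rw [← mul_smul X, h4, add_smul, mul_smul, smul_assoc]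
  rw [sub_smul, sub_smul, neg_smul, neg_smul, sub_neg_eq_add, mul_smul, mul_smul, smul_add,
    smul_sub, smul_assoc, smul_algebra_smul_comm, sub_add_eq_add_sub, sub_eq_zero] at h3
  rw [h5, h3]

end Module

end ParabolicGrading

end ParabolicModule

/-! ### Simplicity of modules generated from a parabolic subalgebra -/

section Stable

variable {F : Type*} [Field F] {n p : ℕ} {𝔩 : LieSubalgebra F (Matrix (Fin n) (Fin n) F)}
  {χ : Module.Dual F 𝔩} {M : Type*} [AddCommGroup M] [Module F M] [Module (ReducedEnv p 𝔩 χ) M]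
  [IsScalarTower F (ReducedEnv p 𝔩 χ) M]

theorem smul_mem_of_toEnv_smul_mem (N : Submodule F M)
    (hN : ∀ x, ∀ m ∈ N, toEnv p 𝔩 χ x • m ∈ N) (a : ReducedEnv p 𝔩 χ) {m : M} (hm : m ∈ N) :
    a • m ∈ N := by
  have ha : a ∈ Algebra.adjoin F (Set.range (toEnv p 𝔩 χ)) := by
    rw [adjoin_range_toEnv]; exact Algebra.mem_top
  induction ha using Algebra.adjoin_induction generalizing m with
  | mem a ha => obtain ⟨x, rfl⟩ := ha; exact hN x m hm
  | algebraMap c => rw [algebraMap_smul]; exact Submodule.smul_mem _ _ hm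
  | add a b _ _ h h' => rw [add_smul]; exact add_mem (h hm) (h' hm)
  | mul a b _ _ h h' => rw [mul_smul]; exact h (h' hm)

theorem eq_top_of_toEnv_smul_mem (hM : IsSimpleModule (ReducedEnv p 𝔩 χ) M) (N : Submodule F M)
    (hN : ∀ x, ∀ m ∈ N, toEnv p 𝔩 χ x • m ∈ N) {m : M} (hm : m ∈ N) (h0 : m ≠ 0) : N = ⊤ := by
  let N' : Submodule (ReducedEnv p 𝔩 χ) M :=
    { N with smul_mem' := fun a _ h => smul_mem_of_toEnv_smul_mem N hN a h }
  have h1 : N' = ⊤ := by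
    refine (eq_bot_or_eq_top N').resolve_left fun h => h0 ?_
    rw [← Submodule.mem_bot (ReducedEnv p 𝔩 χ), ← h]
    exact hm
  rw [eq_top_iff]
  intro x _
  exact (h1 ▸ Submodule.mem_top : x ∈ N')

end Stable

namespace ParabolicGrading

variable {F : Type*} [Field F] {n : ℕ}
  {p : ℕ} {𝔭 𝔤 : LieSubalgebra F (Matrix (Fin n) (Fin n) F)} {h : 𝔭 ≤ 𝔤}
  {χ : Module.Dual F 𝔤} {ι : Type*} {β : List ι} {e f : ι → 𝔤} {δ : ι → ℕ}
  {g : ℤ → Submodule F 𝔤} {L Z : Type*} [AddCommGroup L] [Module F L]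
  [Module (ReducedEnv p 𝔭 (restrictForm h χ)) L] [AddCommGroup Z] [Module F Z]
  [Module (ReducedEnv p 𝔤 χ) Z] [IsScalarTower F (ReducedEnv p 𝔤 χ) Z] {j : L →ₗ[F] Z}

/-- The elements of positive degree act by zero on a simple module with a nonzero vector killed by
the root vectors `e i`: the vectors which they kill form a submodule, as they form an ideal of
`𝔭`. -/
theorem toEnv_smul_eq_zero [IsScalarTower F (ReducedEnv p 𝔭 (restrictForm h χ)) L]
    (hL : IsSimpleModule (ReducedEnv p 𝔭 (restrictForm h χ)) L)
    (H : ParabolicGrading p h χ β e f δ g) {v : L} (hv : v ≠ 0)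
    (hev : ∀ i ∈ β, ∀ x : 𝔭, (e i : Matrix (Fin n) (Fin n) F) = x →
      toEnv p 𝔭 (restrictForm h χ) x • v = 0)
    (x : 𝔭) (d : ℤ) (hd : 0 < d) (hx : LieSubalgebra.inclusion h x ∈ g d) (l : L) :
    toEnv p 𝔭 (restrictForm h χ) x • l = 0 := by
  let N : Submodule F L :=
    { carrier := {l | ∀ (x : 𝔭) (d : ℤ), 0 < d → LieSubalgebra.inclusion h x ∈ g d →
        toEnv p 𝔭 (restrictForm h χ) x • l = 0}
      add_mem' := fun ha hb x d hd hx => by rw [smul_add, ha x d hd hx, hb x d hd hx, add_zero]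
      zero_mem' := fun x d hd hx => smul_zero _
      smul_mem' := fun c l hl x d hd hx => by
        rw [smul_algebra_smul_comm, hl x d hd hx, smul_zero] }
  have hN : N = ⊤ := by
    refine eq_top_of_toEnv_smul_mem hL N (fun y l hl => ?_) (m := v) (fun x d hd hx => ?_) hv
    · have comm : ∀ (x y : 𝔭) (d d' : ℤ), 0 < d → 0 ≤ d' → LieSubalgebra.inclusion h x ∈ g d →
          LieSubalgebra.inclusion h y ∈ g d' →
          toEnv p 𝔭 (restrictForm h χ) x • toEnv p 𝔭 (restrictForm h χ) y • l = 0 := by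
        intro x y d d' hd hd' hx hy
        have hxy := hl ⁅x, y⁆ (d + d') (by omega) (H.lie_mem hx hy)
        rwa [← toEnv_mul_sub_mul, sub_smul, mul_smul, mul_smul, hl x d hd hx, smul_zero,
          sub_zero] at hxy
      induction H.mem_span y using Submodule.span_induction with
      | mem y hy =>
        intro x d hd hx
        rcases hy with ⟨d', hd', hy⟩ | ⟨hy, -⟩
        · exact comm x y d d' hd hd'.le hx hy
        · exact comm x y d 0 hd le_rfl hx hy
      | zero => rw [map_zero, zero_smul]; exact zero_mem _
      | add y z _ _ hy hz => rw [map_add, add_smul]; exact add_mem hy hz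
      | smul c y _ hy => rw [map_smul, smul_assoc]; exact Submodule.smul_mem _ _ hy
    · have key : ∀ y ∈ Submodule.span F (e '' {i | i ∈ β ∧ (δ i : ℤ) = d}),
          ∃ hy : (y : Matrix (Fin n) (Fin n) F) ∈ 𝔭,
            toEnv p 𝔭 (restrictForm h χ) ⟨y, hy⟩ • v = 0 := by
        intro y hy
        induction hy using Submodule.span_induction with
        | mem y hy =>
          obtain ⟨i, ⟨hi, -⟩, rfl⟩ := hy
          exact ⟨H.mem_of_nonneg (by positivity) _ (H.e_mem i hi), hev i hi _ rfl⟩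
        | zero =>
          refine ⟨𝔭.zero_mem, ?_⟩
          change toEnv p 𝔭 (restrictForm h χ) 0 • v = 0
          rw [map_zero, zero_smul]
        | add y z _ _ hy hz =>
          obtain ⟨hy, hy'⟩ := hy
          obtain ⟨hz, hz'⟩ := hz
          refine ⟨𝔭.add_mem hy hz, ?_⟩
          change toEnv p 𝔭 (restrictForm h χ) (⟨y, hy⟩ + ⟨z, hz⟩) • v = 0
          rw [map_add, add_smul, hy', hz', add_zero]
        | smul c y _ hy =>
          obtain ⟨hy, hy'⟩ := hy
          refine ⟨𝔭.smul_mem c hy, ?_⟩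
          change toEnv p 𝔭 (restrictForm h χ) (c • ⟨y, hy⟩) • v = 0
          rw [map_smul, smul_assoc, hy', smul_zero]
      exact (key _ (H.le_span_of_pos hd hx)).2
  exact (hN ▸ Submodule.mem_top : l ∈ N) x d hd hx

/-- If `L` is simple, then the product `E E'` of the top monomials acts on `j(L)` by a scalar: by
Schur's lemma, as this operator is an endomorphism of the module `L`. -/
theorem exists_top_mul_top_smul_eq [hp : Fact p.Prime] [IsAlgClosed F] [FiniteDimensional F L]
    [IsScalarTower F (ReducedEnv p 𝔭 (restrictForm h χ)) L]
    (hL : IsSimpleModule (ReducedEnv p 𝔭 (restrictForm h χ)) L)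
    (H : ParabolicGrading p h χ β e f δ g)
    (hj : ∀ b l, j (b • l) = envMap p h χ b • j l) (hinj : Function.Injective j)
    (hu : ∀ (x : 𝔭) (d : ℤ), 0 < d → LieSubalgebra.inclusion h x ∈ g d →
      ∀ l : L, toEnv p 𝔭 (restrictForm h χ) x • l = 0) :
    ∃ r : F, ∀ l, orderedMonomial (fun i => toEnv p 𝔤 χ (e i)) β (fun _ => p - 1) •
      orderedMonomial (fun i => toEnv p 𝔤 χ (f i)) β (fun _ => p - 1) • j l = r • j l := by
  set E := orderedMonomial (fun i => toEnv p 𝔤 χ (e i)) β (fun _ => p - 1) with hE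
  set E' := orderedMonomial (fun i => toEnv p 𝔤 χ (f i)) β (fun _ => p - 1) with hE'
  choose t ht using fun l => LinearMap.mem_range.mp (H.top_mul_top_smul_mem_range hj hu l)
  rw [← hE, ← hE'] at ht
  let θ : Module.End F L :=
    { toFun := t
      map_add' := fun a b => hinj (by rw [ht, map_add, map_add, ht, ht, smul_add, smul_add])
      map_smul' := fun c a => hinj (by
        rw [ht, map_smul, map_smul, ht, RingHom.id_apply, smul_algebra_smul_comm,
          smul_algebra_smul_comm]) }
  have hθ : ∀ l, j (θ l) = E • E' • j l := ht
  have hcomm : ∀ (x : 𝔭) (l : L), θ (toEnv p 𝔭 (restrictForm h χ) x • l) =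
      toEnv p 𝔭 (restrictForm h χ) x • θ l := by
    intro x
    induction H.mem_span x using Submodule.span_induction with
    | mem x hx =>
      intro l
      rcases hx with ⟨d, hd, hx⟩ | ⟨-, hx⟩
      · rw [hu x d hd hx, hu x d hd hx, map_zero]
      · apply hinj
        rw [hθ, hj, hj, hθ, envMap_toEnv]
        exact H.top_mul_top_smul_of_actsOppositely hj hu hx l
    | zero => intro l; simp only [map_zero, zero_smul]
    | add x y _ _ hx hy => intro l; simp only [map_add, add_smul, hx, hy]
    | smul c x _ hx => intro l; simp only [map_smul, smul_assoc, hx]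
  have := hL.nontrivial
  obtain ⟨r, hr⟩ := Module.End.exists_eigenvalue θ
  obtain ⟨l₀, hl₀⟩ := hr.exists_hasEigenvector
  have htop := eq_top_of_toEnv_smul_mem hL (Module.End.eigenspace θ r) (fun x m hm => by
    rw [Module.End.mem_eigenspace_iff] at hm ⊢
    rw [hcomm, hm, smul_algebra_smul_comm]) hl₀.1 hl₀.2
  refine ⟨r, fun l => ?_⟩
  have hl : l ∈ Module.End.eigenspace θ r := htop ▸ Submodule.mem_top
  rw [← hθ, Module.End.mem_eigenspace_iff.mp hl, map_smul]

/-- A module generated by `j(L)` is spanned by the ordered monomials in the `f i` applied to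
`j(L)`. -/
theorem span_orderedMonomial_smul_eq_top [hp : Fact p.Prime]
    (H : ParabolicGrading p h χ β e f δ g)
    (hj : ∀ b l, j (b • l) = envMap p h χ b • j l)
    (hu : ∀ (x : 𝔭) (d : ℤ), 0 < d → LieSubalgebra.inclusion h x ∈ g d →
      ∀ l : L, toEnv p 𝔭 (restrictForm h χ) x • l = 0)
    (hgen : Submodule.span (ReducedEnv p 𝔤 χ) (Set.range j) = ⊤) :
    Submodule.span F {z | ∃ (m : ι → ℕ) (l : L), (∀ i ∈ β, m i < p) ∧
      orderedMonomial (fun i => toEnv p 𝔤 χ (f i)) β m • j l = z} = ⊤ := by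
  have h1 : ∀ x : 𝔤, ∀ z ∈ ⨆ d, levelSpan p χ β f δ j d,
      toEnv p 𝔤 χ x • z ∈ ⨆ d, levelSpan p χ β f δ j d := by
    intro x z hz
    have hx : x ∈ ⨆ d, g d := H.iSup_eq_top ▸ Submodule.mem_top
    induction hx using Submodule.iSup_induction' with
    | zero => rw [map_zero, zero_smul]; exact zero_mem _
    | add x y _ _ hx hy => rw [map_add, add_smul]; exact add_mem hx hy
    | mem d x hx =>
      induction hz using Submodule.iSup_induction' with
      | zero => rw [smul_zero]; exact zero_mem _
      | add z z' _ _ hz hz' => rw [smul_add]; exact add_mem hz hz'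
      | mem d' z hz => exact Submodule.mem_iSup_of_mem _ (H.smul_mem_levelSpan hj hu hx hz)
  rw [eq_top_iff]
  have h2 : ⨆ d, levelSpan p χ β f δ j d ≤ Submodule.span F {z | ∃ (m : ι → ℕ) (l : L),
      (∀ i ∈ β, m i < p) ∧ orderedMonomial (fun i => toEnv p 𝔤 χ (f i)) β m • j l = z} := by
    refine iSup_le fun d => Submodule.span_le.mpr ?_
    rintro _ ⟨w, l, hw, -, rfl⟩
    have h3 := wordSpan_le_span_orderedMonomial H.nodup H.commutators_f hp.out.pos H.f_pow_mem _ _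
      (word_mem_wordSpan (F := F) (x := fun i => toEnv p 𝔤 χ (f i)) (wt := fun _ => ()) hw le_rfl
        rfl)
    have h4 := Submodule.mem_map_of_mem (f := ((LinearMap.toSpanSingleton (ReducedEnv p 𝔤 χ) Z
      (j l)).restrictScalars F)) h3
    rw [Submodule.map_span] at h4
    refine Submodule.span_mono ?_ h4
    rintro _ ⟨_, ⟨m, hm, -, -, rfl⟩, rfl⟩
    exact ⟨m, l, hm, rfl⟩
  refine le_trans (fun z _ => ?_) h2
  have hz : z ∈ Submodule.span (ReducedEnv p 𝔤 χ) (Set.range j) := hgen ▸ Submodule.mem_top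
  induction hz using Submodule.span_induction with
  | mem z hz =>
    obtain ⟨l, rfl⟩ := hz
    exact Submodule.mem_iSup_of_mem 0 (map_mem_levelSpan l)
  | zero => exact zero_mem _
  | add z z' _ _ hz hz' => exact add_mem (hz trivial) (hz' trivial)
  | smul a z _ hz => exact smul_mem_of_toEnv_smul_mem _ h1 a (hz trivial)

/-- If `E E'` acts on `j(L)` by the scalar `r`, then every nonzero vector can be moved to `r j(l)` with
`l ≠ 0`: complete a longest monomial of the vector to the top monomial `E'` and apply `E`, which kills
the other terms. -/
theorem exists_smul_eq_map [hp : Fact p.Prime] (H : ParabolicGrading p h χ β e f δ g)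
    (hj : ∀ b l, j (b • l) = envMap p h χ b • j l)
    (hu : ∀ (x : 𝔭) (d : ℤ), 0 < d → LieSubalgebra.inclusion h x ∈ g d →
      ∀ l : L, toEnv p 𝔭 (restrictForm h χ) x • l = 0)
    (hgen : Submodule.span (ReducedEnv p 𝔤 χ) (Set.range j) = ⊤) {r : F}
    (hr : ∀ l, orderedMonomial (fun i => toEnv p 𝔤 χ (e i)) β (fun _ => p - 1) •
      orderedMonomial (fun i => toEnv p 𝔤 χ (f i)) β (fun _ => p - 1) • j l = r • j l)
    {z : Z} (hz : z ≠ 0) :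
    ∃ (a : ReducedEnv p 𝔤 χ) (l : L), l ≠ 0 ∧ a • z = r • j l := by
  classical
  set y : ι → ReducedEnv p 𝔤 χ := fun i => toEnv p 𝔤 χ (f i) with hy
  -- exponents below `p`, as functions on a finite set, extended by zero outside `β`
  let ext : ({i // i ∈ β} → Fin p) → ι → ℕ := fun m i => if hi : i ∈ β then m ⟨i, hi⟩ else 0
  have hrep : ∃ ℓ : ({i // i ∈ β} → Fin p) → L,
      z = ∑ m, orderedMonomial y β (ext m) • j (ℓ m) := by
    have hz' : z ∈ Submodule.span F {z | ∃ (m : ι → ℕ) (l : L), (∀ i ∈ β, m i < p) ∧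
      orderedMonomial y β m • j l = z} :=
        H.span_orderedMonomial_smul_eq_top hj hu hgen ▸ Submodule.mem_top
    clear hz
    induction hz' using Submodule.span_induction with
    | mem z hz =>
      obtain ⟨m, l, hm, rfl⟩ := hz
      let m' : {i // i ∈ β} → Fin p := fun i => ⟨m i, hm i i.2⟩
      refine ⟨Pi.single m' l, ?_⟩
      rw [Finset.sum_eq_single m' (fun k _ hk => by rw [Pi.single_eq_of_ne hk, map_zero, smul_zero])
        (by simp), Pi.single_eq_same]
      congr 1
      refine congrArg List.prod (List.map_congr_left fun i hi => ?_)
      simp [ext, m', hi]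
    | zero => exact ⟨0, by simp⟩
    | add z z' _ _ hz hz' =>
      obtain ⟨ℓ, rfl⟩ := hz
      obtain ⟨ℓ', rfl⟩ := hz'
      exact ⟨ℓ + ℓ', by simp [smul_add, Finset.sum_add_distrib]⟩
    | smul c z _ hz =>
      obtain ⟨ℓ, rfl⟩ := hz
      exact ⟨c • ℓ, by simp [Finset.smul_sum, smul_algebra_smul_comm]⟩
  obtain ⟨ℓ, rfl⟩ := hrep
  obtain ⟨m₀, hm₀, hmax⟩ := Finset.exists_max_image
    (Finset.univ.filter fun m => ℓ m ≠ 0) (fun m => (β.map (ext m)).sum) (by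
      rw [Finset.filter_nonempty_iff]
      by_contra! hcon
      exact hz (Finset.sum_eq_zero fun m hm => by rw [hcon m hm, map_zero, smul_zero]))
  rw [Finset.mem_filter] at hm₀
  have hlt : ∀ m i, i ∈ β → ext m i < p := fun m i hi => by simp [ext, hi]
  have hterm : ∀ m, orderedMonomial (fun i => toEnv p 𝔤 χ (e i)) β (fun _ => p - 1) •
      orderedMonomial y β (fun i => p - 1 - ext m₀ i) • orderedMonomial y β (ext m) • j (ℓ m) =
      topMul p χ β e (j (ℓ m)) (((orderedWord β fun i => p - 1 - ext m₀ i) ++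
        orderedWord β (ext m)).map y).prod := by
    intro m
    rw [List.map_append, List.prod_append, prod_map_orderedWord, prod_map_orderedWord]
    change _ = orderedMonomial (fun i => toEnv p 𝔤 χ (e i)) β (fun _ => p - 1) • (_ * _) • j (ℓ m)
    rw [mul_smul]
  have hsub : ∀ m, (orderedWord β fun i => p - 1 - ext m₀ i) ++ orderedWord β (ext m) ⊆ β :=
    fun m => List.append_subset.mpr ⟨orderedWord_subset _ _, orderedWord_subset _ _⟩
  refine ⟨orderedMonomial (fun i => toEnv p 𝔤 χ (e i)) β (fun _ => p - 1) *
    orderedMonomial y β (fun i => p - 1 - ext m₀ i), ℓ m₀, hm₀.2, ?_⟩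
  rw [mul_smul, Finset.smul_sum, Finset.smul_sum, Finset.sum_eq_single m₀ (fun m _ hm => ?_)
    (by simp), hterm, H.topMul_word_eq_top hj hu ?_]
  · exact hr _
  · refine perm_orderedWord H.nodup (hsub _) fun i hi => ?_
    rw [List.count_append, count_orderedWord H.nodup _ hi, count_orderedWord H.nodup _ hi]
    have := hlt m₀ i hi
    omega
  -- the other terms are words which are no longer than the top one, by the choice of `m₀`, and which
  -- are not rearrangements of it
  · by_cases hℓ : ℓ m = 0
    · rw [hℓ, map_zero, smul_zero, smul_zero, smul_zero]
    rw [hterm]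
    refine H.topMul_word_eq_zero hj hu (hsub _) ?_ (fun hperm => hm (funext fun i => ?_)) _
    · have h1 := hmax m (by simpa using hℓ)
      have h2 : (β.map fun i => p - 1 - ext m₀ i).sum + (β.map (ext m₀)).sum =
          (β.map fun _ => p - 1).sum := by
        rw [← List.sum_map_add]
        refine congrArg List.sum (List.map_congr_left fun i hi => ?_)
        have := hlt m₀ i hi
        omega
      rw [List.length_append, length_orderedWord, length_orderedWord]
      omega
    · have h1 := hperm.count_eq i
      rw [List.count_append, count_orderedWord H.nodup _ i.2, count_orderedWord H.nodup _ i.2,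
        count_orderedWord H.nodup _ i.2] at h1
      have h2 := hlt m₀ i i.2
      have h3 : ∀ m, ext m i = m i := fun m => by simp only [ext, dif_pos i.2]
      rw [h3] at h1 h2
      rw [h3] at h1
      exact Fin.ext (by omega)

/-- A module generated by `j(L)`, with `L` simple, is simple if `E E'` acts on `j(L)` by a nonzero
scalar. -/
theorem isSimpleModule [hp : Fact p.Prime]
    (hL : IsSimpleModule (ReducedEnv p 𝔭 (restrictForm h χ)) L)
    (H : ParabolicGrading p h χ β e f δ g)
    (hj : ∀ b l, j (b • l) = envMap p h χ b • j l) (hinj : Function.Injective j)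
    (hu : ∀ (x : 𝔭) (d : ℤ), 0 < d → LieSubalgebra.inclusion h x ∈ g d →
      ∀ l : L, toEnv p 𝔭 (restrictForm h χ) x • l = 0)
    (hgen : Submodule.span (ReducedEnv p 𝔤 χ) (Set.range j) = ⊤) {r : F} (hr0 : r ≠ 0)
    (hr : ∀ l, orderedMonomial (fun i => toEnv p 𝔤 χ (e i)) β (fun _ => p - 1) •
      orderedMonomial (fun i => toEnv p 𝔤 χ (f i)) β (fun _ => p - 1) • j l = r • j l) :
    IsSimpleModule (ReducedEnv p 𝔤 χ) Z := by
  have := hL.nontrivial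
  have : Nontrivial Z := hinj.nontrivial
  refine (isSimpleModule_iff _ _).mpr { eq_bot_or_eq_top := fun N => ?_ }
  refine or_iff_not_imp_left.mpr fun hN => ?_
  obtain ⟨z, hzN, hz⟩ := N.exists_mem_ne_zero_of_ne_bot hN
  obtain ⟨a, l, hl, ha⟩ := H.exists_smul_eq_map hj hu hgen hr hz
  have hlN : j l ∈ N := by
    have h1 := N.smul_mem (algebraMap F (ReducedEnv p 𝔤 χ) r⁻¹) (N.smul_mem a hzN)
    rwa [ha, algebraMap_smul, inv_smul_smul₀ hr0] at h1
  let N' : Submodule (ReducedEnv p 𝔭 (restrictForm h χ)) L :=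
    { carrier := {l | j l ∈ N}
      add_mem' := fun {a b} ha hb => by
        rw [Set.mem_ofPred_eq, map_add]; exact N.add_mem ha hb
      zero_mem' := by rw [Set.mem_ofPred_eq, map_zero]; exact N.zero_mem
      smul_mem' := fun b l hl => by
        rw [Set.mem_ofPred_eq, hj]; exact N.smul_mem _ hl }
  have hN' : N' = ⊤ := by
    refine (eq_bot_or_eq_top N').resolve_left fun h0 => hl ?_
    rw [← Submodule.mem_bot (ReducedEnv p 𝔭 (restrictForm h χ)), ← h0]
    exact hlN
  rw [eq_top_iff, ← hgen, Submodule.span_le]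
  rintro _ ⟨l', rfl⟩
  exact (hN' ▸ Submodule.mem_top : l' ∈ N')

end ParabolicGrading

/-! ### The parabolic grading of a reductive Lie algebra -/

section ReductiveGrading

variable {F : Type*} [Field F] {n : ℕ} {G : Subgroup (GL (Fin n) F)} {T : MaximalTorus G}
  {ι : Type*} {R : RootPairing ι ℤ (CharLattice T) (CocharLattice T)} {b : R.Base} {I : Finset ι}
  {e f : ι → lieAlg G} {β : List ι} {δ : ι → ℕ}

theorem mem_span_singleton_of_coe {x y : lieAlg G} (h : (x : Matrix (Fin n) (Fin n) F) ∈
    Submodule.span F {(y : Matrix (Fin n) (Fin n) F)}) : ∃ c : F, x = c • y := by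
  obtain ⟨c, hc⟩ := Submodule.mem_span_singleton.mp h
  exact ⟨c, Subtype.ext hc.symm⟩

/-- An element of degree zero and of nonzero weight maps each root line to zero or into a different
root line of the same degree: its diagonal coefficients are zero. -/
theorem actsOppositely_of_ne_zero (hR : IsRootDatumOf T R) (hI : I ⊆ b.support)
    (he : ∀ i, IsPositive b i →
      Submodule.span F {(e i : Matrix (Fin n) (Fin n) F)} = weightSpace T (R.root i))
    (hf : ∀ i, IsPositive b i →
      Submodule.span F {(f i : Matrix (Fin n) (Fin n) F)} = weightSpace T (-R.root i))
    (hβ : ∀ i, i ∈ β ↔ IsPositive b i ∧ ¬ InLevi R I i)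
    (hδ : ∀ i ∈ β, HasDegree b I (R.root i) (δ i) ∧ 0 < δ i) {μ : CharLattice T} (hμ : μ ≠ 0)
    (hμ0 : HasDegree b I μ 0) {x : lieAlg G}
    (hx : (x : Matrix (Fin n) (Fin n) F) ∈ weightSpace T μ) : ActsOppositely β e f δ x := by
  have key : ∀ i ∈ β, ∀ k, HasDegree b I (R.root k) (δ i) → R.root k ≠ R.root i →
      IsPositive b k ∧ k ∈ {k | k ∈ β ∧ δ k = δ i ∧ k ≠ i} := by
    intro i hi k hk hki
    have h1 := (hδ i hi).2
    have hpos := isPositive_of_hasDegree_pos hk (by omega)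
    have hkβ := (hβ k).mpr ⟨hpos, not_inLevi_of_hasDegree hI hk (by omega)⟩
    exact ⟨hpos, hkβ, by exact_mod_cast (hδ k hkβ).1.unique hk, fun h => hki (by rw [h])⟩
  refine ⟨fun _ => 0, fun i hi => ⟨?_, ?_⟩⟩
  · rw [zero_smul, sub_zero]
    have hei : (e i : Matrix (Fin n) (Fin n) F) ∈ weightSpace T (R.root i) := by
      rw [← he i ((hβ i).mp hi).1]; exact Submodule.mem_span_singleton_self _
    have hmem := lie_mem_weightSpace T hx hei
    have hdeg := hμ0.add (hδ i hi).1
    rw [zero_add] at hdeg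
    by_cases h0 : ⁅(x : Matrix (Fin n) (Fin n) F), (e i : Matrix (Fin n) (Fin n) F)⁆ = 0
    · rw [show ⁅x, e i⁆ = 0 from Subtype.ext h0]; exact zero_mem _
    obtain ⟨k, hk⟩ := exists_root_of_hasDegree_ne_zero hR hdeg
      (by have := (hδ i hi).2; omega) hmem h0
    rw [← hk] at hmem hdeg
    obtain ⟨hpos, hkm⟩ := key i hi k hdeg (by rw [hk]; simpa using hμ)
    rw [← he k hpos] at hmem
    obtain ⟨c, hc⟩ := mem_span_singleton_of_coe (x := ⁅x, e i⁆) hmem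
    rw [hc]
    exact Submodule.smul_mem _ _ (Submodule.subset_span ⟨k, hkm, rfl⟩)
  · rw [neg_zero, zero_smul, sub_zero]
    have hfi : (f i : Matrix (Fin n) (Fin n) F) ∈ weightSpace T (-R.root i) := by
      rw [← hf i ((hβ i).mp hi).1]; exact Submodule.mem_span_singleton_self _
    have hmem := lie_mem_weightSpace T hx hfi
    have hdeg := hμ0.add (hδ i hi).1.neg
    rw [zero_add] at hdeg
    by_cases h0 : ⁅(x : Matrix (Fin n) (Fin n) F), (f i : Matrix (Fin n) (Fin n) F)⁆ = 0
    · rw [show ⁅x, f i⁆ = 0 from Subtype.ext h0]; exact zero_mem _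
    obtain ⟨k', hk'⟩ := exists_root_of_hasDegree_ne_zero hR hdeg
      (by have := (hδ i hi).2; omega) hmem h0
    obtain ⟨k, hk⟩ := exists_root_eq_neg (R := R) k'
    rw [hk'] at hk
    have hdeg' := hdeg.neg
    rw [← hk, neg_neg] at hdeg'
    rw [show μ + -R.root i = -R.root k by rw [hk, neg_neg]] at hmem
    obtain ⟨hpos, hkm⟩ := key i hi k hdeg' (by rw [hk]; simpa using hμ)
    rw [← hf k hpos] at hmem
    obtain ⟨c, hc⟩ := mem_span_singleton_of_coe (x := ⁅x, f i⁆) hmem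
    rw [hc]
    exact Submodule.smul_mem _ _ (Submodule.subset_span ⟨k, hkm, rfl⟩)

theorem root_ne_zero (hR : IsRootDatumOf T R) (i : ι) : R.root i ≠ 0 := by
  have : R.root i ∈ Set.range R.root := ⟨i, rfl⟩
  rw [hR.roots] at this
  exact this.1

theorem root_vector_ne_zero (hR : IsRootDatumOf T R) {i : ι} {x : Matrix (Fin n) (Fin n) F}
    (hx : Submodule.span F {x} = weightSpace T (R.root i)) : x ≠ 0 := by
  rintro rfl
  have : R.root i ∈ Set.range R.root := ⟨i, rfl⟩
  rw [hR.roots] at this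
  exact this.2 (by rw [← hx, Submodule.span_zero_singleton])

/-- The Cartan subalgebra acts on opposite root vectors by opposite scalars. -/
theorem actsOppositely_of_mem_cartan (hR : IsRootDatumOf T R) (hG : HasInvariantForm G)
    (he : ∀ i, IsPositive b i →
      Submodule.span F {(e i : Matrix (Fin n) (Fin n) F)} = weightSpace T (R.root i))
    (hf : ∀ i, IsPositive b i →
      Submodule.span F {(f i : Matrix (Fin n) (Fin n) F)} = weightSpace T (-R.root i))
    (hβ : ∀ i, i ∈ β ↔ IsPositive b i ∧ ¬ InLevi R I i) {x : lieAlg G}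
    (hx : (x : Matrix (Fin n) (Fin n) F) ∈ cartan T) : ActsOppositely β e f δ x := by
  have h1 : ∀ i, i ∈ β → ∃ c : F, ⁅x, e i⁆ = c • e i ∧ ⁅x, f i⁆ = (-c) • f i := by
    intro i hi
    have hpos := ((hβ i).mp hi).1
    have hei : (e i : Matrix (Fin n) (Fin n) F) ∈ weightSpace T (R.root i) := by
      rw [← he i hpos]; exact Submodule.mem_span_singleton_self _
    have hfi : (f i : Matrix (Fin n) (Fin n) F) ∈ weightSpace T (-R.root i) := by
      rw [← hf i hpos]; exact Submodule.mem_span_singleton_self _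
    have hme := lie_mem_weightSpace T hx hei
    have hmf := lie_mem_weightSpace T hx hfi
    rw [zero_add, ← he i hpos] at hme
    rw [zero_add, ← hf i hpos] at hmf
    obtain ⟨c, hc⟩ := mem_span_singleton_of_coe (x := ⁅x, e i⁆) hme
    obtain ⟨c', hc'⟩ := mem_span_singleton_of_coe (x := ⁅x, f i⁆) hmf
    refine ⟨c, hc, ?_⟩
    have := add_eq_zero_of_lie_eq_smul hG
      (fun h => root_vector_ne_zero hR (he i hpos) (congrArg Subtype.val h)) hei (hf i hpos) hc hc'
    rw [hc', eq_neg_of_add_eq_zero_right this]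
  choose! c hc using h1
  refine ⟨c, fun i hi => ⟨?_, ?_⟩⟩
  · rw [(hc i hi).1, sub_self]; exact zero_mem _
  · rw [(hc i hi).2, sub_self]; exact zero_mem _

/-- The grading of `𝔤` attached to a set of simple roots: the degree of a root is the sum of its
coefficients at the other simple roots. -/
theorem parabolicGrading_degreeSpace {p : ℕ} [Fact p.Prime] [CharP F p] (hR : IsRootDatumOf T R)
    (H2 : IsGoodPrime p b) (H3 : HasInvariantForm G) {χ : Module.Dual F (lieAlg G)}
    (hχ : ∀ i, IsPositive b i → ∀ x : lieAlg G,
      (x : Matrix (Fin n) (Fin n) F) ∈ weightSpace T (R.root i) → χ x = 0)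
    (hI : I ⊆ b.support)
    (he : ∀ i, IsPositive b i →
      Submodule.span F {(e i : Matrix (Fin n) (Fin n) F)} = weightSpace T (R.root i))
    (hf : ∀ i, IsPositive b i →
      Submodule.span F {(f i : Matrix (Fin n) (Fin n) F)} = weightSpace T (-R.root i))
    (hβ_nodup : β.Nodup) (hβ : ∀ i, i ∈ β ↔ IsPositive b i ∧ ¬ InLevi R I i)
    (hδ : ∀ i ∈ β, HasDegree b I (R.root i) (δ i) ∧ 0 < δ i) :
    ParabolicGrading p (parabolic_le hR b I hI) χ β e f δ (degreeSpace b I) := by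
  have hei : ∀ i ∈ β, (e i : Matrix (Fin n) (Fin n) F) ∈ weightSpace T (R.root i) := fun i hi => by
    rw [← he i ((hβ i).mp hi).1]; exact Submodule.mem_span_singleton_self _
  have hfi : ∀ i ∈ β, (f i : Matrix (Fin n) (Fin n) F) ∈ weightSpace T (-R.root i) :=
    fun i hi => by rw [← hf i ((hβ i).mp hi).1]; exact Submodule.mem_span_singleton_self _
  have hpow : ∀ (x : lieAlg G) (i : ι), (x : Matrix (Fin n) (Fin n) F) ∈ weightSpace T (R.root i) →
      toEnv p (lieAlg G) χ x ^ p = algebraMap F _ (χ x ^ p) := fun x i hx => by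
    rw [toEnv_pow p _ χ x 0 (by rw [pow_eq_zero_of_mem_weightSpace_root hR H2 hx]; rfl), map_zero,
      zero_add]
  refine
    { nodup := hβ_nodup
      degree_pos := fun i hi => (hδ i hi).2
      lie_mem := lie_mem_degreeSpace
      iSup_eq_top := iSup_degreeSpace hR
      mem_of_nonneg := fun hd x hx => mem_parabolic_of_mem_degreeSpace hR hI hd hx
      le_span_of_pos := fun hd => (degreeSpace_le_span_of_pos hR hI he hd).trans
        (Submodule.span_mono (Set.image_mono fun i hi =>
          ⟨(hβ i).mpr hi.1, (hδ i ((hβ i).mpr hi.1)).1.unique hi.2⟩))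
      le_span_of_neg := fun hd => (degreeSpace_le_span_of_neg hR hI hf hd).trans
        (Submodule.span_mono (Set.image_mono fun i hi =>
          ⟨(hβ i).mpr hi.1, (hδ i ((hβ i).mpr hi.1)).1.unique hi.2⟩))
      e_mem := fun i hi => mem_degreeSpace (hδ i hi).1 (hei i hi)
      f_mem := fun i hi => mem_degreeSpace (hδ i hi).1.neg (hfi i hi)
      e_pow := fun i hi => ?_
      f_pow := fun i hi => ?_
      mem_span := fun x => ?_ }
  · rw [hpow _ i (hei i hi), hχ i ((hβ i).mp hi).1 _ (hei i hi),
      zero_pow (Fact.out : p.Prime).ne_zero, map_zero]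
  · obtain ⟨k, hk⟩ := exists_root_eq_neg (R := R) i
    exact ⟨_, hpow _ k (hk ▸ hfi i hi)⟩
  · set S : Set (parabolic hR b I hI) := {x | (∃ d : ℤ, 0 < d ∧
      LieSubalgebra.inclusion (parabolic_le hR b I hI) x ∈ degreeSpace b I d) ∨
      LieSubalgebra.inclusion (parabolic_le hR b I hI) x ∈ degreeSpace b I 0 ∧
        ActsOppositely β e f δ (LieSubalgebra.inclusion (parabolic_le hR b I hI) x)} with hS
    have hle : (parabolic hR b I hI).toSubmodule ≤
        Submodule.map (parabolic hR b I hI).toSubmodule.subtype (Submodule.span F S) := by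
      intro y hy
      have hy' : y ∈ levi R I ⊔ nilradical b I := hy
      rw [levi_sup_nilradical] at hy'
      refine (iSup₂_le fun μ hμ z hz => ?_ :
        (⨆ μ ∈ parabolicWeights b I, weightSpace T μ) ≤ _) hy'
      have hz𝔭 : z ∈ parabolic hR b I hI := by
        rw [mem_parabolic, levi_sup_nilradical]
        exact Submodule.mem_iSup_of_mem μ (Submodule.mem_iSup_of_mem hμ hz)
      refine ⟨⟨z, hz𝔭⟩, Submodule.subset_span ?_, rfl⟩
      rcases hμ with rfl | ⟨i, rfl, hi⟩
      · exact Or.inr ⟨mem_degreeSpace HasDegree.zero hz,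
          actsOppositely_of_mem_cartan hR H3 he hf hβ hz⟩
      · have hdeg : ∃ d : ℕ, HasDegree b I (R.root i) d := by
          rcases hi with hi | hi
          · exact ⟨0, hasDegree_of_inLevi hI hi⟩
          · obtain ⟨d, hd, -⟩ := exists_hasDegree_of_isPositive (I := I) hi
            exact ⟨d, hd⟩
        obtain ⟨d, hd⟩ := hdeg
        rcases d.eq_zero_or_pos with rfl | hd0
        · exact Or.inr ⟨mem_degreeSpace hd hz,
            actsOppositely_of_ne_zero hR hI he hf hβ hδ (root_ne_zero hR i) hd hz⟩
        · exact Or.inl ⟨d, by exact_mod_cast hd0, mem_degreeSpace hd hz⟩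
    obtain ⟨y, hy, hyx⟩ := hle x.2
    rwa [← Subtype.ext hyx]

end ReductiveGrading

/-! ### Induced modules -/

section Induced

open scoped TensorProduct

variable {F A B L : Type*} [Field F] [Ring A] [Algebra F A] [Ring B] [Algebra F B]
  [AddCommGroup L] [Module F L] [Module B L] (φ : B →ₐ[F] A)

theorem smul_induced_tmul (a a' : A) (l : L) :
    a • Induced.tmul φ a' l = Induced.tmul φ (a * a') l := rfl

theorem induced_tmul_mul (a : A) (b : B) (l : L) :
    Induced.tmul φ (a * φ b) l = Induced.tmul φ a (b • l) := by
  unfold Induced.tmul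
  rw [← sub_eq_zero, ← map_sub, Submodule.mkQ_apply, Submodule.Quotient.mk_eq_zero]
  exact Submodule.subset_span ⟨a, b, l, rfl⟩

/-- The linear map `l ↦ 1 ⊗ l` into the induced module. -/
noncomputable def inducedOne (L : Type*) [AddCommGroup L] [Module F L] [Module B L] :
    L →ₗ[F] Induced φ L :=
  ((inducedRel φ L).mkQ.restrictScalars F).comp (TensorProduct.mk F A L 1)

theorem inducedOne_apply (l : L) : inducedOne φ L l = Induced.tmul φ 1 l := rfl

theorem inducedOne_smul (b : B) (l : L) : inducedOne φ L (b • l) = φ b • inducedOne φ L l := by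
  rw [inducedOne_apply, inducedOne_apply, smul_induced_tmul, mul_one, ← induced_tmul_mul, one_mul]

theorem span_range_inducedOne : Submodule.span A (Set.range (inducedOne φ L)) = ⊤ := by
  rw [eq_top_iff]
  rintro z -
  obtain ⟨t, rfl⟩ := (inducedRel φ L).mkQ_surjective z
  induction t using TensorProduct.induction_on with
  | zero => rw [map_zero]; exact zero_mem _
  | add t t' h h' => rw [map_add]; exact add_mem h h'
  | tmul a l =>
    change Induced.tmul φ a l ∈ _
    rw [← mul_one a, ← smul_induced_tmul]
    exact Submodule.smul_mem _ _ (Submodule.subset_span ⟨l, rfl⟩)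

end Induced

/-- The product of the top monomials acts on `1 ⊗ v` by a unique scalar, and the induced module is
simple if it is nonzero, for any Lie algebra with a parabolic grading. Finite-dimensionality of `L`,
needed for Schur's lemma, holds as `L` is a quotient of the finite-dimensional algebra `u_χ(𝔭)`. -/
theorem ParabolicGrading.induced_isSimpleModule {F : Type*} [Field F] [IsAlgClosed F] {p : ℕ}
    [Fact p.Prime] [CharP F p] {n : ℕ} {𝔭 𝔤 : LieSubalgebra F (Matrix (Fin n) (Fin n) F)}
    {h : 𝔭 ≤ 𝔤} {χ : Module.Dual F 𝔤} {ι : Type*} {β : List ι} {e f : ι → 𝔤} {δ : ι → ℕ}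
    {g : ℤ → Submodule F 𝔤} (H : ParabolicGrading p h χ β e f δ g)
    (h𝔤 : ∀ x ∈ 𝔤, x ^ p ∈ 𝔤)
    (h𝔭 : 𝔭.toSubmodule ≤ Submodule.span F {x | x ∈ 𝔭 ∧ x ^ p ∈ 𝔭})
    {L : Type*} [AddCommGroup L] [Module F L] [Module (ReducedEnv p 𝔭 (restrictForm h χ)) L]
    [IsScalarTower F (ReducedEnv p 𝔭 (restrictForm h χ)) L]
    (hL : IsSimpleModule (ReducedEnv p 𝔭 (restrictForm h χ)) L) {v : L} (hv : v ≠ 0)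
    (hev : ∀ i ∈ β, ∀ x : 𝔭, (e i : Matrix (Fin n) (Fin n) F) = x →
      toEnv p 𝔭 (restrictForm h χ) x • v = 0) {φ : ReducedEnv p 𝔭 (restrictForm h χ) →ₐ[F]
        ReducedEnv p 𝔤 χ} (hφ : φ = envMap p h χ) {E E' : ReducedEnv p 𝔤 χ}
    (hE : E = orderedMonomial (fun i => toEnv p 𝔤 χ (e i)) β fun _ => p - 1)
    (hE' : E' = orderedMonomial (fun i => toEnv p 𝔤 χ (f i)) β fun _ => p - 1) :
    (∃! r : F, (E * E') • Induced.tmul φ 1 v = r • Induced.tmul φ 1 v) ∧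
      ∀ r : F, (E * E') • Induced.tmul φ 1 v = r • Induced.tmul φ 1 v → r ≠ 0 →
        IsSimpleModule (ReducedEnv p 𝔤 χ) (Induced φ L) := by
  subst hφ hE hE'
  have hu := H.toEnv_smul_eq_zero hL hv hev
  have hinj : Function.Injective (inducedOne (envMap p h χ) L) :=
    (injective_iff_map_eq_zero _).mpr fun l hl => induced_tmul_one_injective h χ h𝔤 h𝔭 hl
  have : FiniteDimensional F L := by
    have := finite_reducedEnv (χ := restrictForm h χ) h𝔭
    exact Module.Finite.of_surjective ((LinearMap.toSpanSingleton
      (ReducedEnv p 𝔭 (restrictForm h χ)) L v).restrictScalars F)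
      (IsSimpleModule.toSpanSingleton_surjective _ hv)
  have hj := inducedOne_smul (envMap p h χ) (L := L)
  obtain ⟨r, hr⟩ := H.exists_top_mul_top_smul_eq hL hj hinj hu
  have hrv := hr v
  rw [← mul_smul] at hrv
  have hv0 : inducedOne (envMap p h χ) L v ≠ 0 := (map_ne_zero_iff _ hinj).mpr hv
  simp only [← inducedOne_apply]
  have huniq : ∀ s : F, _ = s • inducedOne (envMap p h χ) L v → s = r :=
    fun s hs => smul_left_injective F hv0 (hs.symm.trans hrv)
  refine ⟨⟨r, hrv, huniq⟩, fun s hs hs0 => ?_⟩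
  rw [huniq s hs] at hs0
  exact H.isSimpleModule hL hj hinj hu (span_range_inducedOne _) hs0 hr

theorem theorem2p10 {F : Type*} [Field F] [IsAlgClosed F] (p : ℕ) [Fact p.Prime] [CharP F p]
    {n : ℕ} (G : Subgroup (GL (Fin n) F)) (hG : IsReductive G) (T : MaximalTorus G)
    {ι : Type*} [Finite ι] (R : RootPairing ι ℤ (CharLattice T) (CocharLattice T)) (hR : IsRootDatumOf T R)
    (b : R.Base)
    (H1 : DerivedSimplyConnected R) (H2 : IsGoodPrime p b) (H3 : HasInvariantForm G)
    (χ : Module.Dual F (lieAlg G))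
    (hχ : ∀ i, IsPositive b i → ∀ x : lieAlg G,
      (x : Matrix (Fin n) (Fin n) F) ∈ weightSpace T (R.root i) → χ x = 0)
    (I : Finset ι) (hI : I ⊂ b.support)
    (L : Type*) [AddCommGroup L] [Module F L]
    [Module (ReducedEnv p (parabolic hR b I hI.1)
      (restrictForm (parabolic_le hR b I hI.1) χ)) L]
    [IsScalarTower F (ReducedEnv p (parabolic hR b I hI.1)
      (restrictForm (parabolic_le hR b I hI.1) χ)) L]
    (hL : IsSimpleModule (ReducedEnv p (parabolic hR b I hI.1)
      (restrictForm (parabolic_le hR b I hI.1) χ)) L)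
    (lam : Module.Dual F (cartan T)) (v : L) (hv : v ≠ 0)
    (hv_max : ∀ i, IsPositive b i → ∀ x : parabolic hR b I hI.1,
      (x : Matrix (Fin n) (Fin n) F) ∈ weightSpace T (R.root i) →
        toEnv p _ (restrictForm (parabolic_le hR b I hI.1) χ) x • v = 0)
    (hv_wt : ∀ (x : parabolic hR b I hI.1) (hx : (x : Matrix (Fin n) (Fin n) F) ∈ cartan T),
      toEnv p _ (restrictForm (parabolic_le hR b I hI.1) χ) x • v = lam ⟨x, hx⟩ • v)
    (e f : ι → lieAlg G)
    (he : ∀ i, IsPositive b i →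
      Submodule.span F {(e i : Matrix (Fin n) (Fin n) F)} = weightSpace T (R.root i))
    (hf : ∀ i, IsPositive b i →
      Submodule.span F {(f i : Matrix (Fin n) (Fin n) F)} = weightSpace T (-R.root i))
    (β : List ι) (hβ_nodup : β.Nodup) (hβ : ∀ i, i ∈ β ↔ IsPositive b i ∧ ¬ InLevi R I i)
    (hβ_height : β.Pairwise fun i j => b.height i ≤ b.height j) :
    let φ := envMap p (parabolic_le hR b I hI.1) χ
    let E := (β.map fun i => toEnv p _ χ (e i) ^ (p - 1)).prod
    let E' := (β.map fun i => toEnv p _ χ (f i) ^ (p - 1)).prod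
    (∃! r : F, (E * E') • Induced.tmul φ 1 v = r • Induced.tmul φ 1 v) ∧
      ∀ r : F, (E * E') • Induced.tmul φ 1 v = r • Induced.tmul φ 1 v → r ≠ 0 →
        IsSimpleModule (ReducedEnv p (lieAlg G) χ) (Induced φ L) := by
  intro φ E E'
  have hδ : ∀ i, i ∈ β → ∃ d : ℕ, HasDegree b I (R.root i) d ∧ 0 < d := fun i hi => by
    obtain ⟨d, hd, hpos⟩ := exists_hasDegree_of_isPositive (I := I) ((hβ i).mp hi).1
    exact ⟨d, hd, hpos ((hβ i).mp hi).2⟩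
  choose! δ hδ using hδ
  exact (parabolicGrading_degreeSpace hR H2 H3 hχ hI.1 he hf hβ_nodup hβ hδ).induced_isSimpleModule
    (fun _ => pow_mem_lieAlg p G) (parabolic_le_span_pow_mem hR hI.1 H2) hL hv (fun i hi x hx =>
      hv_max i ((hβ i).mp hi).1 x (by
        rw [← he i ((hβ i).mp hi).1, ← hx]; exact Submodule.mem_span_singleton_self _)) rfl rfl rfl
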